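/- **Setting.** A context-free grammar $\mathcal G=(\mathcal V,\mathcal N,\mathcal P,\mathcal S)$ with finite set $\mathcal N$ of non-terminals is in *binary Chomsky normal form* (BCNF) if every non-terminal $N$ is productive and has exactly the production(s) of one of the types $N\to N'.N''$ (product), $N\to N'\mid N''$ with $N'\neq N''$ (union), $N\to t$ with $t\in\mathcal V$ (terminal), $N\to\varepsilon$ (epsilon); moreover no non-terminal of epsilon type is reachable from a self-referential non-terminal, and $\varepsilon\notin\mathcal L(N')$, $\varepsilon\notin\mathcal L(N'')$ for every product $N\to N'.N''$. A weighting $\pi:\mathcal V\to\mathbb R_{>0}$ extends to words by $\pi(w)=\prod_i\pi(w_i)$ and to finite languages by summation. *Immature words* are words over $\mathcal V\cup(\mathcal N\times\mathbb N)$, where $N_m$ stands for $\mathcal L(N)_m$, the words of length $m$ derivable from $N$; a *derivation policy* $\phi$ points to one non-terminal of each immature word that has one. Atomic derivations are $N_m\Rightarrow N'_i.N''_{m-i}$ ($1\le i\le m-1$), $N_m\Rightarrow N'_m$ or $N''_m$, $N_1\Rightarrow t$, $N_0\Rightarrow\varepsilon$. The grammar is *unambiguous* if, for a derivation policy, every $w\in\mathcal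 V^*$ has at most one sequence of consistent atomic derivations from $\mathcal S_{|w|}$ to $w$ (its *parse walk*). **Algorithm.** (a) For each $N\in\mathcal N$, a table of $\pi(\mathcal L(N)_m)$, $0\le m\le n$, is computed from a fixed linear recurrence in $m$ with polynomial coefficients and finitely many initial values (fixed with the weighted grammar, independently of $n$ and $k$; for $N$ not reachable from $\mathcal S$ the entries are irrelevant). (b) $k$ times, a word is drawn, the set $\mathcal F$ of forbidden words consisting of the words already drawn. Starting from $\omega=\mathcal S_n$ and $\mu=\pi(\mathcal S_n)$, with $\pi(\omega):=\pi(\mathcal L(\omega))$ and $\overline\pi(\omega):=\pi(\mathcal L(\omega)\cap\mathcal F)$: if $\mu\le\overline\pi(\omega)$, return an error; if $\omega$ has no non-terminal, return it; otherwise draw $r$ uniformly in $[0,\mu-\overline\pi(\omega))$ and let $N_m$ be the non-terminal pointed to by $\phi$; go through the words $\omega_i$ derived atomically from $\omega$ at this place (for a product, in Boustrophedon order $i=1,m-1,2,m-2,\dots$), with weights $\mu_i=\mu\,\pi(N'_m)/\pi(N_m)$, $\mu\,\pi(N''_m)/\pi(N_m)$ (union), $\mu\,\pi(N'_i)\pi(N''_{m-i})/\pi(N_m)$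 (product), $\mu$ (terminal), subtract $\mu_i-\overline\pi(\omega_i)$ from $r$, and continue with the first $(\omega_i,\mu_i)$ for which $r$ becomes negative. (c) The numbers $\overline\pi(\omega)$ are stored in the prefix tree of the parse walks of the words in $\mathcal F$; a unary node shares its stored number with its child. After each word, the missing nodes of its walk are added and the numbers on the walk are updated. Additions, subtractions, multiplications, divisions and comparisons of real numbers, draws of a random number, accesses to the tree and copies of an initial value of a recurrence into the table count as one operation each. **Theorem.** Let $\mathcal G$ be an unambiguous BCNF grammar. There is a constant $b$ depending only on $\mathcal G$, and for every weighting $\pi$ there are a constant $c$ and recurrences as in (a), depending only on $(\mathcal G,\pi)$, such that for every derivation policy $\phi$ and all integers $n,k\ge1$ with $k\le|\mathcal L(\mathcal G)_n|$, every run of the algorithm ends without error, returns $k$ distinct words of $\mathcal L(\mathcal G)_n$, and - performs at most $c\,n|\mathcal N|+b\,k\,n\log n$ operations, i.e. $\mathcal O(n|\mathcal N|+k\,n\log n)$; - stores at most $c\,n|\mathcal N|+b\,k$ numbers (the recurrences, the tables and the numbers in the tree), i.e. $\mathcal O(n|\mathcal N|+k)$; - builds a prefix tree with at least $n+k$ and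 at most $b\,n\,k$ nodes. Moreover, distinct $\sigma_1,\dots,\sigma_k\in\mathcal L(\mathcal G)_n$ are generated in this order with probability $$\prod_{i=1}^k\frac{\pi(\sigma_i)}{\pi(\mathcal L(\mathcal G)_n)-\sum_{j<i}\pi(\sigma_j)}.$$ The bound on the tree is of the exact worst-case order $\Theta(n\cdot k)$: there are an unambiguous BCNF grammar $\mathcal G$ with $|\mathcal L(\mathcal G)_n|\to\infty$, a policy $\phi$ and $\varepsilon>0$ such that, for every weighting, all recurrences as in (a) and all $n,k\ge1$ with $k\le|\mathcal L(\mathcal G)_n|$, every run builds a tree with at least $\varepsilon\,n\,k$ nodes. -/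

import Mathlib

noncomputable section

/-! ## Grammars in binary Chomsky normal form -/

/-- The four shapes of productions of a grammar in binary Chomsky normal form. -/
inductive BRule (T N : Type) : Type
  /-- `A → B.C` -/
  | product (B C : N)
  /-- `A → B | C` -/
  | union (B C : N)
  /-- `A → t` -/
  | terminal (t : T)
  /-- `A → ε` -/
  | epsilon

/-- The productions of a binary grammar: every nonterminal has one rule of one of the four shapes
(a union rule stands for two productions). -/
structure BGrammar (T N : Type) where
  /-- the initial nonterminal -/
  start : N
  /-- the rule of each nonterminal -/
  rule : N → BRule T N

namespace BRule

/-- The nonterminals on the right-hand side of a rule. -/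
def operands {T N : Type} : BRule T N → List N
  | product B C => [B, C]
  | union B C => [B, C]
  | terminal _ => []
  | epsilon => []

/-- The right-hand sides of the productions a rule stands for. -/
def outputs {T N : Type} : BRule T N → List (List (Symbol T N))
  | product B C => [[Symbol.nonterminal B, Symbol.nonterminal C]]
  | union B C => [[Symbol.nonterminal B], [Symbol.nonterminal C]]
  | terminal t => [[Symbol.terminal t]]
  | epsilon => [[]]

end BRule

namespace BGrammar

open scoped Classical in
/-- The context-free grammar given by a binary grammar. -/
def toCFG {T N : Type} [Fintype N] (G : BGrammar T N) : ContextFreeGrammar T where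
  NT := N
  initial := G.start
  rules := Finset.univ.biUnion fun A =>
    ((G.rule A).outputs.map fun x => (⟨A, x⟩ : ContextFreeRule T N)).toFinset

/-- The language of words over the terminals that can be derived from the nonterminal `A`. -/
def lang {T N : Type} [Fintype N] (G : BGrammar T N) (A : N) : Set (List T) :=
  {w | G.toCFG.Derives [Symbol.nonterminal A] (w.map Symbol.terminal)}

/-- The words of length `n` in the language of `A`. -/
def langLen {T N : Type} [Fintype N] (G : BGrammar T N) (A : N) (n : ℕ) : Set (List T) :=
  {w | w ∈ G.lang A ∧ w.length = n}

/-- The words of length `n` in the language of the grammar. -/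
def words {T N : Type} [Fintype N] (G : BGrammar T N) (n : ℕ) : Set (List T) :=
  {w | w ∈ G.toCFG.language ∧ w.length = n}

/-- `B` occurs in the rule of `A`. -/
def Dep {T N : Type} (G : BGrammar T N) (A B : N) : Prop := B ∈ (G.rule A).operands

/-- `B` can be reached from `A` through the rules. -/
def Reaches {T N : Type} (G : BGrammar T N) : N → N → Prop := Relation.ReflTransGen G.Dep

/-- `A` is self-referential. -/
def SelfRef {T N : Type} (G : BGrammar T N) (A : N) : Prop := Relation.TransGen G.Dep A A

/-- Binary Chomsky normal form. Besides the shape of the rules: the two productions of a union are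
different, every nonterminal is productive, an epsilon-type nonterminal cannot be reached from a
self-referential one, and the empty word occurs only through unions, never in an operand of a
product. -/
structure IsBCNF {T N : Type} [Fintype N] (G : BGrammar T N) : Prop where
  union_ne : ∀ A B C, G.rule A = BRule.union B C → B ≠ C
  productive : ∀ A, (G.lang A).Nonempty
  epsilon_not_selfRef : ∀ E, G.rule E = BRule.epsilon → ∀ A, G.SelfRef A → ¬ G.Reaches A E
  product_pos : ∀ A B C, G.rule A = BRule.product B C → [] ∉ G.lang B ∧ [] ∉ G.lang C

end BGrammar

/-! ## Weights -/

/-- The weight of a word: the product of the weights of its letters. -/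
def wordWeight {T : Type} (wt : T → ℝ) (w : List T) : ℝ := (w.map wt).prod

/-- The weight of a (finite) set of words: the sum of the weights of its elements. -/
def langWeight {T : Type} (wt : T → ℝ) (L : Set (List T)) : ℝ := ∑ᶠ w ∈ L, wordWeight wt w

/-! ## Immature words, derivation policies, unambiguity -/

/-- Symbols of immature words: a nonterminal carries the prescribed length of the factor that it
has to generate (the length of a terminal is 1). -/
inductive ISym (T N : Type) : Type
  | ter (t : T)
  | non (A : N) (m : ℕ)

/-- Immature words. -/
abbrev IWord (T N : Type) : Type := List (ISym T N)

/-- Replace the symbol at position `i` by the word `x`. -/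
def IWord.replace {T N : Type} (ω : IWord T N) (i : ℕ) (x : IWord T N) : IWord T N :=
  ω.take i ++ x ++ ω.drop (i + 1)

/-- The terminals of an immature word, in order. -/
def IWord.letters {T N : Type} (ω : IWord T N) : List T :=
  ω.filterMap fun s => match s with
    | ISym.ter t => some t
    | ISym.non _ _ => none

/-- A derivation policy points to (the position of) a nonterminal of an immature word, and to
nothing in a mature word, i.e. one without nonterminals. -/
structure Policy (T N : Type) where
  /-- the position pointed to -/
  pos : IWord T N → Option ℕ
  pos_none : ∀ ω : IWord T N, pos ω = none ↔ ∀ A m, ISym.non A m ∉ ω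
  pos_some : ∀ (ω : IWord T N) (i : ℕ), pos ω = some i → ∃ A m, ω[i]? = some (ISym.non A m)

namespace BGrammar

/-- `x` is the result of applying a production to the nonterminal `A` with prescribed length
`m`. -/
def Expands {T N : Type} (G : BGrammar T N) (A : N) (m : ℕ) (x : IWord T N) : Prop :=
  match G.rule A with
  | BRule.product B C => ∃ i, 1 ≤ i ∧ i < m ∧ x = [ISym.non B i, ISym.non C (m - i)]
  | BRule.union B C => x = [ISym.non B m] ∨ x = [ISym.non C m]
  | BRule.terminal t => m = 1 ∧ x = [ISym.ter t]
  | BRule.epsilon => m = 0 ∧ x = []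

/-- An atomic derivation on immature words that is consistent with the policy `φ`. -/
def Step {T N : Type} (G : BGrammar T N) (φ : Policy T N) (ω ω' : IWord T N) : Prop :=
  ∃ i A m x, φ.pos ω = some i ∧ ω[i]? = some (ISym.non A m) ∧ G.Expands A m x ∧
    ω' = ω.replace i x

/-- `p` is a parse walk of the word `w`: a sequence of atomic derivations, consistent with `φ`,
from the initial nonterminal to `w`. -/
def IsWalk {T N : Type} (G : BGrammar T N) (φ : Policy T N) (w : List T)
    (p : List (IWord T N)) : Prop :=
  p.head? = some [ISym.non G.start w.length] ∧ p.IsChain (G.Step φ) ∧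
    p.getLast? = some (w.map ISym.ter)

/-- The grammar is unambiguous: for a derivation policy, each word over the terminals has at most
one consistent sequence of atomic derivations. (The choice of the policy is immaterial.) -/
def IsUnambiguous {T N : Type} (G : BGrammar T N) : Prop :=
  ∃ φ : Policy T N, ∀ (w : List T) (p q : List (IWord T N)),
    G.IsWalk φ w p → G.IsWalk φ w q → p = q

end BGrammar

/-! ## Randomized real-number programs with an operation count -/

/-- A randomized program: it returns a value, or performs one (deterministic) operation and goes on,
or draws a real number uniformly in `[0, x)` and goes on with it. -/
inductive Prog (α : Type) : Type
  | ret (a : α)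
  | tick (p : Prog α)
  | draw (x : ℝ) (p : ℝ → Prog α)

namespace Prog

/-- Sequential composition. -/
def bind {α β : Type} : Prog α → (α → Prog β) → Prog β
  | ret a, f => f a
  | tick p, f => tick (bind p f)
  | draw x p, f => draw x fun r => bind (p r) f

instance : Monad Prog where
  pure := ret
  bind := bind

/-- Every run of the program draws only from nonempty intervals and ends, and its result `a` and its
number `c` of operations (drawing a random number counts as one) satisfy `Q a c`. -/
def AllRuns {α : Type} : Prog α → (α → ℕ → Prop) → Prop
  | ret a, Q => Q a 0
  | tick p, Q => AllRuns p fun a c => Q a (c + 1)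
  | draw x p, Q => 0 < x ∧ ∀ r, 0 ≤ r → r < x → AllRuns (p r) fun a c => Q a (c + 1)

open scoped Classical in
/-- The probability that the result of the program lies in `E`. -/
def prob {α : Type} : Prog α → Set α → ENNReal
  | ret a, E => if a ∈ E then 1 else 0
  | tick p, E => prob p E
  | draw x p, E => (ENNReal.ofReal x)⁻¹ * ∫⁻ r in Set.Ico 0 x, prob (p r) E

/-- Addition. -/
def add (x y : ℝ) : Prog ℝ := tick (ret (x + y))

/-- Subtraction. -/
def sub (x y : ℝ) : Prog ℝ := tick (ret (x - y))

/-- Multiplication. -/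
def mul (x y : ℝ) : Prog ℝ := tick (ret (x * y))

/-- Division. -/
def div (x y : ℝ) : Prog ℝ := tick (ret (x / y))

open scoped Classical in
/-- The test `x < y`. -/
def less (x y : ℝ) : Prog Bool := tick (ret (decide (x < y)))

/-- A uniform random number in `[0, x)`. -/
def rand (x : ℝ) : Prog ℝ := draw x ret

end Prog

/-! ## Precomputation of the weights of nonterminals -/

/-- A linear recurrence with polynomial coefficients, with its initial values: the sequence `a`
starts with `init`, and for `m ≥ init.length`
`lead(m) a(m) = c₁(m) a(m-1) + c₂(m) a(m-2) + ⋯`, where `coeffs = [c₁, c₂, …]`, and where terms of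
negative index are zero. A polynomial is the list of its coefficients, constant term first. -/
structure Recurrence where
  init : List ℝ
  lead : List ℝ
  coeffs : List (List ℝ)
  lead_ne : ∀ m : ℕ, init.length ≤ m → lead.foldr (fun c y => c + (m : ℝ) * y) 0 ≠ 0

/-- The value at `x` of a polynomial, by Horner's rule. -/
def horner (x : ℝ) : List ℝ → Prog ℝ
  | [] => pure 0
  | c :: p => do
    let y ← horner x p
    let z ← Prog.mul x y
    Prog.add c z

/-- The sum of the products `c(x) * a`, over the polynomials `c` and the numbers `a` at the same
places of the two lists. -/
def linComb (x : ℝ) : List (List ℝ) → List ℝ → Prog ℝ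
  | c :: cs, a :: as => do
    let s ← linComb x cs as
    let y ← horner x c
    let z ← Prog.mul y a
    Prog.add z s
  | _, _ => pure 0

namespace Recurrence

/-- The numbers that make up the recurrence. -/
def size (R : Recurrence) : ℕ :=
  R.init.length + R.lead.length + (R.coeffs.map List.length).sum

/-- The term `a(m)`, from the list `[a(0), …, a(m-1)]`. -/
def next (R : Recurrence) (m : ℕ) (prev : List ℝ) : Prog ℝ :=
  if m < R.init.length then Prog.tick (pure (R.init.getD m 0))
  else do
    let s ← linComb m R.coeffs prev.reverse
    let d ← horner m R.lead
    Prog.div s d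

/-- The list of the first `l` terms. -/
def fill (R : Recurrence) : ℕ → Prog (List ℝ)
  | 0 => pure []
  | l + 1 => do
    let prev ← R.fill l
    let a ← R.next l prev
    pure (prev ++ [a])

end Recurrence

open scoped Classical in
/-- The table of the terms of index `0, …, n`, for every nonterminal of a list. -/
def precompute {N : Type} (R : N → Recurrence) (n : ℕ) : List N → Prog (N → List ℝ)
  | [] => pure fun _ => []
  | A :: l => do
    let tab ← precompute R n l
    let a ← (R A).fill (n + 1)
    pure fun B => if B = A then a else tab B

/-- The recurrences compute the weights of the languages of the nonterminals in use, by length. -/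
def BGrammar.Computes {T N : Type} [Fintype N] (G : BGrammar T N) (wt : T → ℝ)
    (R : N → Recurrence) : Prop :=
  ∀ A, G.Reaches G.start A → ∀ l : ℕ, ((R A).fill l).AllRuns fun a _ =>
    a = (List.range l).map fun m => langWeight wt (G.langLen A m)

/-! ## The weighted tree of forbidden walks -/

/-- The prefix tree of a set of parse walks. Its nodes are labeled by immature words, the children
of a node being the nodes that it derives in one step. A node points to the memory cell that holds
the weight of the forbidden words below it; several nodes can point to the same cell. -/
structure WTree (T N : Type) where
  nodes : Finset (IWord T N)
  cell : IWord T N → ℕ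
  mem : List ℝ

namespace WTree

/-- The empty tree. -/
def empty {T N : Type} : WTree T N := ⟨∅, fun _ => 0, []⟩

open scoped Classical in
/-- The weight of the forbidden words that can be derived from `ω` (zero if `ω` is not a node). -/
def forb {T N : Type} (t : WTree T N) (ω : IWord T N) : Prog ℝ :=
  Prog.tick (pure (if ω ∈ t.nodes then t.mem.getD (t.cell ω) 0 else 0))

/-- Add `μ` to the numbers in the given cells. -/
def increment {T N : Type} (μ : ℝ) : List ℕ → WTree T N → Prog (WTree T N)
  | [], t => pure t
  | c :: cs, t => do
    let s ← Prog.add (t.mem.getD c 0) μ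
    increment μ cs { t with mem := t.mem.set c s }

open scoped Classical in
/-- The update of the tree by the parse walk (listed from the root) of a new word of weight `μ`.
The nodes of the walk that are absent are added, and share one new cell with content `μ`. The
weights of the nodes already present are increased by `μ`, once per cell; but if the last of these
nodes, `b`, was unary, so that it shares its cell with its child, then the nodes of the walk that
use this cell move to a new one. -/
def update {T N : Type} (G : BGrammar T N) (φ : Policy T N) (t : WTree T N)
    (walk : List (IWord T N)) (μ : ℝ) : Prog (WTree T N) :=
  let old := walk.filter fun v => v ∈ t.nodes
  let t₁ : WTree T N :=
    { nodes := t.nodes ∪ walk.toFinset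
      cell := fun v => if v ∈ t.nodes then t.cell v else t.mem.length
      mem := t.mem ++ [μ] }
  match old.getLast? with
  | none => pure t₁
  | some b =>
    if (t.nodes.filter fun v => G.Step φ b v).card = 1 then do
      let s ← Prog.add (t.mem.getD (t.cell b) 0) μ
      let t₂ : WTree T N :=
        { nodes := t₁.nodes
          cell := fun v => if v ∈ old ∧ t.cell v = t.cell b then t.mem.length + 1 else t₁.cell v
          mem := t₁.mem ++ [s] }
      increment μ ((old.map t.cell).dedup.filter fun c => c ≠ t.cell b) t₂
    else increment μ (old.map t.cell).dedup t₁

end WTree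

/-! ## The step-by-step algorithm -/

/-- The Boustrophedon order `1, m-1, 2, m-2, …` on `{1, …, m-1}`. -/
def boustrophedon (m : ℕ) : List ℕ :=
  (List.range (m - 1)).map fun j => if j % 2 = 0 then j / 2 + 1 else m - 1 - j / 2

/-- The loop of the algorithm for a product `A → B.C`, where `A` has prescribed length `m`. The
numbers `tab B i` are the precomputed weights, `r` is what is left of the random number, `mk i` is
the immature word for the decomposition of `m` as `i + (m - i)`, and `go` is the recursive call. -/
def trySplits {T N β : Type} (tab : N → List ℝ) (t : WTree T N) (μ : ℝ) (A B C : N) (m : ℕ)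
    (mk : ℕ → IWord T N) (go : IWord T N → ℝ → Prog (Option β)) :
    List ℕ → ℝ → Prog (Option β)
  | [], _ => pure none
  | i :: is, r => do
    let a ← Prog.mul μ ((tab B).getD i 0)
    let b ← Prog.mul a ((tab C).getD (m - i) 0)
    let μi ← Prog.div b ((tab A).getD m 0)
    let f ← t.forb (mk i)
    let d ← Prog.sub μi f
    let r' ← Prog.sub r d
    let neg ← Prog.less r' 0
    if neg then go (mk i) μi
    else trySplits tab t μ A B C m mk go is r'

/-- The step-by-step algorithm, from the immature word `ω` of weight `μ`, avoiding the words in the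
tree `t`. It returns the parse walk from `ω` to the mature word that is generated, and the weight of
this word, or `none` for an error. The first argument bounds the depth of the recursion: exceeding
it is an error. -/
def stepByStep {T N : Type} (G : BGrammar T N) (φ : Policy T N) (tab : N → List ℝ)
    (t : WTree T N) : ℕ → IWord T N → ℝ → Prog (Option (List (IWord T N) × ℝ))
  | 0, _, _ => pure none
  | depth + 1, ω, μ => do
    let go : IWord T N → ℝ → Prog (Option (List (IWord T N) × ℝ)) := fun ω' μ' => do
      let res ← stepByStep G φ tab t depth ω' μ'
      pure (res.map fun q => (ω :: q.1, q.2))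
    let f ← t.forb ω
    let ok ← Prog.less f μ
    if ok then
      match φ.pos ω with
      | none => pure (some ([ω], μ))
      | some i =>
        match ω[i]? with
        | some (ISym.non A m) => do
          let x ← Prog.sub μ f
          let r ← Prog.rand x
          match G.rule A with
          | BRule.union B C => do
            let a ← Prog.mul μ ((tab B).getD m 0)
            let μ' ← Prog.div a ((tab A).getD m 0)
            let f' ← t.forb (ω.replace i [ISym.non B m])
            let d ← Prog.sub μ' f'
            let r' ← Prog.sub r d
            let neg ← Prog.less r' 0
            if neg then go (ω.replace i [ISym.non B m]) μ'
            else do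
              let b ← Prog.mul μ ((tab C).getD m 0)
              let μ'' ← Prog.div b ((tab A).getD m 0)
              go (ω.replace i [ISym.non C m]) μ''
          | BRule.product B C =>
            trySplits tab t μ A B C m
              (fun j => ω.replace i [ISym.non B j, ISym.non C (m - j)]) go (boustrophedon m) r
          | BRule.terminal a => go (ω.replace i [ISym.ter a]) μ
          | BRule.epsilon => pure none
        | _ => pure none
    else pure none

/-- What the generation of several words leaves: the words in the order of their generation, the
tree of their parse walks, and the table of the precomputed weights. -/
structure Output (T N : Type) where
  words : List (List T)
  tree : WTree T N
  table : N → List ℝ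

/-- The number of real numbers in memory at the end: the recurrences, the table, and the cells of
the tree. None of these is ever freed, so that this is also the maximum during the run. -/
def Output.numbers {T N : Type} [Fintype N] (R : N → Recurrence) (o : Output T N) : ℕ :=
  (∑ A, (R A).size) + (∑ A, (o.table A).length) + o.tree.mem.length

/-- Generate `k` more words of length `n`, each avoiding all the previous ones. -/
def generateLoop {T N : Type} [Fintype N] (G : BGrammar T N) (φ : Policy T N) (n : ℕ) :
    ℕ → Output T N → Prog (Option (Output T N))
  | 0, o => pure (some o)
  | k + 1, o => do
    let res ← stepByStep G φ o.table o.tree (2 * n * Fintype.card N + 1)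
      [ISym.non G.start n] ((o.table G.start).getD n 0)
    match res with
    | none => pure none
    | some (walk, μ) => do
      let t ← o.tree.update G φ walk μ
      generateLoop G φ n k
        { words := o.words ++ [IWord.letters (walk.getLastD [])]
          tree := t
          table := o.table }

/-- The whole algorithm: precomputation of the weights with the recurrences `R`, then sequential
generation of `k` words of length `n`, starting with the empty tree. -/
def generate {T N : Type} [Fintype N] (G : BGrammar T N) (R : N → Recurrence) (φ : Policy T N)
    (n k : ℕ) : Prog (Option (Output T N)) := do
  let tab ← precompute R n Finset.univ.toList
  generateLoop G φ n k { words := [], tree := WTree.empty, table := tab }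

end

noncomputable section

/-! ## Reasoning about programs -/

namespace Prog

variable {α β γ : Type}

/-! Everything rests on parse trees. A policy unfolds a forest of valid trees into a chain of atomic
derivations that ends in a mature word, and every such chain comes from exactly one forest
(`PTree.exists_run`, `PTree.exists_run_of_isChain`, `PTree.Run.functional`, `PTree.Run.injective`).
Unambiguity, assumed for one policy, therefore says that a tree for the start symbol is determined
by its yield (`TreeUnique`), and this policy-free statement gives back unique walks for every
policy. Plugging trees into a context carries it to all reachable nonterminals. There the two sides
of a union are disjoint, concatenation in a product is injective, and unions form no cycle.

Recurrences. The generating functions of the reachable nonterminals solve a polynomial system. At X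
= 0 its Jacobian J is nilpotent along the acyclic unions, because operands of products have constant
term 0; hence det(1 - J) is a unit of ℝ⟦X⟧. Any derivation over ℝ(X) kills the solutions, since it
maps them to a kernel vector of 1 - J, so they generate a finite extension of ℝ(X). The derivatives
under X d/dX remain in this extension by Cramer's rule, and infinitely many elements of a
finite-dimensional space are dependent. This is a linear differential equation with polynomial
coefficients, whose coefficients of X^m form the recurrence (`BRule.Solves.exists_recurrence`,
`IsBCNF.exists_computes`).

Distribution. The tree stores, for each node, the weight of the forbidden words below it. With this
invariant, `WTree.Inv.gap_eq` identifies the difference of weight and stored number with the weight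
of the words that are still allowed, and the differences of the children add up to that of the
parent (`WTree.Inv.sum_gap`). So each draw falls into the share of some child, errors are
impossible, and the conditional probabilities telescope to weight of the word over allowed weight
(`stepByStep_prob`). Multiplying over the k draws gives the product formula.

Operations. A walk has O(n|N|) steps, because unions lower a height below |N| and there are few
splits (`wordMeasure_step`). The split i of m is found after at most 2 min(i, m - i) trials, and m
log m exceeds the sum of the two corresponding terms by at least min(i, m - i) log 2. Hence
`wordPot`, a potential of the form step bound plus m log m, pays for everything (`wordPot_product`,
`stepByStep_allRuns`).

Memory and tree. Two nodes share a cell exactly when the same forbidden words lie below them. A new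
walk leaves the old tree at its last old node, and only the cell of this node may have to be split,
so that two new cells per word suffice (`WTree.Inv.update`). Each walk has between n + 1 and 2n|N| +
1 nodes, which gives the bounds on the tree. For the lower bound, the grammar of the words x⋯xy⋯y
decides the whole word in the first atomic derivation, so that different walks share only the root.
-/

@[simp] theorem pure_bind (a : α) (f : α → Prog β) : (pure a >>= f) = f a := rfl

@[simp] theorem ret_bind (a : α) (f : α → Prog β) : (ret a >>= f) = f a := rfl

@[simp] theorem tick_bind (p : Prog α) (f : α → Prog β) : (tick p >>= f) = tick (p >>= f) := rfl

@[simp] theorem draw_bind (x : ℝ) (p : ℝ → Prog α) (f : α → Prog β) :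
    (draw x p >>= f) = draw x fun r => p r >>= f := rfl

theorem bind_assoc' (p : Prog α) (f : α → Prog β) (g : β → Prog γ) :
    ((p >>= f) >>= g) = p >>= fun a => f a >>= g := by
  induction p with
  | ret a => rfl
  | tick p ih => exact congrArg tick ih
  | draw x p ih => exact congrArg (draw x) (funext ih)

theorem bind_pure' (p : Prog α) : (p >>= pure) = p := by
  induction p with
  | ret a => rfl
  | tick p ih => exact congrArg tick ih
  | draw x p ih => exact congrArg (draw x) (funext ih)

@[simp] theorem sub_bind (x y : ℝ) (f : ℝ → Prog β) : (sub x y >>= f) = tick (f (x - y)) := rfl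
@[simp] theorem mul_bind (x y : ℝ) (f : ℝ → Prog β) : (mul x y >>= f) = tick (f (x * y)) := rfl
@[simp] theorem div_bind (x y : ℝ) (f : ℝ → Prog β) : (div x y >>= f) = tick (f (x / y)) := rfl
@[simp] theorem rand_bind (x : ℝ) (f : ℝ → Prog β) : (rand x >>= f) = draw x f := rfl

open scoped Classical in
@[simp] theorem less_bind (x y : ℝ) (f : Bool → Prog β) :
    (less x y >>= f) = tick (f (decide (x < y))) := rfl

@[simp] theorem allRuns_pure (a : α) (Q : α → ℕ → Prop) : (pure a : Prog α).AllRuns Q ↔ Q a 0 :=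
  Iff.rfl

@[simp] theorem allRuns_tick (p : Prog α) (Q : α → ℕ → Prop) :
    (tick p).AllRuns Q ↔ p.AllRuns fun a c => Q a (c + 1) := Iff.rfl

theorem allRuns_draw (x : ℝ) (p : ℝ → Prog α) (Q : α → ℕ → Prop) :
    (draw x p).AllRuns Q ↔
      0 < x ∧ ∀ r, 0 ≤ r → r < x → (p r).AllRuns fun a c => Q a (c + 1) := Iff.rfl

theorem AllRuns.mono {p : Prog α} {Q Q' : α → ℕ → Prop} (h : p.AllRuns Q)
    (hQ : ∀ a c, Q a c → Q' a c) : p.AllRuns Q' := by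
  induction p generalizing Q Q' with
  | ret a => exact hQ _ _ h
  | tick p ih => exact ih h fun a c => hQ a (c + 1)
  | draw x p ih => exact ⟨h.1, fun r h0 h1 => ih r (h.2 r h0 h1) fun a c => hQ a (c + 1)⟩

theorem AllRuns.bind {p : Prog α} {f : α → Prog β} {Q : α → ℕ → Prop} {Q' : β → ℕ → Prop}
    (h : p.AllRuns Q) (hf : ∀ a c, Q a c → (f a).AllRuns fun b d => Q' b (c + d)) :
    (p >>= f).AllRuns Q' := by
  induction p generalizing Q Q' with
  | ret a => simpa using hf _ _ h
  | tick p ih =>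
    refine ih h fun a c hc => (hf a (c + 1) hc).mono fun b d hd => ?_
    rwa [add_right_comm] at hd
  | draw x p ih =>
    refine ⟨h.1, fun r h0 h1 => ih r (h.2 r h0 h1) fun a c hc => (hf a (c + 1) hc).mono fun b d hd => ?_⟩
    rwa [add_right_comm] at hd

/-- The integral in `prob` sees only the numbers in [0, x) over which `AllRuns` quantifies, so an
event missed by all runs is null. This serves to discard the draws of a wrong first word. -/
theorem prob_eq_zero {p : Prog α} {E : Set α} (h : p.AllRuns fun a _ => a ∉ E) :
    p.prob E = 0 := by
  induction p with
  | ret a => exact if_neg h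
  | tick p ih => exact ih h
  | draw x p ih =>
    rw [prob, MeasureTheory.setLIntegral_congr_fun (g := fun _ => 0) measurableSet_Ico
      fun r hr => ih r (h.2 r hr.1 hr.2)]
    simp

/-- `p` makes no random choice; it returns `a` after `n` operations. -/
inductive Returns : Prog α → α → ℕ → Prop
  | ret (a : α) : Returns (ret a) a 0
  | tick {p : Prog α} {a : α} {n : ℕ} (h : Returns p a n) : Returns (tick p) a (n + 1)

theorem Returns.bind {p : Prog α} {f : α → Prog β} {a : α} {b : β} {m n : ℕ} (h : Returns p a m)
    (hf : Returns (f a) b n) : Returns (p >>= f) b (m + n) := by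
  induction h with
  | ret a => simpa using hf
  | tick _ ih => rw [add_right_comm]; exact (ih hf).tick

theorem Returns.allRuns_bind {p : Prog α} {a : α} {n : ℕ} (h : Returns p a n) (f : α → Prog β)
    (Q : β → ℕ → Prop) : (p >>= f).AllRuns Q ↔ (f a).AllRuns fun b d => Q b (n + d) := by
  induction h generalizing Q with
  | ret a => simp
  | tick _ ih =>
    rw [tick_bind, allRuns_tick, ih]
    simp only [add_right_comm]

theorem Returns.allRuns {p : Prog α} {a : α} {n : ℕ} (h : Returns p a n) (Q : α → ℕ → Prop) :
    p.AllRuns Q ↔ Q a n := by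
  rw [← bind_pure' p, h.allRuns_bind]
  rfl

theorem Returns.prob_bind {p : Prog α} {a : α} {n : ℕ} (h : Returns p a n) (f : α → Prog β)
    (E : Set β) : (p >>= f).prob E = (f a).prob E := by
  induction h with
  | ret a => rfl
  | tick _ ih => exact ih

@[simp] theorem prob_tick (p : Prog α) (E : Set α) : (tick p).prob E = p.prob E := rfl

theorem returns_pure (a : α) : Returns (pure a) a 0 := .ret a

theorem returns_add (x y : ℝ) : Returns (add x y) (x + y) 1 := .tick (.ret _)

end Prog

/-! ## The cost and the result of the precomputation -/

open Prog

/-- The value at `x` of the polynomial with the given list of coefficients. -/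
def listEval (x : ℝ) (p : List ℝ) : ℝ := p.foldr (fun c y => c + x * y) 0

theorem returns_horner (x : ℝ) (p : List ℝ) : Returns (horner x p) (listEval x p) (2 * p.length) := by
  induction p with
  | nil => exact returns_pure _
  | cons c p ih =>
    exact ih.bind (f := fun y => tick (tick (ret (c + x * y)))) (.tick (.tick (.ret _)))

/-- The count is only bounded, not given exactly, because the shorter of the two lists decides how
many products are formed. -/
theorem returns_linComb (x : ℝ) (cs : List (List ℝ)) (as : List ℝ) :
    ∃ n ≤ 2 * cs.length + 2 * (cs.map List.length).sum, Returns (linComb x cs as)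
      (List.zipWith (fun c a => listEval x c * a) cs as).sum n := by
  induction cs generalizing as with
  | nil => exact ⟨0, by simp, returns_pure _⟩
  | cons c cs ih =>
    cases as with
    | nil => exact ⟨0, by simp, returns_pure _⟩
    | cons a as =>
      obtain ⟨n, hn, h⟩ := ih as
      refine ⟨_, ?_, h.bind ((returns_horner x c).bind (.tick (.tick (.ret _))))⟩
      simp only [List.length_cons, List.map_cons, List.sum_cons]
      omega

namespace Recurrence

/-- A bound for the number of operations that compute one term. -/
def termCost (R : Recurrence) : ℕ :=
  2 * R.coeffs.length + 2 * (R.coeffs.map List.length).sum + 2 * R.lead.length + 1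

theorem returns_next (R : Recurrence) (m : ℕ) (prev : List ℝ) :
    ∃ n ≤ R.termCost, Returns (R.next m prev)
      (if m < R.init.length then R.init.getD m 0 else
        (List.zipWith (fun c a => listEval m c * a) R.coeffs prev.reverse).sum /
          listEval m R.lead) n := by
  unfold next
  split
  · exact ⟨1, by simp [termCost], .tick (.ret _)⟩
  · obtain ⟨n, hn, h⟩ := returns_linComb m R.coeffs prev.reverse
    refine ⟨_, ?_, h.bind ((returns_horner m R.lead).bind (.tick (.ret _)))⟩
    simp only [termCost]
    omega

/-- Cost and length do not depend on what the recurrence computes. This covers the tables of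
nonterminals that are not reachable, whose entries are arbitrary. -/
theorem returns_fill (R : Recurrence) (l : ℕ) :
    ∃ a n, n ≤ l * R.termCost ∧ a.length = l ∧ Returns (R.fill l) a n := by
  induction l with
  | zero => exact ⟨[], 0, by simp, rfl, returns_pure _⟩
  | succ l ih =>
    obtain ⟨a, n, hn, ha, h⟩ := ih
    obtain ⟨n', hn', h'⟩ := R.returns_next l a
    refine ⟨_, _, ?_, ?_, h.bind (h'.bind (returns_pure _))⟩
    · rw [add_mul]; omega
    · simp [ha]

end Recurrence

open Classical in
theorem returns_precompute {N : Type} (R : N → Recurrence) (n : ℕ) (l : List N) :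
    ∃ tab c, c ≤ (n + 1) * (l.map fun A => (R A).termCost).sum ∧
      (∀ A ∈ l, (tab A).length = n + 1 ∧ ∃ d, Returns ((R A).fill (n + 1)) (tab A) d) ∧
      Returns (precompute R n l) tab c := by
  induction l with
  | nil => exact ⟨_, 0, by simp, by simp, returns_pure _⟩
  | cons A l ih =>
    obtain ⟨tab, c, hc, htab, h⟩ := ih
    obtain ⟨a, d, hd, ha, h'⟩ := (R A).returns_fill (n + 1)
    refine ⟨_, _, ?_, ?_, h.bind (h'.bind (returns_pure _))⟩
    · rw [List.map_cons, List.sum_cons, mul_add]; omega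
    · intro B hB
      by_cases hBA : B = A
      · subst hBA
        simpa using ⟨ha, d, h'⟩
      · simpa [hBA] using htab B (by simpa [hBA] using hB)

end

noncomputable section
open Prog

/-! ## Parse trees -/

/-- Parse trees over the rules of a binary grammar: an inner node is labeled by a nonterminal and
has at most two children. -/
inductive PTree (T N : Type) : Type
  | leaf (t : T)
  | nil (A : N)
  | un (A : N) (c : PTree T N)
  | bin (A : N) (l r : PTree T N)

namespace PTree

variable {T N : Type}

/-- The word at the leaves. -/
def yield : PTree T N → List T
  | leaf t => [t]
  | nil _ => []
  | un _ c => c.yield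
  | bin _ l r => l.yield ++ r.yield

/-- The number of inner nodes. -/
def count : PTree T N → ℕ
  | leaf _ => 0
  | nil _ => 1
  | un _ c => c.count + 1
  | bin _ l r => l.count + r.count + 1

/-- The children of the root. -/
def children : PTree T N → List (PTree T N)
  | leaf _ => []
  | nil _ => []
  | un _ c => [c]
  | bin _ l r => [l, r]

/-- The label of the root, with the length of the yield. -/
def root : PTree T N → ISym T N
  | leaf t => ISym.ter t
  | nil A => ISym.non A 0
  | un A c => ISym.non A c.yield.length
  | bin A l r => ISym.non A (l.yield.length + r.yield.length)

/-- All inner nodes are expanded according to the rules of the grammar. -/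
def Valid (G : BGrammar T N) : PTree T N → Prop
  | leaf _ => True
  | nil A => G.Expands A 0 []
  | un A c => G.Expands A c.yield.length [c.root] ∧ c.Valid G
  | bin A l r => G.Expands A (l.yield.length + r.yield.length) [l.root, r.root] ∧
      l.Valid G ∧ r.Valid G

variable {G : BGrammar T N}

theorem root_eq_ter {τ : PTree T N} {t : T} (h : τ.root = ISym.ter t) : τ = leaf t := by
  cases τ <;> simp_all [root]

theorem length_of_root {τ : PTree T N} {A : N} {m : ℕ} (h : τ.root = ISym.non A m) :
    τ.yield.length = m := by
  cases τ <;> simp_all [root, yield]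

theorem yield_eq_flatMap {τ : PTree T N} {A : N} {m : ℕ} (h : τ.root = ISym.non A m) :
    τ.yield = τ.children.flatMap yield := by
  cases τ <;> simp_all [root, yield, children]

theorem count_eq_sum {τ : PTree T N} {A : N} {m : ℕ} (h : τ.root = ISym.non A m) :
    τ.count = (τ.children.map count).sum + 1 := by
  cases τ <;> simp_all [root, count, children]

theorem Valid.children {τ : PTree T N} (h : τ.Valid G) : ∀ c ∈ τ.children, c.Valid G := by
  cases τ <;> simp_all [PTree.children, Valid]

theorem Valid.expands {τ : PTree T N} (h : τ.Valid G) {A : N} {m : ℕ}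
    (hr : τ.root = ISym.non A m) : G.Expands A m (τ.children.map root) := by
  cases τ <;> simp_all [PTree.children, Valid, root]

/-- A tree has no room for a prescribed length: its root carries the length of the yield. An
expansion by the labels of the children forces that length to be `m`, so a root can be put on top of
them. -/
theorem exists_of_children {A : N} {m : ℕ} {C : List (PTree T N)} (hC : ∀ c ∈ C, c.Valid G)
    (h : G.Expands A m (C.map root)) :
    ∃ τ : PTree T N, τ.Valid G ∧ τ.root = ISym.non A m ∧ τ.children = C := by
  match C with
  | [] =>
    refine ⟨nil A, ?_, ?_, rfl⟩
    all_goals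
      simp only [BGrammar.Expands] at h
      split at h <;> simp_all [Valid, root, BGrammar.Expands]
  | [c] =>
    have hm : c.yield.length = m := by
      simp only [BGrammar.Expands] at h
      split at h
      · simp at h
      · rcases h with h | h
        · exact length_of_root (List.singleton_injective h)
        · exact length_of_root (List.singleton_injective h)
      · rw [root_eq_ter (List.singleton_injective h.2), h.1]; rfl
      · simp at h
    subst hm
    exact ⟨un A c, ⟨h, hC c (by simp)⟩, rfl, rfl⟩
  | [l, r] =>
    have hm : l.yield.length + r.yield.length = m := by
      have h' := h
      simp only [BGrammar.Expands] at h'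
      split at h'
      · obtain ⟨i, h1, h2, h3⟩ := h'
        simp only [List.map_cons, List.map_nil, List.cons.injEq, and_true] at h3
        rw [length_of_root h3.1, length_of_root h3.2]
        omega
      all_goals simp at h'
    subst hm
    exact ⟨bin A l r, ⟨h, hC l (by simp), hC r (by simp)⟩, rfl, rfl⟩
  | _ :: _ :: _ :: _ =>
    simp only [BGrammar.Expands] at h
    split at h <;> simp at h

/-- The rule of `A` alone fixes the number of symbols produced; this allows a walk to be read
backwards in `Run.injective`. -/
theorem _root_.BGrammar.Expands.length_eq {A : N} {m m' : ℕ} {x y : IWord T N}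
    (hx : G.Expands A m x) (hy : G.Expands A m' y) : x.length = y.length := by
  simp only [BGrammar.Expands] at hx hy
  split at hx <;> aesop

theorem Valid.ext {τ τ' : PTree T N} (h : τ.Valid G) (h' : τ'.Valid G) {A : N} {m : ℕ}
    (hr : τ.root = ISym.non A m) (hr' : τ'.root = ISym.non A m)
    (hc : τ.children = τ'.children) : τ = τ' := by
  cases τ <;> cases τ' <;> simp_all [root, PTree.children]

/-! ### Parse trees and derivations -/

/-- The label of the root as a symbol of the context-free grammar. -/
def sym : PTree T N → Symbol T N
  | leaf t => Symbol.terminal t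
  | nil A => Symbol.nonterminal A
  | un A _ => Symbol.nonterminal A
  | bin A _ _ => Symbol.nonterminal A

theorem sym_eq_nonterminal {τ : PTree T N} {A : N} :
    τ.sym = Symbol.nonterminal A ↔ τ.root = ISym.non A τ.yield.length := by
  cases τ <;> simp [root, sym, yield]

theorem sym_of_root {τ : PTree T N} {A : N} {m : ℕ} (h : τ.root = ISym.non A m) :
    τ.sym = Symbol.nonterminal A := by
  cases τ <;> simp_all [root, sym]

end PTree

namespace BGrammar

variable {T N : Type} {G : BGrammar T N}

/-- Forgetting the lengths turns an atomic derivation into a production of the context-free grammar.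
-/
theorem Expands.outputs {A : N} {m : ℕ} {C : List (PTree T N)} (h : G.Expands A m (C.map PTree.root)) :
    C.map PTree.sym ∈ (G.rule A).outputs := by
  have hr : ∀ {τ : PTree T N} {A m}, τ.root = ISym.non A m → τ.sym = Symbol.nonterminal A :=
    PTree.sym_of_root
  simp only [Expands] at h
  split at h
  · next B D hAr =>
    obtain ⟨i, -, -, h⟩ := h
    match C with
    | [l, r] => simp at h; simp [BRule.outputs, hAr, hr h.1, hr h.2]
    | [] | [_] | _ :: _ :: _ :: _ => simp at h
  · next B D hAr =>
    match C with
    | [c] => rcases h with h | h <;> simp at h <;> simp [BRule.outputs, hAr, hr h]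
    | [] | _ :: _ :: _ => simp at h
  · next t hAr =>
    match C with
    | [c] =>
      simp at h
      simp [BRule.outputs, hAr, PTree.root_eq_ter h.2, PTree.sym]
    | [] | _ :: _ :: _ => simp at h
  · next hAr =>
    match C with
    | [] => simp [BRule.outputs, hAr]
    | _ :: _ => simp at h

variable [Fintype N]

theorem mem_rules {r : ContextFreeRule T N} :
    r ∈ G.toCFG.rules ↔ ∃ A, ∃ o ∈ (G.rule A).outputs, (⟨A, o⟩ : ContextFreeRule T N) = r := by
  classical
  have : r ∈ (Finset.univ.biUnion fun A =>
      ((G.rule A).outputs.map fun x => (⟨A, x⟩ : ContextFreeRule T N)).toFinset) ↔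
      ∃ A, ∃ o ∈ (G.rule A).outputs, (⟨A, o⟩ : ContextFreeRule T N) = r := by
    simp
  rw [← this]
  unfold toCFG
  convert Iff.rfl

theorem produces_iff {u v : List (Symbol T N)} : G.toCFG.Produces u v ↔
    ∃ A, ∃ o ∈ (G.rule A).outputs, ∃ p q : List (Symbol T N),
      u = p ++ [Symbol.nonterminal A] ++ q ∧ v = p ++ o ++ q := by
  constructor
  · rintro ⟨r, hmem, hr⟩
    obtain ⟨A, o, ho, rfl⟩ := mem_rules.1 hmem
    exact ⟨A, o, ho, hr.exists_parts⟩
  · rintro ⟨A, o, ho, p, q, rfl, rfl⟩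
    exact ⟨⟨A, o⟩, mem_rules.2 ⟨A, o, ho, rfl⟩,
      ContextFreeRule.rewrites_of_exists_parts (⟨A, o⟩ : ContextFreeRule T N) p q⟩

theorem produces_of_mem {A : N} {o : List (Symbol T N)} (h : o ∈ (G.rule A).outputs) :
    G.toCFG.Produces [Symbol.nonterminal A] o :=
  produces_iff.2 ⟨A, o, h, [], [], rfl, (List.append_nil o).symm⟩

theorem derives_append {u v u' v' : List (Symbol T N)} (h : G.toCFG.Derives u u')
    (h' : G.toCFG.Derives v v') : G.toCFG.Derives (u ++ v) (u' ++ v') :=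
  (h.append_right v).trans (h'.append_left u')

theorem _root_.PTree.Valid.derives {τ : PTree T N} (h : τ.Valid G) :
    G.toCFG.Derives [τ.sym] (τ.yield.map Symbol.terminal) := by
  induction τ with
  | leaf t => exact ContextFreeGrammar.Derives.refl _
  | nil A => exact (produces_of_mem (Expands.outputs (C := []) h)).single
  | un A c ih =>
    exact (produces_of_mem (Expands.outputs (C := [c]) h.1)).trans_derives (ih h.2)
  | bin A l r ihl ihr =>
    refine (produces_of_mem (Expands.outputs (C := [l, r]) h.1)).trans_derives ?_
    have := derives_append (ihl h.2.1) (ihr h.2.2)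
    rw [PTree.yield, List.map_append]
    exact this

theorem _root_.PTree.Valid.mem_lang {τ : PTree T N} (h : τ.Valid G) {A : N} {m : ℕ}
    (hr : τ.root = ISym.non A m) : τ.yield ∈ G.lang A := by
  have := h.derives
  rwa [PTree.sym_of_root hr] at this

/-- This is why the restriction to splits 1 ≤ i ≤ m - 1 loses no words of a product. -/
theorem IsBCNF.length_pos (hG : G.IsBCNF) {A B C : N} (h : G.rule A = BRule.product B C) :
    (∀ {τ : PTree T N}, τ.Valid G → τ.sym = Symbol.nonterminal B → 0 < τ.yield.length) ∧
    (∀ {τ : PTree T N}, τ.Valid G → τ.sym = Symbol.nonterminal C → 0 < τ.yield.length) := by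
  constructor
  · intro τ hτ hs
    rw [List.length_pos_iff]
    intro h0
    exact (hG.product_pos A B C h).1 (h0 ▸ hτ.mem_lang (PTree.sym_eq_nonterminal.1 hs))
  · intro τ hτ hs
    rw [List.length_pos_iff]
    intro h0
    exact (hG.product_pos A B C h).2 (h0 ▸ hτ.mem_lang (PTree.sym_eq_nonterminal.1 hs))

/-- A tree can be built from trees for the right-hand side of a production. -/
theorem IsBCNF.expands_of_outputs (hG : G.IsBCNF) {A : N} {C : List (PTree T N)}
    (hC : ∀ c ∈ C, c.Valid G) (h : C.map PTree.sym ∈ (G.rule A).outputs) :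
    G.Expands A (C.flatMap PTree.yield).length (C.map PTree.root) := by
  have hs := @PTree.sym_eq_nonterminal T N
  simp only [Expands]
  rcases hA : G.rule A with ⟨B, D⟩ | ⟨B, D⟩ | t | _ <;> rw [hA] at h <;>
    simp only [BRule.outputs, List.mem_cons, List.not_mem_nil, or_false] at h
  · match C with
    | [l, r] =>
      simp at h hC
      have h1 := (hG.length_pos hA).1 hC.1 h.1
      have h2 := (hG.length_pos hA).2 hC.2 h.2
      refine ⟨l.yield.length, h1, ?_, ?_⟩
      · simp; omega
      · simp [hs.1 h.1, hs.1 h.2]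
    | [] | [_] | _ :: _ :: _ :: _ => simp at h
  · match C with
    | [c] => rcases h with h | h <;> simp at h <;> simp [hs.1 h]
    | [] | _ :: _ :: _ => simp at h
  · match C with
    | [c] =>
      simp at h
      cases c <;> simp_all [PTree.sym, PTree.yield, PTree.root]
    | [] | _ :: _ :: _ => simp at h
  · match C with
    | [] => simp
    | _ :: _ => simp at h

/-- Induction on the derivation from its first step: the trees over the right-hand side of the first
production are consecutive in the forest for the rest, and are gathered below a new root. -/
theorem IsBCNF.exists_forest (hG : G.IsBCNF) {u : List (Symbol T N)} {w : List T}
    (h : G.toCFG.Derives u (w.map Symbol.terminal)) :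
    ∃ F : List (PTree T N), (∀ τ ∈ F, τ.Valid G) ∧ F.map PTree.sym = u ∧
      F.flatMap PTree.yield = w := by
  induction h using Relation.ReflTransGen.head_induction_on with
  | refl =>
    refine ⟨w.map PTree.leaf, ?_, ?_, ?_⟩
    · intro τ hτ
      obtain ⟨t, -, rfl⟩ := List.mem_map.1 hτ
      trivial
    · rw [List.map_map]; rfl
    · induction w <;> simp_all [PTree.yield]
  | head hp _ ih =>
    obtain ⟨A, o, ho, p, q, rfl, rfl⟩ := produces_iff.1 hp
    obtain ⟨F, hF, hs, rfl⟩ := ih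
    obtain ⟨F₁₂, F₃, rfl, h12, rfl⟩ := List.map_eq_append_iff.1 hs
    obtain ⟨F₁, F₂, rfl, rfl, rfl⟩ := List.map_eq_append_iff.1 h12
    have h2 : ∀ c ∈ F₂, c.Valid G := fun c hc => hF c (by simp [hc])
    obtain ⟨τ, hτ, hr, rfl⟩ := PTree.exists_of_children h2 (hG.expands_of_outputs h2 ho)
    refine ⟨F₁ ++ [τ] ++ F₃, ?_, ?_, ?_⟩
    · intro c hc
      simp only [List.mem_append, List.mem_singleton] at hc
      rcases hc with (hc | rfl) | hc
      · exact hF c (by simp [hc])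
      · exact hτ
      · exact hF c (by simp [hc])
    · simp [PTree.sym_of_root hr]
    · simp [PTree.yield_eq_flatMap hr]

theorem IsBCNF.mem_lang_iff (hG : G.IsBCNF) {A : N} {w : List T} :
    w ∈ G.lang A ↔ ∃ τ : PTree T N, τ.Valid G ∧ τ.root = ISym.non A w.length ∧ τ.yield = w := by
  constructor
  · intro h
    obtain ⟨F, hF, hs, hy⟩ := hG.exists_forest h
    replace hs : F.map PTree.sym = [(Symbol.nonterminal A : Symbol T N)] := hs
    match F with
    | [τ] =>
      simp at hF hs hy
      subst hy
      exact ⟨τ, hF, PTree.sym_eq_nonterminal.1 hs, rfl⟩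
    | [] | _ :: _ :: _ => simp at hs
  · rintro ⟨τ, hτ, hr, rfl⟩
    exact hτ.mem_lang hr

end BGrammar

end

noncomputable section
open Prog

/-! ## Parse trees and parse walks -/

namespace Policy

variable {T N : Type} (φ : Policy T N)

theorem exists_split {ω : IWord T N} {i : ℕ} (h : φ.pos ω = some i) :
    ∃ ω₁ A m ω₂, ω = ω₁ ++ ISym.non A m :: ω₂ ∧ i = ω₁.length := by
  obtain ⟨A, m, h⟩ := φ.pos_some ω i h
  obtain ⟨hi, h⟩ := List.getElem?_eq_some_iff.1 h
  refine ⟨ω.take i, A, m, ω.drop (i + 1), ?_, ?_⟩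
  · rw [← h, ← List.drop_eq_getElem_cons hi, List.take_append_drop]
  · rw [List.length_take]; omega

theorem pos_map_ter (w : List T) : φ.pos (w.map ISym.ter) = none := by
  rw [φ.pos_none]
  simp

theorem eq_map_ter {ω : IWord T N} (h : φ.pos ω = none) : ω = ω.letters.map ISym.ter := by
  rw [φ.pos_none] at h
  induction ω with
  | nil => rfl
  | cons s ω ih =>
    cases s with
    | ter t =>
      simp only [IWord.letters] at ih
      simpa [IWord.letters] using ih (by simpa using h)
    | non A m => exact absurd (List.mem_cons_self) (h A m)

end Policy

theorem IWord.letters_map_ter {T N : Type} (w : List T) :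
    IWord.letters (w.map ISym.ter : IWord T N) = w := by
  induction w with
  | nil => rfl
  | cons t w ih => simp [IWord.letters]

theorem ISym.map_ter_injective {T N : Type} {w w' : List T}
    (h : (w.map ISym.ter : IWord T N) = w'.map ISym.ter) : w = w' := by
  rw [← IWord.letters_map_ter (N := N) w, h, IWord.letters_map_ter]

namespace IWord

variable {T N : Type}

theorem replace_split (ω₁ ω₂ x : IWord T N) (s : ISym T N) :
    IWord.replace (ω₁ ++ s :: ω₂) ω₁.length x = ω₁ ++ x ++ ω₂ := by
  simp [IWord.replace]

end IWord

namespace BGrammar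

variable {T N : Type} {G : BGrammar T N} {φ : Policy T N}

theorem step_iff {ω ω' : IWord T N} : G.Step φ ω ω' ↔ ∃ ω₁ A m ω₂ x,
    ω = ω₁ ++ ISym.non A m :: ω₂ ∧ φ.pos ω = some ω₁.length ∧ G.Expands A m x ∧
      ω' = ω₁ ++ x ++ ω₂ := by
  constructor
  · rintro ⟨i, A, m, x, hp, hi, hx, rfl⟩
    obtain ⟨ω₁, B, l, ω₂, rfl, rfl⟩ := φ.exists_split hp
    have : B = A ∧ l = m := by simpa using hi
    obtain ⟨rfl, rfl⟩ := this
    exact ⟨ω₁, B, l, ω₂, x, rfl, hp, hx, IWord.replace_split _ _ _ _⟩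
  · rintro ⟨ω₁, A, m, ω₂, x, rfl, hp, hx, rfl⟩
    exact ⟨ω₁.length, A, m, x, hp, by simp, hx, (IWord.replace_split _ _ _ _).symm⟩

theorem not_step_of_pos_none {ω ω' : IWord T N} (h : φ.pos ω = none) : ¬ G.Step φ ω ω' := by
  rintro ⟨i, A, m, x, hp, -⟩
  simp [h] at hp

end BGrammar

/-- `p` is the sequence of the labels of the forests that arise from `F` by expanding its trees as
the policy tells. -/
inductive PTree.Run {T N : Type} (φ : Policy T N) : List (PTree T N) → List (IWord T N) → Prop
  | done (F : List (PTree T N)) (h : φ.pos (F.map PTree.root) = none) : Run φ F [F.map PTree.root]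
  | step (F₁ : List (PTree T N)) (τ : PTree T N) (F₂ : List (PTree T N)) (p : List (IWord T N))
      (h : φ.pos ((F₁ ++ τ :: F₂).map PTree.root) = some F₁.length)
      (hp : Run φ (F₁ ++ τ.children ++ F₂) p) :
      Run φ (F₁ ++ τ :: F₂) ((F₁ ++ τ :: F₂).map PTree.root :: p)

namespace PTree

variable {T N : Type} {G : BGrammar T N} {φ : Policy T N}

theorem exists_root_of_pos {F₁ F₂ : List (PTree T N)} {τ : PTree T N}
    (h : φ.pos ((F₁ ++ τ :: F₂).map root) = some F₁.length) : ∃ A m, τ.root = ISym.non A m := by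
  obtain ⟨A, m, h⟩ := φ.pos_some _ _ h
  exact ⟨A, m, by simpa using h⟩

theorem valid_expand {F₁ F₂ : List (PTree T N)} {τ : PTree T N}
    (h : ∀ c ∈ F₁ ++ τ :: F₂, c.Valid G) : ∀ c ∈ F₁ ++ τ.children ++ F₂, c.Valid G := by
  intro c hc
  simp only [List.mem_append] at hc
  rcases hc with (hc | hc) | hc
  · exact h c (by simp [hc])
  · exact (h τ (by simp)).children c hc
  · exact h c (by simp [hc])

theorem eq_map_leaf {F : List (PTree T N)} (h : φ.pos (F.map root) = none) :
    F = (F.flatMap yield).map leaf := by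
  rw [φ.pos_none] at h
  induction F with
  | nil => rfl
  | cons τ F ih =>
    have h1 := ih fun A m hm => h A m (by rw [List.map_cons]; exact List.mem_cons_of_mem _ hm)
    cases hr : τ.root with
    | ter t =>
      rw [root_eq_ter hr]
      simpa [yield] using h1
    | non A m => exact absurd (by simp [hr]) (h A m)

theorem map_root_of_pos_none {F : List (PTree T N)} (h : φ.pos (F.map root) = none) :
    F.map root = (F.flatMap yield).map ISym.ter := by
  conv_lhs => rw [eq_map_leaf h, List.map_map]
  rfl

theorem Run.exists_cons {F : List (PTree T N)} {p : List (IWord T N)} (h : Run φ F p) :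
    ∃ q, p = F.map root :: q := by
  cases h with
  | done h => exact ⟨_, rfl⟩
  | step => exact ⟨_, rfl⟩

/-- Each expansion removes one inner node from the forest, so the unfolding stops. -/
theorem exists_run (φ : Policy T N) (F : List (PTree T N)) : ∃ p, Run φ F p := by
  induction hn : (F.map count).sum using Nat.strong_induction_on generalizing F with
  | _ n ih =>
    rcases hp : φ.pos (F.map root) with _ | i
    · exact ⟨_, .done F hp⟩
    · obtain ⟨ω₁, A, m, ω₂, h, rfl⟩ := φ.exists_split hp
      obtain ⟨F₁, F', rfl, rfl, h'⟩ := List.map_eq_append_iff.1 h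
      obtain ⟨τ, F₂, rfl, hr, rfl⟩ := List.map_eq_cons_iff.1 h'
      obtain ⟨p, hp'⟩ := ih _ (by
        rw [← hn]
        simp only [List.map_append, List.map_cons, List.sum_append, List.sum_cons]
        rw [count_eq_sum hr]
        omega) (F₁ ++ τ.children ++ F₂) rfl
      exact ⟨_, .step F₁ τ F₂ p (by simpa using hp) hp'⟩

theorem Run.isChain {F : List (PTree T N)} {p : List (IWord T N)} (h : Run φ F p)
    (hF : ∀ τ ∈ F, τ.Valid G) : p.IsChain (G.Step φ) ∧
      p.getLast? = some ((F.flatMap yield).map ISym.ter) := by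
  induction h with
  | done F h =>
    refine ⟨List.isChain_singleton _, ?_⟩
    rw [List.getLast?_singleton, Option.some.injEq]
    exact map_root_of_pos_none h
  | step F₁ τ F₂ p h hp ih =>
    obtain ⟨A, m, hr⟩ := exists_root_of_pos h
    have hF' := valid_expand hF
    obtain ⟨ih1, ih2⟩ := ih hF'
    obtain ⟨q, rfl⟩ := hp.exists_cons
    constructor
    · refine List.isChain_cons_cons.2 ⟨?_, ih1⟩
      rw [BGrammar.step_iff]
      exact ⟨F₁.map root, A, m, F₂.map root, τ.children.map root, by simp [hr], by simpa using h,
        (hF τ (by simp)).expands hr, by simp⟩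
    · rw [List.getLast?_cons_cons, ih2]
      simp [yield_eq_flatMap hr]

/-- The forest is assembled from the end of the chain: the mature word is a forest of leaves, and
each step read backwards joins the trees of a right-hand side under the nonterminal that was
expanded. -/
theorem exists_run_of_isChain {ω : IWord T N} {p : List (IWord T N)} {w : List T}
    (hp : (ω :: p).IsChain (G.Step φ)) (hl : (ω :: p).getLast? = some (w.map ISym.ter)) :
    ∃ F : List (PTree T N), (∀ τ ∈ F, τ.Valid G) ∧ F.map root = ω ∧ F.flatMap yield = w ∧
      Run φ F (ω :: p) := by
  induction p generalizing ω with
  | nil =>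
    simp only [List.getLast?_singleton, Option.some.injEq] at hl
    subst hl
    have h1 : (w.map PTree.leaf).map root = (w.map ISym.ter : IWord T N) := by
      rw [List.map_map]; rfl
    refine ⟨w.map PTree.leaf, ?_, h1, ?_, ?_⟩
    · intro τ hτ
      obtain ⟨t, -, rfl⟩ := List.mem_map.1 hτ
      trivial
    · induction w <;> simp_all [PTree.yield]
    · have := Run.done (φ := φ) (w.map PTree.leaf) (by rw [h1]; exact φ.pos_map_ter w)
      rwa [h1] at this
  | cons ω' p ih =>
    obtain ⟨hs, hp⟩ := List.isChain_cons_cons.1 hp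
    rw [List.getLast?_cons_cons] at hl
    obtain ⟨F, hF, hr, rfl, hrun⟩ := ih hp hl
    obtain ⟨ω₁, A, m, ω₂, x, rfl, hpos, hx, rfl⟩ := BGrammar.step_iff.1 hs
    obtain ⟨F₁₂, F₃, rfl, h12, rfl⟩ := List.map_eq_append_iff.1 hr
    obtain ⟨F₁, F₂, rfl, rfl, rfl⟩ := List.map_eq_append_iff.1 h12
    obtain ⟨τ, hτ, hroot, rfl⟩ :=
      exists_of_children (fun c hc => hF c (by simp [hc])) hx
    have h1 : (F₁ ++ τ :: F₃).map root = F₁.map root ++ ISym.non A m :: F₃.map root := by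
      simp [hroot]
    refine ⟨F₁ ++ τ :: F₃, ?_, h1, ?_, ?_⟩
    · intro c hc
      simp only [List.mem_append, List.mem_cons] at hc
      rcases hc with hc | rfl | hc
      · exact hF c (by simp [hc])
      · exact hτ
      · exact hF c (by simp [hc])
    · simp [yield_eq_flatMap hroot]
    · have := Run.step F₁ τ F₃ _ (by rw [h1]; simpa using hpos) hrun
      rwa [h1] at this

/-- The policy sees the labels of the roots only, and these are the same in both runs, hence so is
the expanded tree. -/
theorem Run.functional {F : List (PTree T N)} {p q : List (IWord T N)} (h : Run φ F p)
    (h' : Run φ F q) : p = q := by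
  induction h generalizing q with
  | done F h =>
    cases h' with
    | done => rfl
    | step F₁ τ F₂ p h' => rw [h'] at h; cases h
  | step F₁ τ F₂ p h hp ih =>
    generalize hF : F₁ ++ τ :: F₂ = F at *
    cases h' with
    | done _ h' => rw [h'] at h; cases h
    | step F₁' τ' F₂' p' h' hp' =>
      have hlen : F₁.length = F₁'.length := by
        rw [h'] at h
        exact (Option.some.inj h).symm
      obtain ⟨rfl, h2⟩ := List.append_inj hF hlen
      simp only [List.cons.injEq] at h2
      obtain ⟨rfl, rfl⟩ := h2
      rw [ih hp']

/-- Read backwards: the label word tells where the expansion took place and of which nonterminal,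
hence how many consecutive trees of the next forest are its children. By induction the next forests
agree, and cutting them at the same places recovers the same tree. -/
theorem Run.injective {F F' : List (PTree T N)} {p : List (IWord T N)} (h : Run φ F p)
    (h' : Run φ F' p) (hF : ∀ τ ∈ F, τ.Valid G) (hF' : ∀ τ ∈ F', τ.Valid G) : F = F' := by
  induction h generalizing F' with
  | done F h =>
    generalize hp : [F.map root] = p at h'
    cases h' with
    | done _ h' =>
      simp only [List.cons.injEq, and_true] at hp
      have h1 := hp
      rw [map_root_of_pos_none h, map_root_of_pos_none h'] at h1
      rw [eq_map_leaf h, eq_map_leaf h', ISym.map_ter_injective h1]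
    | step F₁ τ F₂ p h' hp' =>
      obtain ⟨q, rfl⟩ := hp'.exists_cons
      simp at hp
  | step F₁ τ F₂ p h hp ih =>
    generalize hq : (F₁ ++ τ :: F₂).map root :: p = q at h'
    cases h' with
    | done _ h' =>
      obtain ⟨q, rfl⟩ := hp.exists_cons
      simp at hq
    | step F₁' τ' F₂' p' h' hp' =>
      simp only [List.cons.injEq] at hq
      obtain ⟨hr, rfl⟩ := hq
      have hlen : F₁.length = F₁'.length := by
        rw [hr, h'] at h
        exact (Option.some.inj h).symm
      obtain ⟨A, m, hA⟩ := exists_root_of_pos h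
      have hA' : τ'.root = ISym.non A m := by
        simp only [List.map_append, List.map_cons] at hr
        have := (List.append_inj hr (by simpa using hlen)).2
        simp only [List.cons.injEq] at this
        rw [← this.1, hA]
      have heq := ih hp' (valid_expand hF) (valid_expand hF')
      have hτ := hF τ (by simp)
      have hτ' := hF' τ' (by simp)
      have hcl : τ.children.length = τ'.children.length := by
        simpa using (hτ.expands hA).length_eq (hτ'.expands hA')
      obtain ⟨h12, h3⟩ := List.append_inj heq (by simp [hlen, hcl])
      obtain ⟨h1, h2⟩ := List.append_inj h12 hlen
      rw [h1, h3, hτ.ext hτ' hA hA' h2]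

end PTree

/-! ### Uniqueness of parse trees, and acyclicity of unions -/

namespace BGrammar

variable {T N : Type} {G : BGrammar T N} {φ : Policy T N}

/-- Trees for `A` are determined by their yields. -/
def TreeUnique (G : BGrammar T N) (A : N) : Prop :=
  ∀ (τ τ' : PTree T N) (m : ℕ), τ.Valid G → τ'.Valid G → τ.root = ISym.non A m →
    τ'.root = ISym.non A m → τ.yield = τ'.yield → τ = τ'

/-- Two trees with the same yield unfold to two walks of one word; these coincide, and a run
determines its forest. -/
theorem IsUnambiguous.treeUnique_start (h : G.IsUnambiguous) : G.TreeUnique G.start := by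
  obtain ⟨φ, h⟩ := h
  intro τ τ' m hτ hτ' hr hr' hy
  obtain ⟨p, hp⟩ := PTree.exists_run φ [τ]
  obtain ⟨p', hp'⟩ := PTree.exists_run φ [τ']
  have h1 := hp.isChain (G := G) (by simpa using hτ)
  have h1' := hp'.isChain (G := G) (by simpa using hτ')
  obtain ⟨q, hq⟩ := hp.exists_cons
  obtain ⟨q', hq'⟩ := hp'.exists_cons
  have hm := PTree.length_of_root hr
  have hm' := PTree.length_of_root hr'
  have := h τ.yield p p' ⟨by simp [hq, hr, hm], h1.1, by simpa using h1.2⟩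
    ⟨by simp [hq', hr', hy, hm'], h1'.1, by simpa [hy] using h1'.2⟩
  subst this
  simpa using hp.injective hp' (by simpa using hτ) (by simpa using hτ')

/-- The policy here is arbitrary: uniqueness of trees does not mention policies, and each walk is
the run of the unique tree. In this sense the choice of the policy in the definition of unambiguity
is immaterial. -/
theorem TreeUnique.walk_unique (h : G.TreeUnique G.start) {w : List T} {p q : List (IWord T N)}
    (hp : G.IsWalk φ w p) (hq : G.IsWalk φ w q) : p = q := by
  have key : ∀ p, G.IsWalk φ w p → ∃ τ : PTree T N, τ.Valid G ∧
      τ.root = ISym.non G.start w.length ∧ τ.yield = w ∧ PTree.Run φ [τ] p := by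
    rintro p ⟨h1, h2, h3⟩
    obtain ⟨p, rfl⟩ := List.head?_eq_some_iff.1 h1
    obtain ⟨F, hF, hr, hy, hrun⟩ := PTree.exists_run_of_isChain h2 h3
    match F with
    | [τ] => exact ⟨τ, by simpa using hF, by simpa using hr, by simpa using hy, hrun⟩
    | [] | _ :: _ :: _ => simp at hr
  obtain ⟨τ, hτ, hr, hy, hrun⟩ := key p hp
  obtain ⟨τ', hτ', hr', hy', hrun'⟩ := key q hq
  rw [h τ τ' _ hτ hτ' hr hr' (hy.trans hy'.symm)] at hrun
  exact hrun.functional hrun'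

theorem TreeUnique.isUnambiguous (h : G.TreeUnique G.start) (φ : Policy T N) : G.IsUnambiguous :=
  ⟨φ, fun _ _ _ hp hq => h.walk_unique hp hq⟩

section

variable [Fintype N]

theorem IsBCNF.exists_tree (hG : G.IsBCNF) (A : N) :
    ∃ (τ : PTree T N) (m : ℕ), τ.Valid G ∧ τ.root = ISym.non A m := by
  obtain ⟨w, hw⟩ := hG.productive A
  obtain ⟨τ, hτ, hr, -⟩ := hG.mem_lang_iff.1 hw
  exact ⟨τ, _, hτ, hr⟩

theorem IsBCNF.expands_product (hG : G.IsBCNF) {A B C : N} (h : G.rule A = BRule.product B C)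
    {l r : PTree T N} (hl : l.Valid G) (hr : r.Valid G) {i j : ℕ} (hl' : l.root = ISym.non B i)
    (hr' : r.root = ISym.non C j) : (PTree.bin A l r).Valid G := by
  refine ⟨?_, hl, hr⟩
  have h1 := (hG.length_pos h).1 hl (PTree.sym_of_root hl')
  have h2 := (hG.length_pos h).2 hr (PTree.sym_of_root hr')
  have e1 := PTree.length_of_root hl'
  have e2 := PTree.length_of_root hr'
  simp only [Expands, h]
  exact ⟨i, by omega, by omega, by rw [hl', hr', e1, e2]; simp⟩

/-- Two trees for `B` are placed in the same context below `A`. In a product the sibling is any tree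
of the other operand, which exists by productivity. -/
theorem TreeUnique.dep (hG : G.IsBCNF) {A B : N} (h : G.TreeUnique A) (hd : G.Dep A B) :
    G.TreeUnique B := by
  intro τ τ' m hτ hτ' hr hr' hy
  have e := PTree.length_of_root hr
  have e' := PTree.length_of_root hr'
  unfold Dep at hd
  rcases hA : G.rule A with ⟨C, D⟩ | ⟨C, D⟩ | t | _ <;> rw [hA] at hd <;>
    simp only [BRule.operands, List.mem_cons, List.not_mem_nil, or_false] at hd
  · rcases hd with rfl | rfl
    · obtain ⟨κ, m', hκ, hκr⟩ := hG.exists_tree D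
      have := h (.bin A τ κ) (.bin A τ' κ) _ (hG.expands_product hA hτ hκ hr hκr)
        (hG.expands_product hA hτ' hκ hr' hκr) rfl (by simp [PTree.root, hy])
        (by simp [PTree.yield, hy])
      exact (PTree.bin.inj this).2.1
    · obtain ⟨κ, m', hκ, hκr⟩ := hG.exists_tree C
      have := h (.bin A κ τ) (.bin A κ τ') _ (hG.expands_product hA hκ hτ hκr hr)
        (hG.expands_product hA hκ hτ' hκr hr') rfl (by simp [PTree.root, hy])
        (by simp [PTree.yield, hy])
      exact (PTree.bin.inj this).2.2
  · have key : ∀ τ : PTree T N, τ.Valid G → τ.root = ISym.non B m → τ.yield.length = m →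
        (PTree.un A τ).Valid G := by
      intro τ hτ hr e
      refine ⟨?_, hτ⟩
      simp only [Expands, hA, hr, e]
      rcases hd with rfl | rfl <;> simp
    have := h (.un A τ) (.un A τ') _ (key τ hτ hr e) (key τ' hτ' hr' e') rfl
      (by simp [PTree.root, hy]) (by simp [PTree.yield, hy])
    exact (PTree.un.inj this).2

theorem TreeUnique.reaches (hG : G.IsBCNF) {A B : N} (h : G.TreeUnique A) (hr : G.Reaches A B) :
    G.TreeUnique B := by
  induction hr with
  | refl => exact h
  | tail _ hd ih => exact ih.dep hG hd

/-- `B` is an operand of the union `A`. -/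
def UnionDep (G : BGrammar T N) (A B : N) : Prop :=
  ∃ C, G.rule A = BRule.union B C ∨ G.rule A = BRule.union C B

omit [Fintype N] in
theorem UnionDep.dep {A B : N} (h : G.UnionDep A B) : G.Dep A B := by
  obtain ⟨C, h | h⟩ := h <;> simp [Dep, h, BRule.operands]

omit [Fintype N] in
-- A chain of unions stacks unary nodes on a tree without changing its yield; the strict growth of
-- the node count is what refutes cycles.
theorem UnionDep.exists_tree {A B : N} (h : Relation.TransGen G.UnionDep A B) {τ : PTree T N}
    {m : ℕ} (hτ : τ.Valid G) (hr : τ.root = ISym.non B m) :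
    ∃ τ' : PTree T N, τ'.Valid G ∧ τ'.root = ISym.non A m ∧ τ'.yield = τ.yield ∧
      τ.count < τ'.count := by
  have key : ∀ {A B : N}, G.UnionDep A B → ∀ {τ : PTree T N}, τ.Valid G →
      τ.root = ISym.non B m → ∃ τ' : PTree T N, τ'.Valid G ∧ τ'.root = ISym.non A m ∧
        τ'.yield = τ.yield ∧ τ.count < τ'.count := by
    intro A B h τ hτ hr
    have e := PTree.length_of_root hr
    refine ⟨.un A τ, ⟨?_, hτ⟩, by simp [PTree.root, e], rfl, by simp [PTree.count]⟩
    obtain ⟨C, h | h⟩ := h <;> simp [Expands, h, hr, e]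
  induction h using Relation.TransGen.head_induction_on with
  | single h => exact key h hτ hr
  | head h _ ih =>
    obtain ⟨τ', h1, h2, h3, h4⟩ := ih
    obtain ⟨τ'', h1', h2', h3', h4'⟩ := key h h1 h2
    exact ⟨τ'', h1', h2', h3'.trans h3, h4.trans h4'⟩

/-- Going once around a cycle of unions would turn a tree into a larger one with the same root and
yield. -/
theorem TreeUnique.acyclic (hG : G.IsBCNF) {A : N} (h : G.TreeUnique A) :
    ¬ Relation.TransGen G.UnionDep A A := by
  intro hc
  obtain ⟨τ, m, hτ, hr⟩ := hG.exists_tree A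
  obtain ⟨τ', h1, h2, h3, h4⟩ := UnionDep.exists_tree hc hτ hr
  rw [h _ _ m hτ h1 hr h2 h3.symm] at h4
  exact lt_irrefl _ h4

open Classical in
/-- The number of nonterminals that can be reached from `A` through unions. -/
def height (G : BGrammar T N) (A : N) : ℕ :=
  (Finset.univ.filter fun B => Relation.TransGen G.UnionDep A B).card

theorem TreeUnique.height_lt_card (hG : G.IsBCNF) {A : N} (h : G.TreeUnique A) :
    G.height A < Fintype.card N := by
  classical
  refine Finset.card_lt_card (Finset.ssubset_univ_iff.2 fun hu => ?_)
  have := Finset.mem_univ A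
  rw [← hu, Finset.mem_filter] at this
  exact h.acyclic hG this.2

/-- `B` is counted for `A` but, by acyclicity, not for itself. -/
theorem TreeUnique.height_lt (hG : G.IsBCNF) {A B : N} (h : G.TreeUnique A)
    (hU : G.UnionDep A B) : G.height B < G.height A := by
  classical
  refine Finset.card_lt_card (Finset.ssubset_iff_of_subset ?_ |>.2 ⟨B, ?_, ?_⟩)
  · intro C hC
    simp only [Finset.mem_filter, Finset.mem_univ, true_and] at hC ⊢
    exact .head hU hC
  · simpa using .single hU
  · simpa using (h.dep hG hU.dep).acyclic hG

end

end BGrammar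

end

noncomputable section

/-! ## Holonomic recurrences for the solutions of binary polynomial systems -/

open Classical in
/-- The Jacobian matrix of the polynomial system that a binary grammar stands for. -/
def BRule.jacobian {T I R : Type} [CommRing R] (rule : I → BRule T I) (x : I → R) :
    Matrix I I R := fun A D =>
  match rule A with
  | BRule.product B C => (if D = B then x C else 0) + (if D = C then x B else 0)
  | BRule.union B C => (if D = B then 1 else 0) + (if D = C then 1 else 0)
  | _ => 0

/-- `x` solves the polynomial system with the given constants at terminals and epsilon. -/
def BRule.Solves {T I R : Type} [CommRing R] (rule : I → BRule T I) (x e : I → R) : Prop :=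
  ∀ A, match rule A with
    | BRule.product B C => x A = x B * x C
    | BRule.union B C => x A = x B + x C
    | _ => x A = e A

open Classical in
theorem Subalgebra.det_mem {k R I : Type} [CommRing k] [CommRing R] [Algebra k R] [Fintype I]
    (S : Subalgebra k R) {M : Matrix I I R} (hM : ∀ A B, M A B ∈ S) : M.det ∈ S := by
  rw [Matrix.det_apply]
  refine sum_mem fun σ _ => ?_
  rw [Units.smul_def, zsmul_eq_mul]
  exact mul_mem (intCast_mem _ _) (prod_mem fun i _ => hM _ _)

namespace BRule

variable {T I R : Type} [CommRing R] {rule : I → BRule T I} {x e : I → R}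

theorem Solves.map {S : Type} [CommRing S] (h : Solves rule x e) (φ : R →+* S) :
    Solves rule (fun A => φ (x A)) (fun A => φ (e A)) := by
  intro A
  have := h A
  split at this <;> simp [this]

theorem jacobian_map {S : Type} [CommRing S] (φ : R →+* S) :
    jacobian rule (fun A => φ (x A)) = (jacobian rule x).map φ := by
  classical
  ext A D
  simp only [jacobian, Matrix.map_apply]
  split
  · simp [apply_ite φ]
  · simp [apply_ite φ]
  · simp

open Classical in
theorem det_one_sub_jacobian_map [Fintype I] {S : Type} [CommRing S] (φ : R →+* S) :
    (1 - jacobian rule (fun A => φ (x A))).det = φ (1 - jacobian rule x).det := by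
  rw [RingHom.map_det, map_sub, map_one, RingHom.mapMatrix_apply, jacobian_map]

open Classical in
theorem one_sub_jacobian_mem {k : Type} [CommRing k] [Algebra k R] (S : Subalgebra k R)
    (hS : ∀ A, x A ∈ S) (A B : I) : (1 - jacobian rule x) A B ∈ S := by
  simp only [Matrix.sub_apply, Matrix.one_apply, jacobian]
  refine sub_mem ?_ ?_
  · split_ifs
    exacts [one_mem _, zero_mem _]
  · split
    · refine add_mem ?_ ?_ <;> split_ifs <;> first | exact hS _ | exact zero_mem _
    · refine add_mem ?_ ?_ <;> split_ifs <;> first | exact one_mem _ | exact zero_mem _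
    · exact zero_mem _

open Classical in
-- The linearized system: the vector of the `D (x A)` solves (1 - J) v = D e, where the right-hand
-- side lives on terminal and epsilon rules. It is used twice, for derivations over the rational
-- functions, which kill the constants, and for the Euler derivation.
theorem Solves.derivation [Fintype I] {k M : Type} [CommRing k] [Algebra k R] [AddCommGroup M]
    [Module k M] [Module R M] (h : Solves rule x e) (D : Derivation k R M) (A : I) :
    D (x A) = ∑ B, jacobian rule x A B • D (x B) +
      (match rule A with
        | product _ _ => 0
        | union _ _ => 0
        | _ => D (e A)) := by
  have := h A
  simp only [jacobian]
  split at this <;> simp_all [add_smul, Finset.sum_add_distrib, ite_smul, add_comm]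

end BRule

open scoped IntermediateField.algebraAdjoinAdjoin in
-- A derivation that vanishes on generators vanishes on the field they generate. Applied to the
-- universal one, this makes the Kähler differentials zero, so the extension is formally unramified;
-- being essentially of finite type over a field, it is finite.
theorem IntermediateField.finiteDimensional_adjoin_of_derivation {K E I : Type} [Field K]
    [CharZero K] [Field E] [Algebra K E] [Fintype I] (x : I → E)
    (h : ∀ (L : IntermediateField K E) (hx : ∀ A, x A ∈ L) (M : Type) [AddCommGroup M]
      [Module K M] [Module L M] (D : Derivation K L M) (A : I), D ⟨x A, hx A⟩ = 0) :
    FiniteDimensional K (IntermediateField.adjoin K (Set.range x)) := by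
  classical
  have hx : ∀ A, x A ∈ IntermediateField.adjoin K (Set.range x) :=
    fun A => IntermediateField.subset_adjoin _ _ ⟨A, rfl⟩
  have hess : Algebra.EssFiniteType K (IntermediateField.adjoin K (Set.range x)) := by
    have : Algebra.FiniteType K (Algebra.adjoin K (Set.range x)) :=
      .adjoin_of_finite (Set.finite_range x)
    have : Algebra.EssFiniteType (Algebra.adjoin K (Set.range x))
        (IntermediateField.adjoin K (Set.range x)) :=
      .of_isLocalization _ (nonZeroDivisors _)
    exact .comp _ (Algebra.adjoin K (Set.range x)) _
  have hD : ∀ y, KaehlerDifferential.D K (IntermediateField.adjoin K (Set.range x)) y = 0 := by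
    rintro ⟨y, hy⟩
    set D := KaehlerDifferential.D K (IntermediateField.adjoin K (Set.range x))
    induction hy using IntermediateField.adjoin_induction with
    | mem y hy =>
      obtain ⟨A, rfl⟩ := hy
      exact h _ hx _ D A
    | algebraMap c => exact D.map_algebraMap c
    | add y z hy hz h1 h2 =>
      have := D.map_add ⟨y, hy⟩ ⟨z, hz⟩
      rwa [h1, h2, add_zero] at this
    | inv y hy h1 =>
      have := D.leibniz_inv ⟨y, hy⟩
      rwa [h1, smul_zero] at this
    | mul y z hy hz h1 h2 =>
      have := D.leibniz ⟨y, hy⟩ ⟨z, hz⟩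
      rwa [h1, h2, smul_zero, smul_zero, add_zero] at this
  have : Algebra.FormallyUnramified K (IntermediateField.adjoin K (Set.range x)) := by
    constructor
    rw [← Submodule.subsingleton_iff (IntermediateField.adjoin K (Set.range x)),
      ← subsingleton_iff_bot_eq_top, ← KaehlerDifferential.span_range_derivation, eq_comm,
      Submodule.span_eq_bot]
    rintro _ ⟨y, rfl⟩
    exact hD y
  exact Algebra.FormallyUnramified.finite_of_free K _

open Classical in
/-- The solutions of a binary polynomial system with invertible Jacobian generate a finite
extension. -/
theorem BRule.Solves.finiteDimensional_adjoin {T K E I : Type} [Field K] [CharZero K] [Field E]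
    [Algebra K E] [Fintype I] {rule : I → BRule T I} {x : I → E} {e : I → K}
    (h : Solves rule x (fun A => algebraMap K E (e A))) (hdet : (1 - jacobian rule x).det ≠ 0) :
    FiniteDimensional K (IntermediateField.adjoin K (Set.range x)) := by
  refine IntermediateField.finiteDimensional_adjoin_of_derivation x
    fun L hx M _ _ _ D A => ?_
  set y : I → L := fun A => ⟨x A, hx A⟩
  have hy : Solves rule y (fun A => algebraMap K L (e A)) := by
    intro A
    have := h A
    split at this <;> exact Subtype.ext this
  have hJ : (1 - jacobian rule y).det ≠ 0 := by
    intro h0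
    apply hdet
    have := det_one_sub_jacobian_map (rule := rule) (x := y) L.val.toRingHom
    rw [h0, map_zero] at this
    exact this
  -- Linear functionals reduce a derivation with values in a vector space to scalar vectors, which
  -- lie in the kernel of the invertible matrix 1 - J.
  have hz : ∀ ℓ : Module.Dual L M, (fun A => ℓ (D (y A))) = 0 := by
    intro ℓ
    by_contra hne
    apply hJ
    rw [← Matrix.exists_mulVec_eq_zero_iff]
    refine ⟨_, hne, ?_⟩
    rw [Matrix.sub_mulVec, Matrix.one_mulVec, sub_eq_zero]
    ext A
    have := congrArg ℓ (hy.derivation D A)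
    have h0 : (match rule A with
        | product _ _ => 0
        | union _ _ => 0
        | _ => D (algebraMap K L (e A))) = 0 := by
      split <;> simp
    rw [h0, add_zero, map_sum] at this
    rw [this]
    simp [Matrix.mulVec, dotProduct]
  rw [← Module.forall_dual_apply_eq_zero_iff L]
  exact fun ℓ => congrFun (hz ℓ) A

end

/-! ### Linear differential equations for the solutions of a polynomial system -/

noncomputable section
open Prog

open scoped Polynomial PowerSeries

/-- The Euler derivation `X d/dX` on power series. -/
def PowerSeries.euler : Derivation ℝ ℝ⟦X⟧ ℝ⟦X⟧ := (PowerSeries.X : ℝ⟦X⟧) • PowerSeries.derivative ℝ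

/-- Monomials are eigenvectors of X d/dX. A differential equation written with this operator
therefore translates into a recurrence without any shift of indices by the derivatives. -/
theorem PowerSeries.coeff_euler_iterate (j m : ℕ) (f : ℝ⟦X⟧) :
    PowerSeries.coeff m (PowerSeries.euler^[j] f) = (m : ℝ) ^ j * PowerSeries.coeff m f := by
  induction j generalizing f with
  | zero => simp
  | succ j ih =>
    rw [Function.iterate_succ_apply, ih]
    have : PowerSeries.coeff m (PowerSeries.euler f) = m * PowerSeries.coeff m f := by
      simp only [PowerSeries.euler, Derivation.coe_smul, Pi.smul_apply, smul_eq_mul]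
      cases m with
      | zero => simp
      | succ m =>
        rw [PowerSeries.coeff_succ_X_mul, PowerSeries.coeff_derivative]
        push_cast
        ring
    rw [this]
    ring

namespace BRule

variable {T I : Type} {rule : I → BRule T I} {f : I → ℝ⟦X⟧} {e : I → ℝ[X]}

/-- A subalgebra that contains the solutions and is closed under the Euler derivation. -/
def eulerAlgebra (f : I → ℝ⟦X⟧) (δ : ℝ⟦X⟧) : Subalgebra ℝ ℝ⟦X⟧ :=
  Algebra.adjoin ℝ (insert PowerSeries.X (insert δ⁻¹ (Set.range f)))

theorem coe_mem_eulerAlgebra (f : I → ℝ⟦X⟧) (δ : ℝ⟦X⟧) (p : ℝ[X]) :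
    (p : ℝ⟦X⟧) ∈ eulerAlgebra f δ := by
  have hX : (PowerSeries.X : ℝ⟦X⟧) ∈ eulerAlgebra f δ := Algebra.subset_adjoin (by simp)
  induction p using Polynomial.induction_on' with
  | add p q hp hq => rw [Polynomial.coe_add]; exact add_mem hp hq
  | monomial n a =>
    rw [← Polynomial.C_mul_X_pow_eq_monomial, Polynomial.coe_mul, Polynomial.coe_pow,
      Polynomial.coe_X, Polynomial.coe_C]
    exact mul_mem ((eulerAlgebra f δ).algebraMap_mem a) (pow_mem hX _)

open Classical in
-- Cramer's rule for (1 - J) v = θe, where θ is the Euler derivation, expresses the θ-derivatives of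
-- the solutions by the solutions, X and the inverse of det(1 - J). That inverse has to be adjoined,
-- and its own derivative is again in the algebra by the quotient rule.
theorem Solves.euler_mem [Fintype I] (h : Solves rule f fun A => (e A : ℝ⟦X⟧))
    (hdet : PowerSeries.constantCoeff (1 - jacobian rule f).det ≠ 0) {g : ℝ⟦X⟧}
    (hg : g ∈ eulerAlgebra f (1 - jacobian rule f).det) :
    PowerSeries.euler g ∈ eulerAlgebra f (1 - jacobian rule f).det := by
  set J := jacobian rule f
  set S := eulerAlgebra f (1 - J).det
  have hX : (PowerSeries.X : ℝ⟦X⟧) ∈ S := Algebra.subset_adjoin (by simp)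
  have hδ : (1 - J).det⁻¹ ∈ S := Algebra.subset_adjoin (by simp)
  have hf : ∀ A, f A ∈ S := fun A => Algebra.subset_adjoin (by simp)
  have hJ : ∀ A B, (1 - J) A B ∈ S := one_sub_jacobian_mem S hf
  have hpoly : ∀ p : ℝ[X], PowerSeries.euler (p : ℝ⟦X⟧) ∈ S := by
    intro p
    simp only [PowerSeries.euler, Derivation.coe_smul, Pi.smul_apply, smul_eq_mul,
      PowerSeries.derivative_coe]
    exact mul_mem hX (coe_mem_eulerAlgebra _ _ _)
  have hadj : ∀ A B, (1 - J).adjugate A B ∈ S := by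
    intro A B
    rw [Matrix.adjugate_apply]
    refine S.det_mem fun i j => ?_
    rw [Matrix.updateRow_apply]
    split_ifs
    · rw [Pi.single_apply]; split_ifs
      exacts [one_mem _, zero_mem _]
    · exact hJ _ _
  have hef : ∀ A, PowerSeries.euler (f A) ∈ S := by
    set c : I → ℝ⟦X⟧ := fun A => match rule A with
        | product _ _ => 0
        | union _ _ => 0
        | _ => PowerSeries.euler (e A : ℝ⟦X⟧) with hc
    have hcS : ∀ A, c A ∈ S := by
      intro A
      simp only [hc]
      split
      exacts [zero_mem _, zero_mem _, hpoly _]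
    set v : I → ℝ⟦X⟧ := fun A => PowerSeries.euler (f A)
    have h1 : (1 - J).mulVec v = c := by
      ext1 A
      rw [Matrix.sub_mulVec, Matrix.one_mulVec, Pi.sub_apply, sub_eq_iff_eq_add, add_comm]
      exact h.derivation PowerSeries.euler A
    have h2 : (1 - J).det • v = (1 - J).adjugate.mulVec c := by
      rw [← h1, Matrix.mulVec_mulVec, Matrix.adjugate_mul, Matrix.smul_mulVec, Matrix.one_mulVec]
    intro A
    have h3 : v A = (1 - J).det⁻¹ * ((1 - J).adjugate.mulVec c) A := by
      rw [← h2, Pi.smul_apply, smul_eq_mul, ← mul_assoc, PowerSeries.inv_mul_cancel _ hdet, one_mul]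
    change v A ∈ S
    rw [h3]
    exact mul_mem hδ (sum_mem fun B _ => mul_mem (hadj _ _) (hcS _))
  have key : ∀ (s : Set ℝ⟦X⟧), s ⊆ S → (∀ g ∈ s, PowerSeries.euler g ∈ S) →
      ∀ g ∈ Algebra.adjoin ℝ s, PowerSeries.euler g ∈ S := by
    intro s hs hes g hg
    induction hg using Algebra.adjoin_induction with
    | mem g hg => exact hes g hg
    | algebraMap r => rw [Derivation.map_algebraMap]; exact zero_mem _
    | add g k hg hk h1 h2 => rw [map_add]; exact add_mem h1 h2
    | mul g k hg hk h1 h2 =>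
      rw [Derivation.leibniz, smul_eq_mul, smul_eq_mul]
      have : Algebra.adjoin ℝ s ≤ S := Algebra.adjoin_le hs
      exact add_mem (mul_mem (this hg) h2) (mul_mem (this hk) h1)
  have hrange : ∀ g ∈ Algebra.adjoin ℝ (Set.range f), PowerSeries.euler g ∈ S :=
    key _ (by rintro _ ⟨A, rfl⟩; exact hf A) (by rintro _ ⟨A, rfl⟩; exact hef A)
  refine key _ Algebra.subset_adjoin ?_ g hg
  rintro g (rfl | rfl | ⟨A, rfl⟩)
  · simpa using hpoly Polynomial.X
  · have h1 : PowerSeries.euler (1 - J).det ∈ S := by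
      exact hrange _ (Subalgebra.det_mem _
        (one_sub_jacobian_mem _ fun A => Algebra.subset_adjoin ⟨A, rfl⟩))
    have h2 : PowerSeries.euler (1 - J).det⁻¹ =
        -((1 - J).det⁻¹ ^ 2 * PowerSeries.euler (1 - J).det) := by
      simp only [PowerSeries.euler, Derivation.coe_smul, Pi.smul_apply, smul_eq_mul,
        PowerSeries.derivative_inv']
      ring
    rw [h2]
    exact neg_mem (mul_mem (pow_mem hδ 2) h1)
  · exact hef A

open Classical in
/-- A component of the solution satisfies a nontrivial linear differential equation. -/
theorem Solves.exists_euler_relation [Fintype I] (h : Solves rule f fun A => (e A : ℝ⟦X⟧))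
    (hdet : PowerSeries.constantCoeff (1 - jacobian rule f).det ≠ 0) (A : I) :
    ∃ (s : Finset ℕ) (p : ℕ → ℝ[X]), (∃ j ∈ s, p j ≠ 0) ∧
      ∑ j ∈ s, (p j : ℝ⟦X⟧) * PowerSeries.euler^[j] (f A) = 0 := by
  -- The scene is the field of fractions of ℝ⟦X⟧ as an extension of ℝ(X). The solutions generate a
  -- finite extension `L` inside it, and `L` contains the Euler algebra, because it also contains
  -- the inverse of the determinant.
  let K := FractionRing ℝ[X]
  let E := FractionRing ℝ⟦X⟧
  have hinj : Function.Injective (algebraMap ℝ[X] E) := by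
    rw [IsScalarTower.algebraMap_eq ℝ[X] ℝ⟦X⟧ E]
    exact (IsFractionRing.injective ℝ⟦X⟧ E).comp (Polynomial.coe_injective ℝ)
  have : FaithfulSMul ℝ[X] E := (faithfulSMul_iff_algebraMap_injective _ _).2 hinj
  let _ : Algebra K E := FractionRing.liftAlgebra ℝ[X] E
  have : IsScalarTower ℝ[X] K E := FractionRing.isScalarTower_liftAlgebra ℝ[X] E
  let ι := algebraMap ℝ⟦X⟧ E
  have hιp : ∀ p : ℝ[X], ι p = algebraMap K E (algebraMap ℝ[X] K p) := by
    intro p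
    rw [← IsScalarTower.algebraMap_apply ℝ[X] K E, IsScalarTower.algebraMap_apply ℝ[X] ℝ⟦X⟧ E]
    rfl
  have hs : Solves rule (fun A => ι (f A)) (fun A => algebraMap K E (algebraMap ℝ[X] K (e A))) := by
    have := h.map ι
    simpa only [hιp] using this
  have hd : (1 - jacobian rule f).det ≠ 0 := by
    intro h0
    simp [h0] at hdet
  have hfin := hs.finiteDimensional_adjoin (K := K) (by
    rw [det_one_sub_jacobian_map (rule := rule) (x := f) ι, Ne,
      map_eq_zero_iff _ (IsFractionRing.injective ℝ⟦X⟧ E)]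
    exact hd)
  set L := IntermediateField.adjoin K (Set.range fun A => ι (f A))
  set S := eulerAlgebra f (1 - jacobian rule f).det
  have hmem : ∀ j, PowerSeries.euler^[j] (f A) ∈ S := by
    intro j
    induction j with
    | zero => exact Algebra.subset_adjoin (by simp)
    | succ j ih =>
      rw [Function.iterate_succ_apply']
      exact h.euler_mem hdet ih
  have hfL : ∀ B, ι (f B) ∈ L := fun B => IntermediateField.subset_adjoin _ _ ⟨B, rfl⟩
  have hpL : ∀ p : ℝ[X], ι p ∈ L := fun p => by rw [hιp]; exact L.algebraMap_mem _
  have hadj : ∀ s : Set ℝ⟦X⟧, (∀ g ∈ s, ι g ∈ L) → ∀ g ∈ Algebra.adjoin ℝ s, ι g ∈ L := by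
    intro s hs g hg
    induction hg using Algebra.adjoin_induction with
    | mem g hg => exact hs g hg
    | algebraMap r => simpa using hpL (Polynomial.C r)
    | add g k hg hk h1 h2 => rw [map_add]; exact add_mem h1 h2
    | mul g k hg hk h1 h2 => rw [map_mul]; exact mul_mem h1 h2
  have hδL : ι (1 - jacobian rule f).det ∈ L := by
    exact hadj (Set.range f) (by rintro _ ⟨B, rfl⟩; exact hfL B) _ (Subalgebra.det_mem _
      (one_sub_jacobian_mem _ fun A => Algebra.subset_adjoin ⟨A, rfl⟩))
  have hSL : ∀ g ∈ S, ι g ∈ L := by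
    refine hadj _ ?_
    rintro g (rfl | rfl | ⟨B, rfl⟩)
    · simpa using hpL Polynomial.X
    · have h1 : ι (1 - jacobian rule f).det⁻¹ = (ι (1 - jacobian rule f).det)⁻¹ := by
        refine eq_inv_of_mul_eq_one_left ?_
        rw [← map_mul, PowerSeries.inv_mul_cancel _ hdet, map_one]
      rw [h1]
      exact inv_mem hδL
    · exact hfL B
  let b : ℕ → L := fun j => ⟨ι (PowerSeries.euler^[j] (f A)), hSL _ (hmem j)⟩
  -- An infinite sequence of derivatives in a finite-dimensional space. Passing from ℝ(X) to ℝ[X]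
  -- below amounts to clearing denominators.
  have hb : ¬ LinearIndependent K b := fun hb => by
    have := hb.finite
    exact not_finite ℕ
  have hb' : ¬ LinearIndependent ℝ[X] fun j => ι (PowerSeries.euler^[j] (f A)) := fun hli =>
    hb (LinearIndependent.of_comp L.val.toLinearMap
      ((LinearIndependent.iff_fractionRing ℝ[X] K).1 hli))
  rw [not_linearIndependent_iff] at hb'
  obtain ⟨s, p, hp, j, hj, hpj⟩ := hb'
  refine ⟨s, p, ⟨j, hj, hpj⟩, IsFractionRing.injective ℝ⟦X⟧ E ?_⟩
  rw [map_sum, map_zero, ← hp]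
  refine Finset.sum_congr rfl fun i _ => ?_
  rw [map_mul, Algebra.smul_def, IsScalarTower.algebraMap_apply ℝ[X] ℝ⟦X⟧ E]
  rfl

end BRule

end

/-! ### From differential equations to recurrences -/

noncomputable section
open Prog

open scoped Polynomial PowerSeries

/-- The coefficients of a polynomial, constant term first. -/
def Polynomial.coeffList' (p : ℝ[X]) : List ℝ := (List.range (p.natDegree + 1)).map p.coeff

theorem listEval_map_range (x : ℝ) (c : ℕ → ℝ) (n : ℕ) :
    listEval x ((List.range n).map c) = ∑ i ∈ Finset.range n, c i * x ^ i := by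
  induction n generalizing c with
  | zero => simp [listEval]
  | succ n ih =>
    rw [List.range_succ_eq_map, List.map_cons, List.map_map, Finset.sum_range_succ']
    have := ih (c ∘ Nat.succ)
    simp only [listEval, List.foldr_cons] at this ⊢
    rw [this, Finset.mul_sum, pow_zero, mul_one, add_comm]
    congr 1
    refine Finset.sum_congr rfl fun i _ => ?_
    simp only [Function.comp, Nat.succ_eq_add_one]
    ring

theorem listEval_coeffList' (x : ℝ) (p : ℝ[X]) : listEval x p.coeffList' = p.eval x := by
  rw [Polynomial.coeffList', listEval_map_range, Polynomial.eval_eq_sum_range]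

/-- The first terms of the sequence are computed by the recurrence. -/
def Recurrence.Generates (R : Recurrence) (a : ℕ → ℝ) : Prop :=
  ∀ l, ∃ n, Returns (R.fill l) ((List.range l).map a) n

theorem Recurrence.generates_of_forall (R : Recurrence) (a : ℕ → ℝ)
    (h0 : ∀ m < R.init.length, R.init.getD m 0 = a m)
    (h1 : ∀ m, R.init.length ≤ m → (List.zipWith (fun c a => listEval m c * a) R.coeffs
      ((List.range m).map a).reverse).sum / listEval m R.lead = a m) : R.Generates a := by
  intro l
  induction l with
  | zero => exact ⟨0, returns_pure _⟩
  | succ l ih =>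
    obtain ⟨n, h⟩ := ih
    obtain ⟨n', -, h'⟩ := R.returns_next l ((List.range l).map a)
    refine ⟨n + (n' + 0), ?_⟩
    rw [List.range_succ, List.map_append]
    have : (if l < R.init.length then R.init.getD l 0 else
        (List.zipWith (fun c a => listEval l c * a) R.coeffs
          ((List.range l).map a).reverse).sum / listEval l R.lead) = a l := by
      split_ifs with hl
      · exact h0 l hl
      · exact h1 l (not_lt.1 hl)
    rw [this] at h'
    exact h.bind (h'.bind (returns_pure _))

theorem sum_zipWith_reverse_range (a : ℕ → ℝ) (c : ℕ → List ℝ) (d m : ℕ) (hd : d ≤ m) :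
    (List.zipWith (fun c a => listEval m c * a) ((List.range d).map c)
      ((List.range m).map a).reverse).sum =
    ∑ s ∈ Finset.range d, listEval m (c s) * a (m - 1 - s) := by
  have : List.zipWith (fun c a => listEval m c * a) ((List.range d).map c)
      ((List.range m).map a).reverse =
      (List.range d).map fun s => listEval m (c s) * a (m - 1 - s) := by
    refine List.ext_getElem (by simp [hd]) fun i h1 h2 => ?_
    simp
  rw [this, ← List.sum_toFinset _ List.nodup_range, List.toFinset_range]

/-- A sequence that satisfies a nontrivial relation with polynomial coefficients is generated by a
recurrence. -/
theorem exists_recurrence_of_relation (a : ℕ → ℝ) (q : ℕ → ℝ[X]) (d : ℕ) (hq : ∃ i, q i ≠ 0)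
    (hd : ∀ i, d < i → q i = 0)
    (h : ∀ m, ∑ i ∈ Finset.range (m + 1), (q i).eval ((m - i : ℕ) : ℝ) * a (m - i) = 0) :
    ∃ R : Recurrence, R.Generates a := by
  classical
  -- The first nonzero polynomial supplies the leading coefficient. It has finitely many roots, so
  -- it does not vanish at integers from `M` on.
  set i₀ := Nat.find hq
  have hi₀ : q i₀ ≠ 0 := Nat.find_spec hq
  have hlt : ∀ i < i₀, q i = 0 := fun i hi => not_not.1 (Nat.find_min hq hi)
  obtain ⟨M, hM⟩ : ∃ M : ℕ, ∀ m : ℕ, M ≤ m → (q i₀).eval (m : ℝ) ≠ 0 := by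
    have hfin : {m : ℕ | (q i₀).eval (m : ℝ) = 0}.Finite :=
      (Polynomial.finite_setOfPred_isRoot hi₀).preimage Nat.cast_injective.injOn
    obtain ⟨M, hM⟩ := hfin.bddAbove
    exact ⟨M + 1, fun m hm h0 => by have := hM h0; omega⟩
  -- In the relation a term `a (m - 1 - s)` comes with a polynomial evaluated at its own index,
  -- while a recurrence evaluates all coefficients at `m`; the substitution X - (s + 1) makes up for
  -- this.
  set p : ℕ → ℝ[X] := fun s => -(q (i₀ + 1 + s)).comp (Polynomial.X - Polynomial.C ((s : ℝ) + 1))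
  let R : Recurrence :=
    -- Past `M` the division is possible, and past `d` all earlier terms that occur have nonnegative
    -- index.
    { init := (List.range (M + d)).map a
      lead := (q i₀).coeffList'
      coeffs := (List.range d).map fun s => (p s).coeffList'
      lead_ne := by
        intro m hm
        have := hM m (by simp at hm; omega)
        rwa [← listEval_coeffList'] at this }
  refine ⟨R, R.generates_of_forall a ?_ ?_⟩
  · intro m hm
    simp only [R, List.length_map, List.length_range] at hm ⊢
    simp [hm]
  · intro m hm
    simp only [R, List.length_map, List.length_range] at hm ⊢
    rw [sum_zipWith_reverse_range _ _ _ _ (by omega), listEval_coeffList',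
      div_eq_iff (hM m (by omega))]
    -- At this index the terms with i < i₀ vanish and the one with i = i₀ is the leading coefficient
    -- at `m` times `a m`.
    have hrel := h (m + i₀)
    rw [show m + i₀ + 1 = i₀ + (m + 1) by ring, Finset.sum_range_add,
      Finset.sum_eq_zero (fun i hi => by rw [hlt i (Finset.mem_range.1 hi)]; simp), zero_add,
      Finset.sum_range_succ'] at hrel
    have hsub : ∑ s ∈ Finset.range d, listEval m (p s).coeffList' * a (m - 1 - s) =
        ∑ s ∈ Finset.range m, -((q (i₀ + (s + 1))).eval ((m + i₀ - (i₀ + (s + 1)) : ℕ) : ℝ) *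
          a (m + i₀ - (i₀ + (s + 1)))) := by
      rw [← Finset.sum_subset (s₁ := Finset.range d) (s₂ := Finset.range m)]
      · refine Finset.sum_congr rfl fun s hs => ?_
        have hs' := Finset.mem_range.1 hs
        have e1 : m + i₀ - (i₀ + (s + 1)) = m - 1 - s := by omega
        have e2 : ((m - 1 - s : ℕ) : ℝ) = m - (s + 1) := by
          rw [show m - 1 - s = m - (s + 1) by omega, Nat.cast_sub (by omega)]
          push_cast
          ring
        rw [e1, listEval_coeffList', e2, show i₀ + (s + 1) = i₀ + 1 + s by ring]
        simp [p]
      · intro s hs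
        have := Finset.mem_range.1 hs
        exact Finset.mem_range.2 (by omega)
      · intro s hs hs'
        rw [Finset.mem_range, not_lt] at hs'
        rw [hd (i₀ + (s + 1)) (by omega)]
        simp
    rw [hsub, Finset.sum_neg_distrib]
    simp only [add_zero, Nat.add_sub_cancel] at hrel
    linarith

namespace BRule

variable {T I : Type} [Fintype I] {rule : I → BRule T I} {f : I → ℝ⟦X⟧} {e : I → ℝ[X]}

open Classical in
-- At X = 0 the rows of products vanish and those of unions refer to smaller heights. A vector fixed
-- by the Jacobian is thus zero, by induction on the height.
theorem constantCoeff_det_ne_zero (ht : I → ℕ)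
    (hU : ∀ A B C, rule A = union B C → ht B < ht A ∧ ht C < ht A)
    (hP : ∀ A B C, rule A = product B C → PowerSeries.constantCoeff (f B) = 0 ∧
      PowerSeries.constantCoeff (f C) = 0) :
    PowerSeries.constantCoeff (1 - jacobian rule f).det ≠ 0 := by
  rw [← det_one_sub_jacobian_map]
  intro h0
  obtain ⟨v, hv, h⟩ := Matrix.exists_mulVec_eq_zero_iff.2 h0
  apply hv
  rw [Matrix.sub_mulVec, Matrix.one_mulVec, sub_eq_zero] at h
  have : ∀ n A, ht A = n → v A = 0 := by
    intro n
    induction n using Nat.strong_induction_on with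
    | _ n ih =>
      intro A hA
      rw [h]
      simp only [Matrix.mulVec, dotProduct, jacobian]
      split
      · next B C hr => simp [hP A B C hr]
      · next B C hr =>
        have := hU A B C hr
        simp [add_mul, Finset.sum_add_distrib, ih _ (hA ▸ this.1) B rfl,
          ih _ (hA ▸ this.2) C rfl]
      · simp
  exact funext fun A => this _ A rfl

/-- The coefficients of the solutions of a proper binary polynomial system are generated by
recurrences with polynomial coefficients. -/
theorem Solves.exists_recurrence (h : Solves rule f fun A => (e A : ℝ⟦X⟧)) (ht : I → ℕ)
    (hU : ∀ A B C, rule A = union B C → ht B < ht A ∧ ht C < ht A)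
    (hP : ∀ A B C, rule A = product B C → PowerSeries.constantCoeff (f B) = 0 ∧
      PowerSeries.constantCoeff (f C) = 0) (A : I) :
    ∃ R : Recurrence, R.Generates fun m => PowerSeries.coeff m (f A) := by
  classical
  obtain ⟨s, p, ⟨j, hj, hpj⟩, hrel⟩ :=
    h.exists_euler_relation (constantCoeff_det_ne_zero ht hU hP) A
  -- The relation is regrouped by powers of X: `q i` collects, as a polynomial in the Euler
  -- operator, what stands with X^i. The coefficient of X^m then pairs `q i`, evaluated at m - i,
  -- with the coefficient of index m - i.
  set q : ℕ → ℝ[X] := fun i => ∑ j ∈ s, Polynomial.C ((p j).coeff i) * Polynomial.X ^ j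
  have hq : ∀ i, ∀ j ∈ s, (q i).coeff j = (p j).coeff i := by
    intro i j hj
    simp only [q, Polynomial.finsetSum_coeff, Polynomial.coeff_C_mul_X_pow]
    simp [hj]
  refine exists_recurrence_of_relation _ q (s.sup fun j => (p j).natDegree) ?_ ?_ ?_
  · refine ⟨(p j).natDegree, fun h0 => ?_⟩
    have := hq (p j).natDegree j hj
    rw [h0, Polynomial.coeff_zero] at this
    exact hpj (Polynomial.leadingCoeff_eq_zero.1 this.symm)
  · intro i hi
    refine Finset.sum_eq_zero fun j hj => ?_
    rw [Polynomial.coeff_eq_zero_of_natDegree_lt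
      (lt_of_le_of_lt (Finset.le_sup (f := fun j => (p j).natDegree) hj) hi)]
    simp
  · intro m
    have := congrArg (PowerSeries.coeff m) hrel
    rw [map_sum, map_zero] at this
    rw [← this]
    simp only [PowerSeries.coeff_mul, PowerSeries.coeff_euler_iterate,
      Finset.Nat.sum_antidiagonal_eq_sum_range_succ_mk, Polynomial.coeff_coe]
    rw [Finset.sum_comm]
    refine Finset.sum_congr rfl fun i _ => ?_
    simp only [q, Polynomial.eval_finsetSum, Finset.sum_mul]
    refine Finset.sum_congr rfl fun j _ => ?_
    simp only [Polynomial.eval_mul, Polynomial.eval_C, Polynomial.eval_pow, Polynomial.eval_X]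
    ring

end BRule

end

noncomputable section
open Prog

/-! ## Derivations of words and weights of languages -/

namespace BGrammar

variable {T N : Type} {G : BGrammar T N} {φ : Policy T N}

/-- The word `w` is derived from the immature word `ω`, consistently with the policy. -/
def Der (G : BGrammar T N) (φ : Policy T N) (ω : IWord T N) (w : List T) : Prop :=
  Relation.ReflTransGen (G.Step φ) ω (w.map ISym.ter)

/-- The immature word `ω` occurs in the derivations of words of length `n`. -/
def Reach (G : BGrammar T N) (φ : Policy T N) (n : ℕ) (ω : IWord T N) : Prop :=
  Relation.ReflTransGen (G.Step φ) [ISym.non G.start n] ω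

theorem Reach.step {n : ℕ} {ω ω' : IWord T N} (h : G.Reach φ n ω) (hs : G.Step φ ω ω') :
    G.Reach φ n ω' := Relation.ReflTransGen.tail h hs

theorem Der.head {ω ω' : IWord T N} {w : List T} (h : G.Der φ ω' w) (hs : G.Step φ ω ω') :
    G.Der φ ω w := Relation.ReflTransGen.head hs h

theorem der_of_pos_none {ω : IWord T N} (h : φ.pos ω = none) {w : List T} :
    G.Der φ ω w ↔ ω = w.map ISym.ter := by
  constructor
  · intro hd
    rcases Relation.ReflTransGen.cases_head hd with h' | ⟨c, hc, -⟩
    · exact h'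
    · exact absurd hc (not_step_of_pos_none h)
  · rintro rfl
    exact Relation.ReflTransGen.refl

theorem der_iff_exists_step {ω : IWord T N} (h : φ.pos ω ≠ none) {w : List T} :
    G.Der φ ω w ↔ ∃ c, G.Step φ ω c ∧ G.Der φ c w := by
  constructor
  · intro hd
    rcases Relation.ReflTransGen.cases_head hd with h' | h'
    · exact absurd (h' ▸ φ.pos_map_ter w) h
    · exact h'
  · rintro ⟨c, hc, hd⟩
    exact hd.head hc

/-- A sequence of atomic derivations from `ω` to the word `w`. -/
def IsPath (G : BGrammar T N) (φ : Policy T N) (ω : IWord T N) (w : List T)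
    (p : List (IWord T N)) : Prop :=
  p.head? = some ω ∧ p.IsChain (G.Step φ) ∧ p.getLast? = some (w.map ISym.ter)

theorem Der.exists_isPath {ω : IWord T N} {w : List T} (h : G.Der φ ω w) :
    ∃ p, G.IsPath φ ω w p := by
  obtain ⟨p, h1, h2⟩ := List.exists_isChain_cons_of_relationReflTransGen h
  exact ⟨ω :: p, rfl, h1, by rw [List.getLast?_eq_some_getLast (by simp), h2]⟩

theorem IsPath.cons {ω ω' : IWord T N} {w : List T} {p : List (IWord T N)}
    (h : G.IsPath φ ω' w p) (hs : G.Step φ ω ω') : G.IsPath φ ω w (ω :: p) := by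
  obtain ⟨h1, h2, h3⟩ := h
  obtain ⟨p, rfl⟩ := List.head?_eq_some_iff.1 h1
  exact ⟨rfl, List.isChain_cons_cons.2 ⟨hs, h2⟩, by rwa [List.getLast?_cons_cons]⟩

theorem isPath_singleton (w : List T) : G.IsPath φ (w.map ISym.ter) w [w.map ISym.ter] :=
  ⟨rfl, List.isChain_singleton _, rfl⟩

theorem IsPath.der {ω : IWord T N} {w : List T} {p : List (IWord T N)} (h : G.IsPath φ ω w p) :
    G.Der φ ω w := by
  obtain ⟨h1, h2, h3⟩ := h
  obtain ⟨p, rfl⟩ := List.head?_eq_some_iff.1 h1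
  rw [List.getLast?_eq_some_getLast (by simp), Option.some.injEq] at h3
  exact List.relationReflTransGen_of_exists_isChain_cons p h2 h3

theorem IsPath.mem {ω : IWord T N} {w : List T} {p : List (IWord T N)} (h : G.IsPath φ ω w p)
    {v : IWord T N} (hv : v ∈ p) : Relation.ReflTransGen (G.Step φ) ω v ∧ G.Der φ v w := by
  induction p generalizing ω with
  | nil => simp at hv
  | cons u p ih =>
    obtain ⟨h1, h2, h3⟩ := h
    simp only [List.head?_cons, Option.some.injEq] at h1
    subst h1
    have hd : G.Der φ u w := IsPath.der (p := u :: p) ⟨rfl, h2, h3⟩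
    rcases List.mem_cons.1 hv with rfl | hv
    · exact ⟨.refl, hd⟩
    · cases p with
      | nil => simp at hv
      | cons u' p =>
        obtain ⟨hs, h2⟩ := List.isChain_cons_cons.1 h2
        obtain ⟨h4, h5⟩ := ih ⟨rfl, h2, by rwa [List.getLast?_cons_cons] at h3⟩ hv
        exact ⟨.head hs h4, h5⟩

section

variable [Fintype N]

theorem IsBCNF.mem_langLen (hG : G.IsBCNF) {A : N} {m : ℕ} {w : List T} :
    w ∈ G.langLen A m ↔ ∃ τ : PTree T N, τ.Valid G ∧ τ.root = ISym.non A m ∧ τ.yield = w := by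
  simp only [langLen, Set.mem_ofPred_eq, hG.mem_lang_iff]
  constructor
  · rintro ⟨⟨τ, h1, h2, h3⟩, rfl⟩
    exact ⟨τ, h1, h2, h3⟩
  · rintro ⟨τ, h1, h2, rfl⟩
    have := PTree.length_of_root h2
    exact ⟨⟨τ, h1, by rw [this, h2], rfl⟩, this⟩

theorem words_eq (n : ℕ) : G.words n = G.langLen G.start n := rfl

/-- A word of the language has a parse tree, which any policy unfolds; so deriving only at the
places the policy points to loses nothing. -/
theorem IsBCNF.mem_words_iff_der (hG : G.IsBCNF) (φ : Policy T N) {n : ℕ} {w : List T} :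
    w ∈ G.words n ↔ G.Der φ [ISym.non G.start n] w := by
  rw [words_eq, hG.mem_langLen]
  constructor
  · rintro ⟨τ, hτ, hr, rfl⟩
    obtain ⟨p, hp⟩ := PTree.exists_run φ [τ]
    obtain ⟨h1, h2⟩ := hp.isChain (G := G) (by simpa using hτ)
    obtain ⟨q, rfl⟩ := hp.exists_cons
    exact IsPath.der (p := [τ].map PTree.root :: q) ⟨by simp [hr], h1, by simpa using h2⟩
  · intro h
    obtain ⟨p, h1, h2, h3⟩ := h.exists_isPath
    obtain ⟨p, rfl⟩ := List.head?_eq_some_iff.1 h1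
    obtain ⟨F, hF, hr, hy, -⟩ := PTree.exists_run_of_isChain h2 h3
    match F with
    | [τ] => exact ⟨τ, by simpa using hF, by simpa using hr, by simpa using hy⟩
    | [] | _ :: _ :: _ => simp at hr

/-- Two different immature words derived in one step have no word in common. -/
theorem child_unique (hG : G.IsBCNF) (hU : G.TreeUnique G.start) {n : ℕ} {ω c c' : IWord T N}
    {w : List T} (hr : G.Reach φ n ω) (hs : G.Step φ ω c) (hs' : G.Step φ ω c')
    (hd : G.Der φ c w) (hd' : G.Der φ c' w) : c = c' := by
  have hw : w ∈ G.words n := (hG.mem_words_iff_der φ).2 (hr.trans (hd.head hs))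
  obtain rfl : w.length = n := hw.2
  -- One fixed path from the root to `ω`, continued through either child, gives two walks of `w`.
  -- They coincide, and cancelling the common beginning leaves equal children.
  have key : ∃ p, ∀ c, G.Step φ ω c → ∀ q, G.IsPath φ c w q → G.IsWalk φ w (p ++ q) := by
    clear hs hs' hd hd'
    unfold IsWalk Reach at *
    generalize [ISym.non G.start w.length] = ω₀ at *
    induction hr using Relation.ReflTransGen.head_induction_on with
    | refl => exact ⟨[ω], fun c hc q hq => hq.cons hc⟩
    | head h _ ih =>
      obtain ⟨p, ih⟩ := ih
      exact ⟨_ :: p, fun c hc q hq => IsPath.cons (ih c hc q hq) h⟩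
  obtain ⟨p, hp⟩ := key
  obtain ⟨q, hq⟩ := hd.exists_isPath
  obtain ⟨q', hq'⟩ := hd'.exists_isPath
  have := List.append_cancel_left (hU.walk_unique (hp c hs q hq) (hp c' hs' q' hq'))
  subst this
  exact Option.some.inj (hq.1.symm.trans hq'.1)

/-! ### Finiteness -/

omit [Fintype N] in
-- The alphabet may be infinite; only the finitely many letters of terminal rules occur in words,
-- which makes the languages of fixed length finite.
theorem _root_.PTree.Valid.terminal_of_mem {τ : PTree T N} (h : τ.Valid G) {A : N} {m : ℕ}
    (hr : τ.root = ISym.non A m) {t : T} (ht : t ∈ τ.yield) : ∃ B, G.rule B = BRule.terminal t := by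
  induction τ generalizing A m with
  | leaf t => simp [PTree.root] at hr
  | nil A => simp [PTree.yield] at ht
  | un B c ih =>
    have hx := h.1
    simp only [Expands] at hx
    split at hx
    · simp at hx
    · rcases hx with hx | hx
      · exact ih h.2 (List.singleton_injective hx) ht
      · exact ih h.2 (List.singleton_injective hx) ht
    · next t' hB =>
      rw [PTree.root_eq_ter (List.singleton_injective hx.2)] at ht
      simp only [PTree.yield, List.mem_singleton] at ht
      exact ⟨B, ht ▸ hB⟩
    · simp at hx
  | bin B l r ihl ihr =>
    obtain ⟨hx, hl, hr⟩ := h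
    simp only [Expands] at hx
    split at hx
    · obtain ⟨i, -, -, hx⟩ := hx
      simp only [List.cons.injEq, and_true] at hx
      rcases List.mem_append.1 ht with ht | ht
      · exact ihl hl hx.1 ht
      · exact ihr hr hx.2 ht
    all_goals simp at hx

theorem IsBCNF.finite_langLen (hG : G.IsBCNF) (A : N) (m : ℕ) : (G.langLen A m).Finite := by
  set S : Set T := {t | ∃ B, G.rule B = BRule.terminal t}
  have hS : S.Finite := by
    refine (Set.finite_range fun B : N => match G.rule B with
      | BRule.terminal t => some t
      | _ => none).preimage (Option.some_injective T).injOn |>.subset ?_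
    rintro t ⟨B, hB⟩
    exact ⟨B, by simp [hB]⟩
  have : Finite S := hS
  refine ((List.finite_length_eq S m).image (List.map Subtype.val)).subset ?_
  intro w hw
  obtain ⟨τ, hτ, hr, rfl⟩ := hG.mem_langLen.1 hw
  have hlen := PTree.length_of_root hr
  refine ⟨τ.yield.pmap Subtype.mk fun t ht => hτ.terminal_of_mem hr ht, ?_, ?_⟩
  · simpa using hlen
  · simp [List.map_pmap]

/-! ### Weights -/

variable (wt : T → ℝ)

omit [Fintype N] in
theorem _root_.wordWeight_append (u v : List T) :
    wordWeight wt (u ++ v) = wordWeight wt u * wordWeight wt v := by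
  simp [wordWeight]

omit [Fintype N] in
theorem _root_.langWeight_eq_sum {L : Set (List T)} (h : L.Finite) :
    langWeight wt L = ∑ w ∈ h.toFinset, wordWeight wt w :=
  finsum_mem_eq_finite_toFinset_sum _ h

theorem langWeight_langLen_zero {A : N} (h : [] ∉ G.lang A) :
    langWeight wt (G.langLen A 0) = 0 := by
  have : G.langLen A 0 = ∅ := by
    ext w
    simp only [langLen, Set.mem_ofPred_eq, List.length_eq_zero_iff, Set.mem_empty_iff_false,
      iff_false]
    rintro ⟨hw, rfl⟩
    exact h hw
  rw [this]
  simp [langWeight]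

/-- A word in both operands would have two trees for `A`, and they differ because the operands do.
-/
theorem IsBCNF.langWeight_union (hG : G.IsBCNF) {A B C : N} (hU : G.TreeUnique A)
    (hA : G.rule A = BRule.union B C) (m : ℕ) :
    langWeight wt (G.langLen A m) =
      langWeight wt (G.langLen B m) + langWeight wt (G.langLen C m) := by
  have hne := hG.union_ne A B C hA
  have hv : ∀ {D : N} {τ : PTree T N}, D = B ∨ D = C → τ.Valid G → τ.root = ISym.non D m →
      (PTree.un A τ).Valid G ∧ (PTree.un A τ).root = ISym.non A m := by
    intro D τ hD hτ hr
    have e := PTree.length_of_root hr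
    refine ⟨⟨?_, hτ⟩, by simp [PTree.root, e]⟩
    simp only [Expands, hA, hr, e]
    rcases hD with rfl | rfl <;> simp
  have hset : G.langLen A m = G.langLen B m ∪ G.langLen C m := by
    ext w
    simp only [Set.mem_union, hG.mem_langLen]
    constructor
    · rintro ⟨τ, hτ, hr, rfl⟩
      have hx := hτ.expands hr
      have hy := PTree.yield_eq_flatMap hr
      have hc := hτ.children
      revert hx hy hc
      simp only [Expands, hA]
      generalize τ.children = L
      intro hx hy hc
      match L with
      | [c] =>
        rcases hx with hx | hx
        · exact Or.inl ⟨c, hc c (by simp), by simpa using hx, by simpa using hy.symm⟩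
        · exact Or.inr ⟨c, hc c (by simp), by simpa using hx, by simpa using hy.symm⟩
      | [] | _ :: _ :: _ => simp at hx
    · rintro (⟨τ, hτ, hr, rfl⟩ | ⟨τ, hτ, hr, rfl⟩)
      · exact ⟨_, (hv (Or.inl rfl) hτ hr).1, (hv (Or.inl rfl) hτ hr).2, rfl⟩
      · exact ⟨_, (hv (Or.inr rfl) hτ hr).1, (hv (Or.inr rfl) hτ hr).2, rfl⟩
  rw [hset]
  refine finsum_mem_union ?_ (hG.finite_langLen B m) (hG.finite_langLen C m)
  rw [Set.disjoint_left]
  intro w hB hC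
  obtain ⟨τ, hτ, hr, rfl⟩ := hG.mem_langLen.1 hB
  obtain ⟨τ', hτ', hr', hy⟩ := hG.mem_langLen.1 hC
  have h1 := hv (Or.inl rfl) hτ hr
  have h2 := hv (Or.inr rfl) hτ' hr'
  have := hU _ _ m h1.1 h2.1 h1.2 h2.2 (by simp [PTree.yield, hy])
  rw [(PTree.un.inj this).2, hr'] at hr
  exact hne (ISym.non.inj hr).1.symm

/-- Concatenation is a bijection from the pairs of factors onto the words of length `m`; if two
pairs had the same concatenation, there would be two trees with the same yield. -/
theorem IsBCNF.langWeight_product (hG : G.IsBCNF) {A B C : N} (hU : G.TreeUnique A)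
    (hA : G.rule A = BRule.product B C) (m : ℕ) :
    langWeight wt (G.langLen A m) = ∑ ij ∈ Finset.HasAntidiagonal.antidiagonal m,
      langWeight wt (G.langLen B ij.1) * langWeight wt (G.langLen C ij.2) := by
  classical
  simp only [langWeight_eq_sum wt (hG.finite_langLen _ _), Finset.sum_mul_sum,
    ← Finset.sum_product']
  rw [Finset.sum_sigma']
  symm
  refine Finset.sum_nbij (fun x => x.2.1 ++ x.2.2) ?_ ?_ ?_ ?_
  · rintro ⟨⟨i, j⟩, u, v⟩ h
    simp only [Finset.mem_sigma, Finset.HasAntidiagonal.mem_antidiagonal, Finset.mem_product,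
      Set.Finite.mem_toFinset, hG.mem_langLen] at h ⊢
    obtain ⟨rfl, ⟨l, hl, hlr, rfl⟩, ⟨r, hr, hrr, rfl⟩⟩ := h
    exact ⟨.bin A l r, hG.expands_product hA hl hr hlr hrr,
      by simp [PTree.root, PTree.length_of_root hlr, PTree.length_of_root hrr], rfl⟩
  · rintro ⟨⟨i, j⟩, u, v⟩ h ⟨⟨i', j'⟩, u', v'⟩ h' heq
    simp only [Finset.mem_coe, Finset.mem_sigma, Finset.HasAntidiagonal.mem_antidiagonal, Finset.mem_product,
      Set.Finite.mem_toFinset, hG.mem_langLen] at h h' heq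
    obtain ⟨rfl, ⟨l, hl, hlr, rfl⟩, ⟨r, hr, hrr, rfl⟩⟩ := h
    obtain ⟨h0, ⟨l', hl', hlr', rfl⟩, ⟨r', hr', hrr', rfl⟩⟩ := h'
    have := hU (.bin A l r) (.bin A l' r') (i + j) (hG.expands_product hA hl hr hlr hrr)
      (hG.expands_product hA hl' hr' hlr' hrr')
      (by simp [PTree.root, PTree.length_of_root hlr, PTree.length_of_root hrr])
      (by simp [PTree.root, PTree.length_of_root hlr', PTree.length_of_root hrr', h0]) heq
    obtain ⟨-, rfl, rfl⟩ := PTree.bin.inj this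
    rw [hlr] at hlr'
    rw [hrr] at hrr'
    rw [(ISym.non.inj hlr').2, (ISym.non.inj hrr').2]
  · intro w hw
    simp only [Finset.mem_coe, Set.Finite.mem_toFinset, hG.mem_langLen] at hw
    obtain ⟨τ, hτ, hr, rfl⟩ := hw
    have hx := hτ.expands hr
    have hy := PTree.yield_eq_flatMap hr
    have hc := hτ.children
    revert hx hy hc
    simp only [Expands, hA]
    generalize τ.children = L
    rintro ⟨i, h1, h2, hx⟩ hy hc
    match L with
    | [l, r] =>
      simp only [List.map_cons, List.map_nil, List.cons.injEq, and_true] at hx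
      refine ⟨⟨(i, m - i), l.yield, r.yield⟩, ?_, by simpa using hy.symm⟩
      simp only [Finset.mem_coe, Finset.mem_sigma, Finset.HasAntidiagonal.mem_antidiagonal, Finset.mem_product,
        Set.Finite.mem_toFinset, hG.mem_langLen]
      exact ⟨by omega, ⟨l, hc l (by simp), hx.1, rfl⟩, ⟨r, hc r (by simp), hx.2, rfl⟩⟩
    | [] | [_] | _ :: _ :: _ :: _ => simp at hx
  · rintro ⟨⟨i, j⟩, u, v⟩ -
    exact (wordWeight_append wt u v).symm

theorem IsBCNF.langLen_terminal (hG : G.IsBCNF) {A : N} {t : T}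
    (hA : G.rule A = BRule.terminal t) (m : ℕ) :
    G.langLen A m = if m = 1 then {[t]} else ∅ := by
  ext w
  rw [hG.mem_langLen]
  constructor
  · rintro ⟨τ, hτ, hr, rfl⟩
    have hx := hτ.expands hr
    have hy := PTree.yield_eq_flatMap hr
    revert hx hy
    simp only [Expands, hA]
    generalize τ.children = L
    rintro ⟨rfl, hx⟩ hy
    match L with
    | [c] => simpa [PTree.root_eq_ter (List.singleton_injective hx), PTree.yield] using hy
    | [] | _ :: _ :: _ => simp at hx
  · split_ifs with hm
    · rintro rfl
      exact ⟨.un A (.leaf t), ⟨by simp [Expands, hA, PTree.yield, PTree.root], trivial⟩,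
        by simp [PTree.root, PTree.yield, hm], rfl⟩
    · simp

theorem IsBCNF.langLen_epsilon (hG : G.IsBCNF) {A : N}
    (hA : G.rule A = BRule.epsilon) (m : ℕ) :
    G.langLen A m = if m = 0 then {[]} else ∅ := by
  ext w
  rw [hG.mem_langLen]
  constructor
  · rintro ⟨τ, hτ, hr, rfl⟩
    have hx := hτ.expands hr
    have hy := PTree.yield_eq_flatMap hr
    revert hx hy
    simp only [Expands, hA]
    generalize τ.children = L
    rintro ⟨rfl, hx⟩ hy
    match L with
    | [] => simpa using hy
    | _ :: _ => simp at hx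
  · split_ifs with hm
    · rintro rfl
      exact ⟨.nil A, by simp [PTree.Valid, Expands, hA], by simp [PTree.root, hm], rfl⟩
    · simp

open Classical in
open scoped Polynomial PowerSeries in
/-- The weights of the languages of an unambiguous grammar are computed by recurrences. -/
theorem IsBCNF.exists_computes (hG : G.IsBCNF) (hU : G.TreeUnique G.start) :
    ∃ R : N → Recurrence, G.Computes wt R := by
  -- Unambiguity says nothing about nonterminals that are not reachable, whose unions may even be
  -- cyclic. They are replaced by epsilon rules, with generating function 1.
  set rule : N → BRule T N := fun A => if G.Reaches G.start A then G.rule A else BRule.epsilon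
  set f : N → ℝ⟦X⟧ := fun A => if G.Reaches G.start A then
    PowerSeries.mk fun m => langWeight wt (G.langLen A m) else 1
  set e : N → ℝ[X] := fun A => match rule A with
    | BRule.terminal t => Polynomial.C (wt t) * Polynomial.X
    | _ => 1
  have hdep : ∀ {A B}, G.Reaches G.start A → G.Dep A B → G.Reaches G.start B :=
    fun h hd => Relation.ReflTransGen.tail h hd
  have hsolves : BRule.Solves rule f (fun A => (e A : ℝ⟦X⟧)) := by
    intro A
    by_cases hA : G.Reaches G.start A
    · have hUA := hU.reaches hG hA
      have hr : rule A = G.rule A := if_pos hA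
      simp only [e, hr]
      rcases hAr : G.rule A with ⟨B, C⟩ | ⟨B, C⟩ | t | _
      · have hB := hdep hA (show G.Dep A B by simp [Dep, hAr, BRule.operands])
        have hC := hdep hA (show G.Dep A C by simp [Dep, hAr, BRule.operands])
        ext m
        simp [f, hA, hB, hC, PowerSeries.coeff_mul, hG.langWeight_product wt hUA hAr]
      · have hB := hdep hA (show G.Dep A B by simp [Dep, hAr, BRule.operands])
        have hC := hdep hA (show G.Dep A C by simp [Dep, hAr, BRule.operands])
        ext m
        simp [f, hA, hB, hC, hG.langWeight_union wt hUA hAr]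
      · ext m
        simp only [f, hA, if_true, PowerSeries.coeff_mk, hG.langLen_terminal hAr,
          Polynomial.coeff_coe, Polynomial.coeff_C_mul_X]
        split_ifs <;> simp [langWeight, wordWeight]
      · ext m
        simp only [f, hA, if_true, PowerSeries.coeff_mk, hG.langLen_epsilon hAr,
          Polynomial.coeff_coe, Polynomial.coeff_one]
        split_ifs with hm
        · rw [langWeight, finsum_mem_singleton]
          simp [wordWeight]
        · simp [langWeight]
    · simp [rule, f, e, hA]
  have hR := hsolves.exists_recurrence (ht := G.height) ?_ ?_
  · choose R hR using hR
    refine ⟨R, fun A hA l => ?_⟩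
    obtain ⟨n, hn⟩ := hR A l
    rw [hn.allRuns]
    simp [f, hA]
  · intro A B C h
    by_cases hA : G.Reaches G.start A
    · simp only [rule, hA, if_true] at h
      have hUA := hU.reaches hG hA
      exact ⟨hUA.height_lt hG ⟨C, Or.inl h⟩, hUA.height_lt hG ⟨B, Or.inr h⟩⟩
    · simp [rule, hA] at h
  · intro A B C h
    by_cases hA : G.Reaches G.start A
    · simp only [rule, hA, if_true] at h
      have hp := hG.product_pos A B C h
      have key : ∀ D, G.Reaches G.start D → [] ∉ G.lang D → PowerSeries.constantCoeff (f D) = 0 := by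
        intro D hD h0
        rw [← PowerSeries.coeff_zero_eq_constantCoeff_apply]
        simp [f, hD, langWeight_langLen_zero wt h0]
      exact ⟨key B (hdep hA (by simp [Dep, h, BRule.operands])) hp.1,
        key C (hdep hA (by simp [Dep, h, BRule.operands])) hp.2⟩
    · simp [rule, hA] at h

end

end BGrammar

end

noncomputable section
open Prog

/-! ## Measures and weights of immature words -/

theorem mem_boustrophedon {m i : ℕ} : i ∈ boustrophedon m ↔ 1 ≤ i ∧ i < m := by
  simp only [boustrophedon, List.mem_map, List.mem_range]
  constructor
  · rintro ⟨j, hj, rfl⟩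
    split_ifs <;> omega
  · rintro ⟨h1, h2⟩
    by_cases h : 2 * i ≤ m
    · exact ⟨2 * (i - 1), by omega, by rw [if_pos (by omega)]; omega⟩
    · exact ⟨2 * (m - i - 1) + 1, by omega, by rw [if_neg (by omega)]; omega⟩

theorem nodup_boustrophedon (m : ℕ) : (boustrophedon m).Nodup := by
  refine (List.nodup_map_iff_inj_on List.nodup_range).2 fun j hj j' hj' h => ?_
  rw [List.mem_range] at hj hj'
  split_ifs at h <;> omega

theorem length_boustrophedon (m : ℕ) : (boustrophedon m).length = m - 1 := by
  simp [boustrophedon]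

/-- The j-th entry is found after j + 1 trials. Searching from both ends makes this at most twice
the smaller part, which is the source of the logarithm in the operation count. -/
theorem boustrophedon_index {m j : ℕ} (hj : j < (boustrophedon m).length) :
    j + 1 ≤ 2 * min (boustrophedon m)[j] (m - (boustrophedon m)[j]) := by
  have : j < m - 1 := by rwa [length_boustrophedon] at hj
  simp only [boustrophedon, List.getElem_map, List.getElem_range]
  split_ifs <;> omega

namespace BGrammar

variable {T N : Type} {G : BGrammar T N} {φ : Policy T N}

/-- The right-hand sides of the atomic derivations of the nonterminal `A` with positive length `m`,
in the order of the algorithm. -/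
def childList (G : BGrammar T N) (A : N) (m : ℕ) : List (IWord T N) :=
  match G.rule A with
  | BRule.product B C => (boustrophedon m).map fun i => [ISym.non B i, ISym.non C (m - i)]
  | BRule.union B C => [[ISym.non B m], [ISym.non C m]]
  | BRule.terminal t => if m = 1 then [[ISym.ter t]] else []
  | BRule.epsilon => []

theorem mem_childList {A : N} {m : ℕ} (hm : 0 < m) {x : IWord T N} :
    x ∈ G.childList A m ↔ G.Expands A m x := by
  rcases hA : G.rule A with ⟨B, C⟩ | ⟨B, C⟩ | t | _ <;> simp only [childList, Expands, hA]
  · simp only [List.mem_map, mem_boustrophedon]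
    constructor
    · rintro ⟨i, ⟨h1, h2⟩, rfl⟩; exact ⟨i, h1, h2, rfl⟩
    · rintro ⟨i, h1, h2, rfl⟩; exact ⟨i, ⟨h1, h2⟩, rfl⟩
  · simp
  · split_ifs with h <;> simp [h]
  · simp [hm.ne']

/-- All nonterminals are in use and have positive lengths up to `n`. -/
def Good (G : BGrammar T N) (n : ℕ) (ω : IWord T N) : Prop :=
  ∀ A m, ISym.non A m ∈ ω → G.Reaches G.start A ∧ 0 < m ∧ m ≤ n

theorem Expands.good {A : N} {m n : ℕ} {x : IWord T N} (h : G.Expands A m x)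
    (hA : G.Reaches G.start A) (hm : 0 < m) (hn : m ≤ n) : G.Good n x := by
  have hd : ∀ B, G.Dep A B → G.Reaches G.start B := fun B hB => Relation.ReflTransGen.tail hA hB
  simp only [Dep] at hd
  simp only [Expands] at h
  intro D l hD
  split at h
  · next B C hr =>
    obtain ⟨i, h1, h2, rfl⟩ := h
    simp only [hr, BRule.operands] at hd
    simp only [List.mem_cons, ISym.non.injEq, List.not_mem_nil, or_false] at hD
    rcases hD with ⟨rfl, rfl⟩ | ⟨rfl, rfl⟩
    · exact ⟨hd _ (by simp), by omega, by omega⟩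
    · exact ⟨hd _ (by simp), by omega, by omega⟩
  · next B C hr =>
    simp only [hr, BRule.operands] at hd
    rcases h with rfl | rfl
    · obtain ⟨rfl, rfl⟩ := ISym.non.inj (List.mem_singleton.1 hD)
      exact ⟨hd _ (by simp), hm, hn⟩
    · obtain ⟨rfl, rfl⟩ := ISym.non.inj (List.mem_singleton.1 hD)
      exact ⟨hd _ (by simp), hm, hn⟩
  · obtain ⟨rfl, rfl⟩ := h
    simp at hD
  · omega

theorem Good.step {n : ℕ} {ω ω' : IWord T N} (h : G.Good n ω) (hs : G.Step φ ω ω') :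
    G.Good n ω' := by
  obtain ⟨ω₁, A, m, ω₂, x, rfl, -, hx, rfl⟩ := step_iff.1 hs
  obtain ⟨h1, h2, h3⟩ := h A m (by simp)
  intro B l hB
  simp only [List.mem_append] at hB
  rcases hB with (hB | hB) | hB
  · exact h B l (by simp [hB])
  · exact hx.good h1 h2 h3 B l hB
  · exact h B l (by simp [hB])

theorem Reach.good {n : ℕ} (hn : 0 < n) {ω : IWord T N} (h : G.Reach φ n ω) : G.Good n ω := by
  induction h with
  | refl =>
    intro A m h
    obtain ⟨rfl, rfl⟩ := ISym.non.inj (List.mem_singleton.1 h)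
    exact ⟨.refl, hn, le_rfl⟩
  | tail _ hs ih => exact ih.step hs

/-- The immature words one step below `ω₁ A_m ω₂`. -/
theorem step_split_iff {ω₁ ω₂ ω' : IWord T N} {A : N} {m : ℕ}
    (hp : φ.pos (ω₁ ++ ISym.non A m :: ω₂) = some ω₁.length) (hm : 0 < m) :
    G.Step φ (ω₁ ++ ISym.non A m :: ω₂) ω' ↔ ∃ x ∈ G.childList A m, ω' = ω₁ ++ x ++ ω₂ := by
  simp only [step_iff, mem_childList hm]
  constructor
  · rintro ⟨ω₁', A', m', ω₂', x, h, hp', hx, rfl⟩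
    rw [hp] at hp'
    obtain ⟨rfl, h2⟩ := List.append_inj h (Option.some.inj hp')
    simp only [List.cons.injEq, ISym.non.injEq] at h2
    obtain ⟨⟨rfl, rfl⟩, rfl⟩ := h2
    exact ⟨x, hx, rfl⟩
  · rintro ⟨x, hx, rfl⟩
    exact ⟨_, _, _, _, x, rfl, hp, hx, rfl⟩

section

variable [Fintype N]

/-- A bound for the number of atomic derivations from a symbol. -/
def symMeasure (G : BGrammar T N) : ISym T N → ℕ
  | ISym.ter _ => 0
  | ISym.non A m => (2 * m - 2) * Fintype.card N + G.height A + 1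

/-- A bound for the number of atomic derivations from an immature word. -/
def wordMeasure (G : BGrammar T N) (ω : IWord T N) : ℕ := (ω.map G.symMeasure).sum

/-- A bound for the number of operations from a symbol. -/
def symPot (G : BGrammar T N) : ISym T N → ℝ
  | ISym.ter _ => 0
  | ISym.non A m => 12 * G.symMeasure (ISym.non A m) + 14 / Real.log 2 * (m * Real.log m)

/-- A bound for the number of operations from an immature word. -/
def wordPot (G : BGrammar T N) (ω : IWord T N) : ℝ := (ω.map G.symPot).sum

/-- The two parts together have 2|N| less in the terms (2m - 2)|N|. This covers their two heights,
each at most |N| - 1, their two summands 1 and the step itself. -/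
theorem wordMeasure_product (hG : G.IsBCNF) (hU : G.TreeUnique G.start) {A B C : N} {m i : ℕ}
    (hA : G.Reaches G.start A) (h : G.rule A = BRule.product B C) (h1 : 1 ≤ i) (h2 : i < m) :
    G.symMeasure (ISym.non B i) + G.symMeasure (ISym.non C (m - i)) + 1 ≤
      G.symMeasure (ISym.non A m) := by
  have hB : G.Dep A B := by simp [Dep, h, BRule.operands]
  have hC : G.Dep A C := by simp [Dep, h, BRule.operands]
  have hB' := ((hU.reaches hG hA).dep hG hB).height_lt_card hG
  have hC' := ((hU.reaches hG hA).dep hG hC).height_lt_card hG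
  simp only [symMeasure]
  obtain ⟨i, rfl⟩ := Nat.exists_eq_add_of_le h1
  obtain ⟨l, rfl⟩ := Nat.exists_eq_add_of_lt h2
  rw [show 2 * (1 + i) - 2 = 2 * i by omega, show 2 * (1 + i + l + 1 - (1 + i)) - 2 = 2 * l by omega,
    show 2 * (1 + i + l + 1) - 2 = 2 * i + 2 * l + 2 by omega, add_mul, add_mul]
  omega

theorem wordMeasure_expands (hG : G.IsBCNF) (hU : G.TreeUnique G.start) {A : N} {m : ℕ}
    {x : IWord T N} (hA : G.Reaches G.start A) (hm : 0 < m) (h : G.Expands A m x) :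
    G.wordMeasure x + 1 ≤ G.symMeasure (ISym.non A m) := by
  have hUA := hU.reaches hG hA
  simp only [Expands] at h
  split at h
  · next B C hr =>
    obtain ⟨i, h1, h2, rfl⟩ := h
    have := wordMeasure_product hG hU hA hr h1 h2
    simpa [wordMeasure] using this
  · next B C hr =>
    rcases h with rfl | rfl
    · have := hUA.height_lt hG ⟨C, Or.inl hr⟩
      simp [wordMeasure, symMeasure]; omega
    · have := hUA.height_lt hG ⟨B, Or.inr hr⟩
      simp [wordMeasure, symMeasure]; omega
  · obtain ⟨rfl, rfl⟩ := h
    simp [wordMeasure, symMeasure]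
  · omega

theorem wordMeasure_step (hG : G.IsBCNF) (hU : G.TreeUnique G.start) {n : ℕ} {ω ω' : IWord T N}
    (h : G.Good n ω) (hs : G.Step φ ω ω') : G.wordMeasure ω' < G.wordMeasure ω := by
  obtain ⟨ω₁, A, m, ω₂, x, rfl, -, hx, rfl⟩ := step_iff.1 hs
  obtain ⟨h1, h2, -⟩ := h A m (by simp)
  have := wordMeasure_expands hG hU h1 h2 hx
  simp only [wordMeasure, List.map_append, List.sum_append, List.map_cons, List.sum_cons] at *
  omega

omit [Fintype N] in
-- The whole is at least twice the smaller part, so each unit of the smaller part gains log 2, and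
-- no unit of the larger part loses.
theorem mul_log_split {i m : ℕ} (h1 : 1 ≤ i) (h2 : i < m) :
    (min i (m - i) : ℕ) * Real.log 2 + i * Real.log i + (m - i : ℕ) * Real.log (m - i : ℕ) ≤
      m * Real.log m := by
  have key : ∀ a b : ℕ, 1 ≤ a → a ≤ b →
      a * Real.log 2 + a * Real.log a + b * Real.log b ≤ (a + b : ℕ) * Real.log (a + b : ℕ) := by
    intro a b ha hab
    have ha' : (0 : ℝ) < a := by exact_mod_cast ha
    have hb' : (0 : ℝ) < b := ha'.trans_le (by exact_mod_cast hab)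
    have e1 : Real.log 2 + Real.log a ≤ Real.log (a + b : ℕ) := by
      rw [← Real.log_mul (by norm_num) ha'.ne']
      refine Real.log_le_log (by positivity) ?_
      have : (a : ℝ) ≤ b := by exact_mod_cast hab
      push_cast
      linarith
    have e2 : Real.log b ≤ Real.log (a + b : ℕ) := by
      refine Real.log_le_log hb' ?_
      push_cast
      linarith
    calc _ = a * (Real.log 2 + Real.log a) + b * Real.log b := by ring
      _ ≤ a * Real.log (a + b : ℕ) + b * Real.log (a + b : ℕ) := by gcongr
      _ = _ := by push_cast; ring
  rcases le_total i (m - i) with h | h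
  · rw [min_eq_left h]
    have := key i (m - i) h1 h
    rwa [Nat.add_sub_cancel' h2.le] at this
  · rw [min_eq_right h]
    have := key (m - i) i (by omega) h
    rw [Nat.sub_add_cancel h2.le] at this
    linarith

theorem symPot_nonneg (s : ISym T N) : 0 ≤ G.symPot s := by
  cases s with
  | ter t => exact le_rfl
  | non A m =>
    have h1 := Real.log_pos one_lt_two
    have h2 : 0 ≤ Real.log m := Real.log_natCast_nonneg m
    simp only [symPot]
    positivity

theorem wordPot_nonneg (ω : IWord T N) : 0 ≤ G.wordPot ω := by
  refine List.sum_nonneg ?_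
  simp only [List.mem_map]
  rintro _ ⟨s, -, rfl⟩
  exact symPot_nonneg s

/-- A trial costs 7 operations and there are at most 2 min(i, m - i) of them, whence the 14. The 12
comes from the drop of the step bound; a product needs only 4 of these for the operations before the
first trial. -/
theorem wordPot_product (hG : G.IsBCNF) (hU : G.TreeUnique G.start) {A B C : N} {m i : ℕ}
    (hA : G.Reaches G.start A) (h : G.rule A = BRule.product B C) (h1 : 1 ≤ i) (h2 : i < m) :
    G.wordPot [ISym.non B i, ISym.non C (m - i)] + (12 + 14 * (min i (m - i) : ℕ)) ≤
      G.symPot (ISym.non A m) := by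
  have e1 : (G.symMeasure (ISym.non B i) : ℝ) + G.symMeasure (ISym.non C (m - i)) + 1 ≤
      G.symMeasure (ISym.non A m) := by exact_mod_cast wordMeasure_product hG hU hA h h1 h2
  have e2 := mul_log_split h1 h2
  have hl := Real.log_pos one_lt_two
  have e3 : 14 / Real.log 2 * ((min i (m - i) : ℕ) * Real.log 2 + i * Real.log i +
      (m - i : ℕ) * Real.log (m - i : ℕ)) ≤ 14 / Real.log 2 * (m * Real.log m) := by gcongr
  have e4 : 14 / Real.log 2 * ((min i (m - i) : ℕ) * Real.log 2) = 14 * (min i (m - i) : ℕ) := by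
    field_simp
  rw [mul_add, mul_add, e4] at e3
  simp only [wordPot, List.map_cons, List.map_nil, List.sum_cons, List.sum_nil, symPot]
  linarith

/-- The 12 operations are 4 before the choice and at most 8 for the choice itself, when the second
alternative is taken. -/
theorem wordPot_union (hG : G.IsBCNF) (hU : G.TreeUnique G.start) {A B : N} {m : ℕ}
    (hA : G.Reaches G.start A) (h : G.UnionDep A B) :
    G.wordPot [ISym.non B m] + 12 ≤ G.symPot (ISym.non A m) := by
  have e := (hU.reaches hG hA).height_lt hG h
  have e' : (G.symMeasure (ISym.non B m) : ℝ) + 1 ≤ G.symMeasure (ISym.non A m) := by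
    norm_cast
    simp only [symMeasure]
    omega
  simp only [wordPot, List.map_cons, List.map_nil, List.sum_cons, List.sum_nil, symPot]
  linarith

/-! ### Weights of immature words -/

variable (wt : T → ℝ)

/-- The weight of a symbol of an immature word. -/
def symWeight (G : BGrammar T N) (wt : T → ℝ) : ISym T N → ℝ
  | ISym.ter t => wt t
  | ISym.non A m => langWeight wt (G.langLen A m)

/-- The weight of an immature word. -/
def iWeight (G : BGrammar T N) (wt : T → ℝ) (ω : IWord T N) : ℝ := (ω.map (G.symWeight wt)).prod

theorem iWeight_append (u v : IWord T N) :
    G.iWeight wt (u ++ v) = G.iWeight wt u * G.iWeight wt v := by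
  simp [iWeight]

theorem iWeight_map_ter (w : List T) : G.iWeight wt (w.map ISym.ter) = wordWeight wt w := by
  simp [iWeight, wordWeight, Function.comp_def, symWeight]

theorem symWeight_eq_sum (hG : G.IsBCNF) {A : N} (hU : G.TreeUnique A) {m : ℕ} (hm : 0 < m) :
    G.symWeight wt (ISym.non A m) = ((G.childList A m).map (G.iWeight wt)).sum := by
  simp only [symWeight, childList]
  rcases hA : G.rule A with ⟨B, C⟩ | ⟨B, C⟩ | t | _
  · obtain ⟨hB, hC⟩ := hG.product_pos A B C hA
    rw [hG.langWeight_product wt hU hA, List.map_map,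
      ← List.sum_toFinset _ (nodup_boustrophedon m),
      Finset.Nat.sum_antidiagonal_eq_sum_range_succ_mk]
    symm
    -- The Boustrophedon list misses exactly i = 0 and i = m, where one operand would have to derive
    -- the empty word.
    refine Finset.sum_subset_zero_on_sdiff ?_ ?_ ?_
    · intro i hi
      rw [List.mem_toFinset, mem_boustrophedon] at hi
      rw [Finset.mem_range]
      omega
    · intro i hi
      simp only [Finset.mem_sdiff, Finset.mem_range, List.mem_toFinset, mem_boustrophedon] at hi
      rcases (by omega : i = 0 ∨ i = m) with rfl | rfl
      · rw [langWeight_langLen_zero wt hB, zero_mul]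
      · rw [Nat.sub_self, langWeight_langLen_zero wt hC, mul_zero]
    · intro i _
      simp [iWeight, symWeight]
  · rw [hG.langWeight_union wt hU hA]
    simp [iWeight, symWeight]
  · rw [hG.langLen_terminal hA]
    split_ifs
    · simp [langWeight, iWeight, symWeight, wordWeight]
    · simp [langWeight]
  · rw [hG.langLen_epsilon hA, if_neg hm.ne']
    simp [langWeight]

theorem nodup_childList (hG : G.IsBCNF) (A : N) (m : ℕ) : (G.childList A m).Nodup := by
  simp only [childList]
  rcases hA : G.rule A with ⟨B, C⟩ | ⟨B, C⟩ | t | _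
  · refine (List.nodup_map_iff_inj_on (nodup_boustrophedon m)).2 fun i _ j _ h => ?_
    simp only [List.cons.injEq, ISym.non.injEq] at h
    exact h.1.2
  · simpa using hG.union_ne A B C hA
  · simp only
    split_ifs <;> simp
  · simp

/-! ### The words derived from an immature word -/

open Classical in
/-- The words of length `n` derived from `ω`. -/
def IsBCNF.derived (hG : G.IsBCNF) (φ : Policy T N) (n : ℕ) (ω : IWord T N) : Finset (List T) :=
  (hG.finite_langLen G.start n).toFinset.filter fun w => G.Der φ ω w

theorem IsBCNF.mem_derived (hG : G.IsBCNF) {n : ℕ} {ω : IWord T N} (h : G.Reach φ n ω)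
    {w : List T} : w ∈ hG.derived φ n ω ↔ G.Der φ ω w := by
  simp only [derived, Finset.mem_filter, Set.Finite.mem_toFinset, and_iff_right_iff_imp]
  intro hd
  exact (hG.mem_words_iff_der φ).2 (h.trans hd)

theorem IsBCNF.derived_of_pos_none (hG : G.IsBCNF) {n : ℕ} {ω : IWord T N} (h : G.Reach φ n ω)
    (hp : φ.pos ω = none) : hG.derived φ n ω = {ω.letters} := by
  ext w
  rw [hG.mem_derived h, der_of_pos_none hp, Finset.mem_singleton]
  constructor
  · rintro rfl
    exact (IWord.letters_map_ter w).symm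
  · rintro rfl
    exact φ.eq_map_ter hp

/-- The words below a node are the disjoint union of those below its children, disjoint by
`child_unique`. The summand is left general since both real weights and probabilities in `ENNReal`
are summed. -/
theorem IsBCNF.sum_derived (hG : G.IsBCNF) (hU : G.TreeUnique G.start) {n : ℕ}
    {ω₁ ω₂ : IWord T N} {A : N} {m : ℕ} (h : G.Reach φ n (ω₁ ++ ISym.non A m :: ω₂))
    (hp : φ.pos (ω₁ ++ ISym.non A m :: ω₂) = some ω₁.length) (hm : 0 < m)
    {M : Type} [AddCommMonoid M] (f : List T → M) :
    ∑ w ∈ hG.derived φ n (ω₁ ++ ISym.non A m :: ω₂), f w =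
      ((G.childList A m).map fun x => ∑ w ∈ hG.derived φ n (ω₁ ++ x ++ ω₂), f w).sum := by
  classical
  rw [← List.sum_toFinset _ (nodup_childList hG A m)]
  have hs : ∀ x ∈ G.childList A m, G.Step φ (ω₁ ++ ISym.non A m :: ω₂) (ω₁ ++ x ++ ω₂) :=
    fun x hx => (step_split_iff hp hm).2 ⟨x, hx, rfl⟩
  rw [← Finset.sum_biUnion]
  · refine Finset.sum_congr ?_ fun _ _ => rfl
    ext w
    simp only [Finset.mem_biUnion, List.mem_toFinset]
    rw [hG.mem_derived h, der_iff_exists_step (by rw [hp]; simp)]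
    constructor
    · rintro ⟨c, hc, hd⟩
      obtain ⟨x, hx, rfl⟩ := (step_split_iff hp hm).1 hc
      exact ⟨x, hx, (hG.mem_derived (h.step hc)).2 hd⟩
    · rintro ⟨x, hx, hd⟩
      exact ⟨_, hs x hx, (hG.mem_derived (h.step (hs x hx))).1 hd⟩
  · intro x hx y hy hxy
    rw [Finset.mem_coe, List.mem_toFinset] at hx hy
    rw [Function.onFun, Finset.disjoint_left]
    intro w hw hw'
    apply hxy
    have := child_unique hG hU h (hs x hx) (hs y hy)
      ((hG.mem_derived (h.step (hs x hx))).1 hw) ((hG.mem_derived (h.step (hs y hy))).1 hw')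
    exact List.append_cancel_left (List.append_cancel_right this)

/-- The product of the weights of the symbols obeys the same recursion along atomic derivations as
the total weight of the derived words; both agree on mature words. -/
theorem IsBCNF.iWeight_eq_sum (hG : G.IsBCNF) (hU : G.TreeUnique G.start) {n : ℕ} (hn : 0 < n)
    {ω : IWord T N} (h : G.Reach φ n ω) :
    G.iWeight wt ω = ∑ w ∈ hG.derived φ n ω, wordWeight wt w := by
  induction hk : G.wordMeasure ω using Nat.strong_induction_on generalizing ω with
  | _ k ih =>
    rcases hp : φ.pos ω with _ | i
    · rw [hG.derived_of_pos_none h hp, Finset.sum_singleton, ← iWeight_map_ter (G := G),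
        ← φ.eq_map_ter hp]
    · obtain ⟨ω₁, A, m, ω₂, rfl, rfl⟩ := φ.exists_split hp
      obtain ⟨hA, hm, -⟩ := h.good hn A m (by simp)
      rw [hG.sum_derived hU h hp hm]
      have : ∀ x ∈ G.childList A m, ∑ w ∈ hG.derived φ n (ω₁ ++ x ++ ω₂), wordWeight wt w =
          G.iWeight wt ω₁ * G.iWeight wt ω₂ * G.iWeight wt x := by
        intro x hx
        have hs : G.Step φ (ω₁ ++ ISym.non A m :: ω₂) (ω₁ ++ x ++ ω₂) :=
          (step_split_iff hp hm).2 ⟨x, hx, rfl⟩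
        rw [← ih _ (hk ▸ wordMeasure_step hG hU (h.good hn) hs) (h.step hs) rfl, iWeight_append,
          iWeight_append]
        ring
      rw [List.map_congr_left this, List.sum_map_mul_left, ← symWeight_eq_sum wt hG
        (hU.reaches hG hA) hm, iWeight_append]
      simp only [iWeight, List.map_cons, List.prod_cons]
      ring

end

end BGrammar

end

noncomputable section
open Prog

/-! ## The weighted tree of forbidden walks -/

namespace BGrammar

variable {T N : Type} [Fintype N] {G : BGrammar T N} {φ : Policy T N} {n : ℕ}

theorem IsPath.isWalk {w : List T} {p : List (IWord T N)} (hG : G.IsBCNF)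
    (h : G.IsPath φ [ISym.non G.start n] w p) : G.IsWalk φ w p := by
  have : w.length = n := ((hG.mem_words_iff_der φ).2 h.der).2
  rwa [IsPath, ← this] at h

/-- By uniqueness the walk of `w` consists of all immature words between the root and `w`. From here
on the tree can be described by reachability, without lists. -/
theorem IsPath.mem_iff (hG : G.IsBCNF) (hU : G.TreeUnique G.start) {w : List T}
    {p : List (IWord T N)} (h : G.IsPath φ [ISym.non G.start n] w p) {v : IWord T N} :
    v ∈ p ↔ G.Reach φ n v ∧ G.Der φ v w := by
  refine ⟨fun hv => h.mem hv, fun ⟨hr, hd⟩ => ?_⟩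
  have key : ∃ q, G.IsPath φ [ISym.non G.start n] w q ∧ v ∈ q := by
    unfold Reach at hr
    generalize [ISym.non G.start n] = u at hr
    induction hr using Relation.ReflTransGen.head_induction_on with
    | refl =>
      obtain ⟨q, hq⟩ := hd.exists_isPath
      exact ⟨q, hq, List.mem_of_mem_head? hq.1⟩
    | head hs _ ih =>
      obtain ⟨q, hq, hv⟩ := ih
      exact ⟨_, hq.cons hs, List.mem_cons_of_mem _ hv⟩
  obtain ⟨q, hq, hv⟩ := key
  rwa [hU.walk_unique (h.isWalk hG) (hq.isWalk hG)]

omit [Fintype N] in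
theorem IsPath.pairwise {ω : IWord T N} {w : List T} {p : List (IWord T N)}
    (h : G.IsPath φ ω w p) : p.Pairwise (Relation.TransGen (G.Step φ)) :=
  List.isChain_iff_pairwise.1 (h.2.1.imp fun _ _ hs => .single hs)

/-- Two immature words from which the same word is derived are comparable. -/
theorem reach_total (hG : G.IsBCNF) (hU : G.TreeUnique G.start) {u v : IWord T N} {w : List T}
    (hu : G.Reach φ n u) (hv : G.Reach φ n v) (hdu : G.Der φ u w) (hdv : G.Der φ v w) :
    Relation.ReflTransGen (G.Step φ) u v ∨ Relation.ReflTransGen (G.Step φ) v u := by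
  obtain ⟨p, hp⟩ : ∃ p, G.IsPath φ [ISym.non G.start n] w p :=
    Der.exists_isPath (Relation.ReflTransGen.trans hu hdu)
  have : Std.Symm fun u v : IWord T N =>
      Relation.ReflTransGen (G.Step φ) u v ∨ Relation.ReflTransGen (G.Step φ) v u :=
    ⟨fun _ _ h => Or.symm h⟩
  exact List.Pairwise.forall_of_forall
    (R := fun u v => Relation.ReflTransGen (G.Step φ) u v ∨ Relation.ReflTransGen (G.Step φ) v u)
    (fun _ _ => Or.inl Relation.ReflTransGen.refl)
    (hp.pairwise.imp fun h => Or.inl (Relation.TransGen.to_reflTransGen h))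
    ((hp.mem_iff hG hU).2 ⟨hu, hdu⟩) ((hp.mem_iff hG hU).2 ⟨hv, hdv⟩)

theorem wordMeasure_transGen (hG : G.IsBCNF) (hU : G.TreeUnique G.start) {u v : IWord T N}
    (hu : G.Good n u) (h : Relation.TransGen (G.Step φ) u v) :
    G.Good n v ∧ G.wordMeasure v < G.wordMeasure u := by
  induction h with
  | single hs => exact ⟨hu.step hs, wordMeasure_step hG hU hu hs⟩
  | tail _ hs ih => exact ⟨ih.1.step hs, (wordMeasure_step hG hU ih.1 hs).trans ih.2⟩

end BGrammar

namespace WTree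

open BGrammar

variable {T N : Type}

open scoped Classical in
/-- The number stored for `ω`. -/
def val (t : WTree T N) (ω : IWord T N) : ℝ :=
  if ω ∈ t.nodes then t.mem.getD (t.cell ω) 0 else 0

@[simp] theorem forb_bind {β : Type} (t : WTree T N) (ω : IWord T N) (f : ℝ → Prog β) :
    (t.forb ω >>= f) = Prog.tick (f (t.val ω)) := rfl

/-- Distinctness of the cells matters: nodes that share a cell must not add the weight twice. -/
theorem returns_increment (μ : ℝ) (cs : List ℕ) (t : WTree T N) (hcs : cs.Nodup)
    (hlt : ∀ c ∈ cs, c < t.mem.length) :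
    ∃ mem : List ℝ, mem.length = t.mem.length ∧
      (∀ c ∈ cs, mem.getD c 0 = t.mem.getD c 0 + μ) ∧
      (∀ c ∉ cs, mem.getD c 0 = t.mem.getD c 0) ∧
      Returns (increment μ cs t) { t with mem := mem } cs.length := by
  induction cs generalizing t with
  | nil => exact ⟨t.mem, rfl, by simp, by simp, returns_pure _⟩
  | cons c cs ih =>
    rw [List.nodup_cons] at hcs
    set t' : WTree T N := { t with mem := t.mem.set c (t.mem.getD c 0 + μ) }
    obtain ⟨mem, h1, h2, h3, h4⟩ := ih t' hcs.2 (by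
      intro d hd
      simpa [t'] using hlt d (List.mem_cons_of_mem _ hd))
    have hc := hlt c List.mem_cons_self
    have hset : ∀ d, t'.mem.getD d 0 =
        if d = c then t.mem.getD c 0 + μ else t.mem.getD d 0 := by
      intro d
      simp only [t', List.getD_eq_getElem?_getD, List.getElem?_set]
      by_cases hdc : c = d
      · subst hdc
        simp [hc]
      · rw [if_neg hdc, if_neg (Ne.symm hdc)]
    refine ⟨mem, by simpa [t'] using h1, ?_, ?_, ?_⟩
    · intro d hd
      rcases List.mem_cons.1 hd with rfl | hd
      · rw [h3 _ hcs.1, hset, if_pos rfl]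
      · have hd' := hd
        rw [h2 d hd, hset, if_neg]
        rintro rfl
        exact hcs.1 hd'
    · intro d hd
      rw [List.mem_cons, not_or] at hd
      rw [h3 d hd.2, hset, if_neg hd.1]
    · exact .tick h4

open scoped Classical in
/-- The tree stores the weights of the words in `F` below its nodes, and two nodes share a cell if
and only if the same words of `F` are below them. -/
structure Inv [Fintype N] (G : BGrammar T N) (φ : Policy T N) (n : ℕ) (wt : T → ℝ)
    (F : Finset (List T)) (t : WTree T N) : Prop where
  mem_nodes : ∀ v, v ∈ t.nodes ↔ G.Reach φ n v ∧ ∃ w ∈ F, G.Der φ v w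
  cell_lt : ∀ v ∈ t.nodes, t.cell v < t.mem.length
  cell_eq : ∀ u ∈ t.nodes, ∀ v ∈ t.nodes,
    t.cell u = t.cell v ↔ ∀ w ∈ F, G.Der φ u w ↔ G.Der φ v w
  mem_eq : ∀ v ∈ t.nodes,
    t.mem.getD (t.cell v) 0 = ∑ w ∈ F with G.Der φ v w, wordWeight wt w

variable [Fintype N] {G : BGrammar T N} {φ : Policy T N} {n : ℕ} {wt : T → ℝ}
  {F : Finset (List T)} {t : WTree T N}

theorem inv_empty : Inv G φ n wt ∅ (empty : WTree T N) where
  mem_nodes := by simp [empty]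
  cell_lt := by simp [empty]
  cell_eq := by simp [empty]
  mem_eq := by simp [empty]

open scoped Classical in
-- For an immature word outside of the tree the default value 0 is correct too, as no forbidden word
-- lies below it.
theorem Inv.val_eq (h : Inv G φ n wt F t) {v : IWord T N} (hv : G.Reach φ n v) :
    t.val v = ∑ w ∈ F with G.Der φ v w, wordWeight wt w := by
  unfold val
  split_ifs with hm
  · exact h.mem_eq v hm
  · rw [Finset.filter_eq_empty_iff.2, Finset.sum_empty]
    intro w hw hd
    exact hm ((h.mem_nodes v).2 ⟨hv, w, hw, hd⟩)

open scoped Classical in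
-- What both forms of the update have in common. Nodes are of three kinds: new ones on the walk,
-- below which `w` is the only forbidden word; old ones on the walk, which gain `w`; and old ones
-- off the walk, which do not change. Sharing must be kept within each kind and excluded between
-- kinds.
theorem Inv.insert (h : Inv G φ n wt F t) {w : List T} (hw : w ∉ F)
    {walk : List (IWord T N)} (hwalk : ∀ v, v ∈ walk ↔ G.Reach φ n v ∧ G.Der φ v w)
    {t' : WTree T N} (hnodes : ∀ v, v ∈ t'.nodes ↔ v ∈ t.nodes ∨ v ∈ walk)
    (hlt : ∀ v ∈ t'.nodes, t'.cell v < t'.mem.length)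
    (hnew : ∀ v ∈ walk, v ∉ t.nodes → t'.cell v = t.mem.length)
    (hnew' : t'.mem.getD t.mem.length 0 = wordWeight wt w)
    (hoff : ∀ v ∈ t.nodes, v ∉ walk → t'.cell v = t.cell v ∧
      t'.mem.getD (t.cell v) 0 = t.mem.getD (t.cell v) 0)
    (hon : ∀ v ∈ t.nodes, v ∈ walk → t'.cell v ≠ t.mem.length ∧
      t'.mem.getD (t'.cell v) 0 = t.mem.getD (t.cell v) 0 + wordWeight wt w)
    (honon : ∀ u ∈ t.nodes, u ∈ walk → ∀ v ∈ t.nodes, v ∈ walk →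
      (t'.cell u = t'.cell v ↔ t.cell u = t.cell v))
    (honoff : ∀ u ∈ t.nodes, u ∈ walk → ∀ v ∈ t.nodes, v ∉ walk → t'.cell u ≠ t.cell v) :
    Inv G φ n wt (Insert.insert w F) t' := by
  have hreach : ∀ v ∈ t.nodes, G.Reach φ n v := fun v hv => ((h.mem_nodes v).1 hv).1
  have hder : ∀ v ∈ t.nodes, v ∉ walk → ¬ G.Der φ v w := fun v hv hv' hd =>
    hv' ((hwalk v).2 ⟨hreach v hv, hd⟩)
  have hfil : ∀ v ∈ walk, v ∉ t.nodes → ∀ w' ∈ F, ¬ G.Der φ v w' := fun v hv hv' w' hw' hd =>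
    hv' ((h.mem_nodes v).2 ⟨((hwalk v).1 hv).1, w', hw', hd⟩)
  have hex : ∀ v ∈ t.nodes, ∃ w' ∈ F, G.Der φ v w' := fun v hv => ((h.mem_nodes v).1 hv).2
  constructor
  · intro v
    rw [hnodes, h.mem_nodes, hwalk]
    simp only [Finset.mem_insert, exists_eq_or_imp]
    simp only [and_or_left]
    exact or_comm
  · exact hlt
  · intro u hu v hv
    simp only [Finset.mem_insert, forall_eq_or_imp]
    by_cases hun : u ∈ t.nodes <;> by_cases hvn : v ∈ t.nodes
    · by_cases huw : u ∈ walk <;> by_cases hvw : v ∈ walk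
      · rw [honon u hun huw v hvn hvw, h.cell_eq u hun v hvn]
        have h1 := ((hwalk u).1 huw).2
        have h2 := ((hwalk v).1 hvw).2
        exact ⟨fun hc => ⟨iff_of_true h1 h2, hc⟩, fun hc => hc.2⟩
      · have h1 := ((hwalk u).1 huw).2
        have h2 := hder v hvn hvw
        refine ⟨fun hc => absurd hc ?_, fun hc => absurd (hc.1.1 h1) h2⟩
        rw [(hoff v hvn hvw).1]
        exact honoff u hun huw v hvn hvw
      · have h1 := ((hwalk v).1 hvw).2
        have h2 := hder u hun huw
        refine ⟨fun hc => absurd hc.symm ?_, fun hc => absurd (hc.1.2 h1) h2⟩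
        rw [(hoff u hun huw).1]
        exact honoff v hvn hvw u hun huw
      · rw [(hoff u hun huw).1, (hoff v hvn hvw).1, h.cell_eq u hun v hvn]
        have h1 := hder u hun huw
        have h2 := hder v hvn hvw
        exact ⟨fun hc => ⟨iff_of_false h1 h2, hc⟩, fun hc => hc.2⟩
    · have hvw := ((hnodes v).1 hv).resolve_left hvn
      obtain ⟨w', hw', hd⟩ := hex u hun
      refine ⟨fun hc => absurd hc ?_, fun hc => absurd ((hc.2 w' hw').1 hd) (hfil v hvw hvn w' hw')⟩
      rw [hnew v hvw hvn]
      by_cases huw : u ∈ walk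
      · exact (hon u hun huw).1
      · rw [(hoff u hun huw).1]
        exact (h.cell_lt u hun).ne
    · have huw := ((hnodes u).1 hu).resolve_left hun
      obtain ⟨w', hw', hd⟩ := hex v hvn
      refine ⟨fun hc => absurd hc.symm ?_,
        fun hc => absurd ((hc.2 w' hw').2 hd) (hfil u huw hun w' hw')⟩
      rw [hnew u huw hun]
      by_cases hvw : v ∈ walk
      · exact (hon v hvn hvw).1
      · rw [(hoff v hvn hvw).1]
        exact (h.cell_lt v hvn).ne
    · have huw := ((hnodes u).1 hu).resolve_left hun
      have hvw := ((hnodes v).1 hv).resolve_left hvn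
      refine ⟨fun _ => ⟨?_, ?_⟩, fun _ => by rw [hnew u huw hun, hnew v hvw hvn]⟩
      · exact iff_of_true ((hwalk u).1 huw).2 ((hwalk v).1 hvw).2
      · exact fun w' hw' => iff_of_false (hfil u huw hun w' hw') (hfil v hvw hvn w' hw')
  · intro v hv
    rw [Finset.filter_insert]
    by_cases hvw : v ∈ walk
    · rw [if_pos ((hwalk v).1 hvw).2, Finset.sum_insert (by simp [hw])]
      by_cases hvn : v ∈ t.nodes
      · rw [(hon v hvn hvw).2, h.mem_eq v hvn, add_comm]
      · rw [hnew v hvw hvn, hnew', Finset.filter_eq_empty_iff.2 (fun _ h => hfil v hvw hvn _ h),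
          Finset.sum_empty, add_zero]
    · have hvn := ((hnodes v).1 hv).resolve_right hvw
      rw [if_neg (hder v hvn hvw), (hoff v hvn hvw).1, (hoff v hvn hvw).2, h.mem_eq v hvn]

open scoped Classical in
/-- The branching node `b` of a new walk is unary if and only if it shares its cell with a node
outside of the walk. -/
theorem Inv.card_children_eq_one_iff (hG : G.IsBCNF) (hU : G.TreeUnique G.start) (hn : 0 < n)
    (h : Inv G φ n wt F t) {w : List T} {b : IWord T N} (hb : b ∈ t.nodes) (hbw : G.Der φ b w)
    (hwF : w ∉ F) (hlast : ∀ v ∈ t.nodes, G.Der φ v w → Relation.ReflTransGen (G.Step φ) v b) :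
    (t.nodes.filter fun v => G.Step φ b v).card = 1 ↔
      ∃ v ∈ t.nodes, ¬ G.Der φ v w ∧ t.cell v = t.cell b := by
  have hbr := ((h.mem_nodes b).1 hb).1
  -- `b` is not mature: otherwise the new word and the forbidden word below `b` would both be `b`.
  have hchild : ∀ w' ∈ F, G.Der φ b w' → ∃ c ∈ t.nodes, G.Step φ b c ∧ G.Der φ c w' := by
    intro w' hw' hd
    have hp : φ.pos b ≠ none := by
      intro hp
      rw [der_of_pos_none hp] at hd hbw
      rw [hd] at hbw
      exact hwF (ISym.map_ter_injective hbw ▸ hw')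
    obtain ⟨c, hc, hd⟩ := (der_iff_exists_step hp).1 hd
    exact ⟨c, (h.mem_nodes c).2 ⟨hbr.step hc, w', hw', hd⟩, hc, hd⟩
  rw [Finset.card_eq_one]
  constructor
  · rintro ⟨v, hv⟩
    have hv' : ∀ c, c ∈ t.nodes ∧ G.Step φ b c ↔ c = v := by
      intro c
      rw [← Finset.mem_singleton, ← hv, Finset.mem_filter]
    obtain ⟨hvn, hs⟩ := (hv' v).2 rfl
    refine ⟨v, hvn, fun hd => ?_, (h.cell_eq v hvn b hb).2 fun w' hw' => ?_⟩
    -- A child of `b` on the new walk would have to precede `b`, against the decrease of the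
    -- measure.
    · have h1 := hlast v hvn hd
      have h2 := (wordMeasure_transGen hG hU (hbr.good hn) (.head' hs h1)).2
      exact lt_irrefl _ h2
    · refine ⟨fun hd => hd.head hs, fun hd => ?_⟩
      obtain ⟨c, hc1, hc2, hc3⟩ := hchild w' hw' hd
      rwa [(hv' c).1 ⟨hc1, hc2⟩] at hc3
  · rintro ⟨v, hvn, hvw, hcell⟩
    rw [h.cell_eq v hvn b hb] at hcell
    obtain ⟨hvr, w', hw', hd⟩ := (h.mem_nodes v).1 hvn
    -- A common forbidden word makes `b` and `v` comparable, and `v` is not above `b` because it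
    -- does not derive `w`. All forbidden words below `b` then pass through its child towards `v`.
    have hbv : Relation.ReflTransGen (G.Step φ) b v := by
      refine (reach_total hG hU hbr hvr ((hcell w' hw').1 hd) hd).resolve_right fun hvb => ?_
      exact hvw (Relation.ReflTransGen.trans hvb hbw)
    rcases Relation.ReflTransGen.cases_head hbv with rfl | ⟨c, hc, hcv⟩
    · exact absurd hbw hvw
    · have hcr := hbr.step hc
      refine ⟨c, Finset.eq_singleton_iff_unique_mem.2 ⟨?_, ?_⟩⟩
      · exact Finset.mem_filter.2 ⟨(h.mem_nodes c).2 ⟨hcr, w', hw', hcv.trans hd⟩, hc⟩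
      · intro c' hc'
        rw [Finset.mem_filter] at hc'
        obtain ⟨-, w'', hw'', hd''⟩ := (h.mem_nodes c').1 hc'.1
        have := (hcell w'' hw'').2 (hd''.head hc'.2)
        exact child_unique hG hU hbr hc'.2 hc hd'' (hcv.trans this)

/-- A node `u` at or above the branching node `b` that shares its cell with a node `v` off the walk
has `b` between itself and `v`. The sets of forbidden words shrink downwards and agree at both ends,
so `b` has the same set. Only the cell of `b` can therefore be shared across the border of the walk.
-/
theorem Inv.cell_eq_of_off (hG : G.IsBCNF) (hU : G.TreeUnique G.start)
    (h : Inv G φ n wt F t) {w : List T} {b : IWord T N} (hb : b ∈ t.nodes) (hbw : G.Der φ b w)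
    {u v : IWord T N} (hu : u ∈ t.nodes) (hub : Relation.ReflTransGen (G.Step φ) u b)
    (hv : v ∈ t.nodes) (hvw : ¬ G.Der φ v w) (huv : t.cell u = t.cell v) :
    t.cell u = t.cell b := by
  rw [h.cell_eq u hu b hb]
  rw [h.cell_eq u hu v hv] at huv
  obtain ⟨hbr, w', hw', hd⟩ := (h.mem_nodes b).1 hb
  have hdv : G.Der φ v w' := (huv w' hw').1 (hub.trans hd)
  have hbv := (reach_total hG hU hbr ((h.mem_nodes v).1 hv).1 hd hdv).resolve_right
    fun hvb => hvw (Relation.ReflTransGen.trans hvb hbw)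
  intro w'' hw''
  exact ⟨fun hd => hbv.trans ((huv w'' hw'').1 hd), fun hd => hub.trans hd⟩

theorem getD_append_of_lt {l l' : List ℝ} {i : ℕ} (h : i < l.length) :
    (l ++ l').getD i 0 = l.getD i 0 := by
  simp [List.getD_eq_getElem?_getD, List.getElem?_append_left h]

open scoped Classical in
/-- The update by the walk of a new word preserves the invariant; it takes at most one operation
per node of the walk and one more, and at most two new cells. -/
theorem Inv.update (hG : G.IsBCNF) (hU : G.TreeUnique G.start) (hn : 0 < n)
    (h : Inv G φ n wt F t) {w : List T} (hw : w ∉ F) {walk : List (IWord T N)}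
    (hwalk : G.IsPath φ [ISym.non G.start n] w walk) :
    ∃ t' c, c ≤ walk.length + 1 ∧ t'.mem.length ≤ t.mem.length + 2 ∧
      Returns (t.update G φ walk (wordWeight wt w)) t' c ∧
      Inv G φ n wt (Insert.insert w F) t' := by
  set μ := wordWeight wt w
  have hmem : ∀ v, v ∈ walk ↔ G.Reach φ n v ∧ G.Der φ v w := fun v => hwalk.mem_iff hG hU
  set L := t.mem.length with hL
  set old := walk.filter fun v => v ∈ t.nodes with hold
  have hmold : ∀ v, v ∈ old ↔ v ∈ t.nodes ∧ v ∈ walk := by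
    intro v; simp [old, and_comm]
  have hgetL : ∀ l : List ℝ, (t.mem ++ μ :: l).getD L 0 = μ := by
    intro l; simp [List.getD_eq_getElem?_getD, hL]
  unfold WTree.update
  simp only [← hold]
  rcases hb : old.getLast? with _ | b
  · have hempty : ∀ v ∈ t.nodes, v ∉ walk := by
      intro v hv hv'
      have := (hmold v).2 ⟨hv, hv'⟩
      rw [List.getLast?_eq_none_iff.1 hb] at this
      simp at this
    refine ⟨_, 0, Nat.zero_le _, by simp; omega, returns_pure _, ?_⟩
    refine h.insert hw hmem (by simp) ?_ ?_ (hgetL []) ?_ ?_ ?_ ?_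
    · intro v hv
      simp only
      split_ifs with hvn
      · have := h.cell_lt v hvn
        simp; omega
      · simp
    · intro v _ hvn
      simp [hvn]
    · intro v hvn _
      exact ⟨by simp [hvn], getD_append_of_lt (h.cell_lt v hvn)⟩
    · exact fun v hvn hvw => absurd hvw (hempty v hvn)
    · exact fun v hvn hvw => absurd hvw (hempty v hvn)
    · exact fun v hvn hvw => absurd hvw (hempty v hvn)
  · obtain ⟨ys, hys⟩ := List.getLast?_eq_some_iff.1 hb
    have hbold : b ∈ old := by rw [hys]; simp
    obtain ⟨hbn, hbwalk⟩ := (hmold b).1 hbold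
    have hbw := ((hmem b).1 hbwalk).2
    have hle : ∀ v ∈ t.nodes, v ∈ walk → Relation.ReflTransGen (G.Step φ) v b := by
      intro v hv hv'
      have hp : old.Pairwise (Relation.TransGen (G.Step φ)) := hwalk.pairwise.filter _
      have hvo := (hmold v).2 ⟨hv, hv'⟩
      rw [hys] at hp hvo
      rcases List.mem_append.1 hvo with hvo | hvo
      · exact ((List.pairwise_append.1 hp).2.2 v hvo b (by simp)).to_reflTransGen
      · rw [List.mem_singleton.1 hvo]
    have hoffder : ∀ v ∈ t.nodes, v ∉ walk → ¬ G.Der φ v w := fun v hv hv' hd =>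
      hv' ((hmem v).2 ⟨((h.mem_nodes v).1 hv).1, hd⟩)
    have hcard := h.card_children_eq_one_iff hG hU hn hbn hbw hw fun v hv hd =>
      hle v hv ((hmem v).2 ⟨((h.mem_nodes v).1 hv).1, hd⟩)
    have hoffcell : ∀ u ∈ t.nodes, u ∈ walk → ∀ v ∈ t.nodes, v ∉ walk → t.cell u = t.cell v →
        t.cell u = t.cell b := fun u hu hu' v hv hv' =>
      h.cell_eq_of_off hG hU hbn hbw hu (hle u hu hu') hv (hoffder v hv hv')
    have holdlen : old.length ≤ walk.length := List.length_filter_le _ _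
    simp only
    -- If `b` is unary, its cell keeps the old number for the nodes off the walk, and the nodes on
    -- the walk with this cell move to a second new cell. Otherwise no cell is shared across the
    -- border of the walk, and adding the weight once to each cell of the walk is correct.
    split_ifs with hone
    · set cs := (old.map t.cell).dedup.filter fun c => c ≠ t.cell b
      have hcs : ∀ c, c ∈ cs ↔ (∃ v ∈ t.nodes, v ∈ walk ∧ t.cell v = c) ∧ c ≠ t.cell b := by
        intro c
        simp [cs, hmold, and_assoc]
      have hcslt : ∀ c ∈ cs, c < L := by
        intro c hc
        obtain ⟨⟨v, hv, -, rfl⟩, -⟩ := (hcs c).1 hc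
        exact h.cell_lt v hv
      set s := t.mem.getD (t.cell b) 0 + μ with hs
      set t₂ : WTree T N :=
        { nodes := t.nodes ∪ walk.toFinset
          cell := fun v => if v ∈ old ∧ t.cell v = t.cell b then L + 1 else
            if v ∈ t.nodes then t.cell v else L
          mem := t.mem ++ [μ] ++ [s] } with ht₂
      have hlen₂ : t₂.mem.length = L + 2 := by simp [t₂, hL]
      obtain ⟨mem, h1, h2, h3, h4⟩ := returns_increment μ cs t₂
        ((List.nodup_dedup _).filter _) (fun c hc => by rw [hlen₂]; have := hcslt c hc; omega)
      have hget : ∀ i < L, t₂.mem.getD i 0 = t.mem.getD i 0 := by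
        intro i hi
        simp only [t₂, List.append_assoc]
        exact getD_append_of_lt hi
      -- One addition fills the second new cell; each other cell of an old node on the walk is
      -- increased once.
      refine ⟨{ nodes := t₂.nodes, cell := t₂.cell, mem := mem }, 1 + cs.length, ?_, ?_, ?_, ?_⟩
      · have e1 : cs.length ≤ (old.map t.cell).dedup.length := List.length_filter_le _ _
        have e2 : (old.map t.cell).dedup.length ≤ (old.map t.cell).length :=
          (List.dedup_sublist _).length_le
        rw [List.length_map] at e2
        omega
      · exact h1.le.trans hlen₂.le
      · exact (returns_add _ _).bind h4
      · have hcon : ∀ v ∈ t.nodes, v ∈ walk →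
            t₂.cell v = if t.cell v = t.cell b then L + 1 else t.cell v := by
          intro v hv hv'
          simp [t₂, hmold, hv, hv']
        have hcoff : ∀ v ∈ t.nodes, v ∉ walk → t₂.cell v = t.cell v := by
          intro v hv hv'
          simp [t₂, hmold, hv, hv']
        have hcnew : ∀ v ∉ t.nodes, t₂.cell v = L := by
          intro v hv
          simp [t₂, hmold, hv]
        refine h.insert hw hmem (by simp [t₂]) ?_ ?_ ?_ ?_ ?_ ?_ ?_
        · intro v hv
          change t₂.cell v < mem.length
          rw [h1, hlen₂]
          by_cases hvn : v ∈ t.nodes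
          · have := h.cell_lt v hvn
            by_cases hvw : v ∈ walk
            · rw [hcon v hvn hvw]; split_ifs <;> omega
            · rw [hcoff v hvn hvw]; omega
          · rw [hcnew v hvn]; omega
        · exact fun v _ hvn => hcnew v hvn
        · change mem.getD L 0 = μ
          rw [h3 L fun hc => lt_irrefl _ (hcslt L hc)]
          simp only [t₂, List.append_assoc]
          exact hgetL [s]
        · intro v hvn hvw
          refine ⟨hcoff v hvn hvw, ?_⟩
          change mem.getD _ 0 = _
          rw [h3, hget _ (h.cell_lt v hvn)]
          rw [hcs]
          rintro ⟨⟨u, hu, hu', huv⟩, hne⟩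
          exact hne (huv ▸ hoffcell u hu hu' v hvn hvw huv)
        · intro v hvn hvw
          have hlt := h.cell_lt v hvn
          change t₂.cell v ≠ L ∧ mem.getD (t₂.cell v) 0 = _
          rw [hcon v hvn hvw]
          split_ifs with hvb
          · refine ⟨by omega, ?_⟩
            rw [h3 _ fun hc => by have := hcslt _ hc; omega, hvb]
            simp [t₂, List.getD_eq_getElem?_getD, hL, s, μ]
          · refine ⟨by omega, ?_⟩
            rw [h2 _ ((hcs _).2 ⟨⟨v, hvn, hvw, rfl⟩, hvb⟩), hget _ hlt]
        · intro u hu hu' v hv hv'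
          have hlt := h.cell_lt u hu
          have hlt' := h.cell_lt v hv
          change t₂.cell u = t₂.cell v ↔ _
          rw [hcon u hu hu', hcon v hv hv']
          split_ifs with hub hvb hvb <;> omega
        · intro u hu hu' v hv hv'
          have hlt' := h.cell_lt v hv
          change t₂.cell u ≠ _
          rw [hcon u hu hu']
          split_ifs with hub
          · omega
          · exact fun huv => hub (hoffcell u hu hu' v hv hv' huv)
    · set cs := (old.map t.cell).dedup
      have hcs : ∀ c, c ∈ cs ↔ ∃ v ∈ t.nodes, v ∈ walk ∧ t.cell v = c := by
        intro c
        simp [cs, hmold, and_assoc]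
      have hcslt : ∀ c ∈ cs, c < L := by
        intro c hc
        obtain ⟨v, hv, -, rfl⟩ := (hcs c).1 hc
        exact h.cell_lt v hv
      have hne : ∀ u ∈ t.nodes, u ∈ walk → ∀ v ∈ t.nodes, v ∉ walk → t.cell u ≠ t.cell v := by
        intro u hu hu' v hv hv' huv
        exact hone (hcard.2 ⟨v, hv, hoffder v hv hv', huv ▸ hoffcell u hu hu' v hv hv' huv⟩)
      set t₁ : WTree T N :=
        { nodes := t.nodes ∪ walk.toFinset
          cell := fun v => if v ∈ t.nodes then t.cell v else L
          mem := t.mem ++ [μ] } with ht₁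
      have hlen₁ : t₁.mem.length = L + 1 := by simp [t₁, hL]
      obtain ⟨mem, h1, h2, h3, h4⟩ := returns_increment μ cs t₁
        (List.nodup_dedup _) (fun c hc => by rw [hlen₁]; have := hcslt c hc; omega)
      have hget : ∀ i < L, t₁.mem.getD i 0 = t.mem.getD i 0 := by
        intro i hi
        exact getD_append_of_lt hi
      have hcold : ∀ v ∈ t.nodes, t₁.cell v = t.cell v := by
        intro v hv
        simp [t₁, hv]
      have hcnew : ∀ v ∉ t.nodes, t₁.cell v = L := by
        intro v hv
        simp [t₁, hv]
      refine ⟨_, cs.length, ?_, ?_, h4, ?_⟩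
      · have e2 : cs.length ≤ (old.map t.cell).length :=
          (List.dedup_sublist _).length_le
        rw [List.length_map] at e2
        omega
      · exact h1.le.trans (by omega)
      · refine h.insert hw hmem (by simp [t₁]) ?_ ?_ ?_ ?_ ?_ ?_ ?_
        · intro v hv
          change t₁.cell v < mem.length
          rw [h1, hlen₁]
          by_cases hvn : v ∈ t.nodes
          · have := h.cell_lt v hvn
            rw [hcold v hvn]; omega
          · rw [hcnew v hvn]; omega
        · exact fun v _ hvn => hcnew v hvn
        · change mem.getD L 0 = μ
          rw [h3 L fun hc => lt_irrefl _ (hcslt L hc)]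
          exact hgetL []
        · intro v hvn hvw
          refine ⟨hcold v hvn, ?_⟩
          change mem.getD _ 0 = _
          rw [h3, hget _ (h.cell_lt v hvn)]
          rw [hcs]
          rintro ⟨u, hu, hu', huv⟩
          exact hne u hu hu' v hvn hvw huv
        · intro v hvn hvw
          have hlt := h.cell_lt v hvn
          change t₁.cell v ≠ L ∧ mem.getD (t₁.cell v) 0 = _
          rw [hcold v hvn]
          refine ⟨by omega, ?_⟩
          rw [h2 _ ((hcs _).2 ⟨v, hvn, hvw, rfl⟩), hget _ hlt]
        · intro u hu hu' v hv hv'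
          change t₁.cell u = t₁.cell v ↔ _
          rw [hcold u hu, hcold v hv]
        · intro u hu hu' v hv hv'
          change t₁.cell u ≠ _
          rw [hcold u hu]
          exact hne u hu hu' v hv hv'

end WTree

end

noncomputable section
open Prog MeasureTheory

/-! ## The step-by-step algorithm -/

/-- A uniform number in `[0, d + D)` either falls below `d` or leaves a uniform number in
`[0, D)`. -/
theorem lintegral_Ico_add {d D : ℝ} (hd : 0 ≤ d) (hD : 0 ≤ D) (a : ENNReal) (h : ℝ → ENNReal) :
    ∫⁻ r in Set.Ico 0 (d + D), (if r - d < 0 then a else h (r - d)) =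
      ENNReal.ofReal d * a + ∫⁻ r in Set.Ico 0 D, h r := by
  rw [← Set.Ico_union_Ico_eq_Ico hd (le_add_of_nonneg_right hD),
    lintegral_union measurableSet_Ico (Set.Ico_disjoint_Ico_same)]
  congr 1
  · rw [setLIntegral_congr_fun (g := fun _ => a) measurableSet_Ico fun r hr => if_pos (by
      have := hr.2
      linarith), setLIntegral_const, Real.volume_Ico, sub_zero, mul_comm]
  · rw [setLIntegral_congr_fun (g := fun r => h (r - d)) measurableSet_Ico fun r hr =>
        if_neg (by have := hr.1; linarith), ← lintegral_indicator measurableSet_Ico,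
      ← lintegral_indicator measurableSet_Ico,
      ← lintegral_sub_right_eq_self (fun r => (Set.Ico 0 D).indicator h r) d]
    refine lintegral_congr fun r => ?_
    simp only [Set.indicator, Set.mem_Ico, sub_nonneg, sub_lt_iff_lt_add, add_comm D d]

/-! ### The random choice of an atomic derivation -/

section

variable {T N β : Type} (tab : N → List ℝ) (t : WTree T N) (μ : ℝ)

section

variable (A B C : N) (m : ℕ) (mk : ℕ → IWord T N) (go : IWord T N → ℝ → Prog (Option β))
  {w : ℕ → ℝ}

theorem trySplits_cons {i : ℕ}
    (hw : μ * (tab B).getD i 0 * (tab C).getD (m - i) 0 / (tab A).getD m 0 = w i) (is : List ℕ)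
    (r : ℝ) : trySplits tab t μ A B C m mk go (i :: is) r =
      tick (tick (tick (tick (tick (tick (tick (if r - (w i - t.val (mk i)) < 0
        then go (mk i) (w i)
        else trySplits tab t μ A B C m mk go is (r - (w i - t.val (mk i)))))))))) := by
  simp [trySplits, ← hw]

/-- Since `r` is below the sum of all shares, some share is hit before the list is exhausted; the
remaining `r` is nonnegative, so the share that is hit is positive. Seven operations are counted per
trial. -/
theorem trySplits_allRuns {is : List ℕ}
    (hw : ∀ i ∈ is, μ * (tab B).getD i 0 * (tab C).getD (m - i) 0 / (tab A).getD m 0 = w i)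
    {Q : Option β → ℕ → Prop} {r : ℝ} (h0 : 0 ≤ r)
    (hr : r < (is.map fun i => w i - t.val (mk i)).sum)
    (hgo : ∀ (j : ℕ) (hj : j < is.length), 0 < w is[j] - t.val (mk is[j]) →
      (go (mk is[j]) (w is[j])).AllRuns fun a c => Q a (c + 7 * (j + 1))) :
    (trySplits tab t μ A B C m mk go is r).AllRuns Q := by
  induction is generalizing r Q with
  | nil => simp at hr; linarith
  | cons i is ih =>
    rw [trySplits_cons tab t μ A B C m mk go (hw i (by simp))]
    simp only [allRuns_tick]
    rw [List.map_cons, List.sum_cons] at hr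
    split_ifs with h
    · exact hgo 0 (by simp) (by simp; linarith)
    · refine ih (fun j hj => hw j (by simp [hj])) (by linarith) (by linarith) fun j hj hpos => ?_
      refine (hgo (j + 1) (by simpa using hj) (by simpa using hpos)).mono fun a c hc => ?_
      have e : c + 7 * (j + 1 + 1) = c + 7 * (j + 1) + 1 + 1 + 1 + 1 + 1 + 1 + 1 := by ring
      rwa [e] at hc

/-- One trial after the other is peeled off with `lintegral_Ico_add`: what is left of a uniform
number is again uniform. The continuation `k` stands for the rest of the whole program, since the
event concerns the final output. -/
theorem trySplits_prob {γ : Type} (k : Option β → Prog γ) (E : Set γ) {is : List ℕ}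
    (hw : ∀ i ∈ is, μ * (tab B).getD i 0 * (tab C).getD (m - i) 0 / (tab A).getD m 0 = w i)
    (hd : ∀ i ∈ is, 0 ≤ w i - t.val (mk i)) :
    ∫⁻ r in Set.Ico 0 (is.map fun i => w i - t.val (mk i)).sum,
        (trySplits tab t μ A B C m mk go is r >>= k).prob E =
      (is.map fun i => ENNReal.ofReal (w i - t.val (mk i)) *
        (go (mk i) (w i) >>= k).prob E).sum := by
  induction is with
  | nil => simp
  | cons i is ih =>
    rw [List.map_cons, List.sum_cons, List.map_cons, List.sum_cons,
      ← ih (fun j hj => hw j (by simp [hj])) fun j hj => hd j (by simp [hj]),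
      ← lintegral_Ico_add (hd i (by simp)) (List.sum_nonneg ?_)]
    · refine lintegral_congr fun r => ?_
      rw [trySplits_cons tab t μ A B C m mk go (hw i (by simp))]
      simp only [tick_bind, prob_tick]
      split_ifs <;> rfl
    · intro x hx
      obtain ⟨j, hj, rfl⟩ := List.mem_map.1 hx
      exact hd j (by simp [hj])

end

variable (G : BGrammar T N) (A : N) (m : ℕ) (mk : IWord T N → IWord T N)
  (go : IWord T N → ℝ → Prog (Option β))

/-- The choice of an atomic derivation of the nonterminal `A` with prescribed length `m` in an
immature word of weight `μ`, with the random number `r`; `mk x` is the immature word after the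
replacement of the nonterminal by `x`, and `go` is what follows. -/
def branch (r : ℝ) : Prog (Option β) :=
  match G.rule A with
  | BRule.union B C => do
    let a ← Prog.mul μ ((tab B).getD m 0)
    let μ' ← Prog.div a ((tab A).getD m 0)
    let f' ← t.forb (mk [ISym.non B m])
    let d ← Prog.sub μ' f'
    let r' ← Prog.sub r d
    let neg ← Prog.less r' 0
    if neg then go (mk [ISym.non B m]) μ'
    else do
      let b ← Prog.mul μ ((tab C).getD m 0)
      let μ'' ← Prog.div b ((tab A).getD m 0)
      go (mk [ISym.non C m]) μ''
  | BRule.product B C =>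
    trySplits tab t μ A B C m (fun j => mk [ISym.non B j, ISym.non C (m - j)]) go
      (boustrophedon m) r
  | BRule.terminal a => go (mk [ISym.ter a]) μ
  | BRule.epsilon => pure none

/-- The table contains the weights of the languages of the nonterminals in use. -/
def IsTable [Fintype N] (wt : T → ℝ) (n : ℕ) : Prop :=
  ∀ A, G.Reaches G.start A → ∀ m ≤ n, (tab A).getD m 0 = langWeight wt (G.langLen A m)

variable {tab t μ G A m mk go}

theorem branch_union {B C : N} (hA : G.rule A = BRule.union B C) {w : IWord T N → ℝ}
    (hB : μ * (tab B).getD m 0 / (tab A).getD m 0 = w [ISym.non B m])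
    (hC : μ * (tab C).getD m 0 / (tab A).getD m 0 = w [ISym.non C m]) (r : ℝ) :
    branch tab t μ G A m mk go r = tick (tick (tick (tick (tick (tick (
      if r - (w [ISym.non B m] - t.val (mk [ISym.non B m])) < 0
      then go (mk [ISym.non B m]) (w [ISym.non B m])
      else tick (tick (go (mk [ISym.non C m]) (w [ISym.non C m]))))))))) := by
  simp [branch, hA, ← hB, ← hC]

open BGrammar

/-- κ is the weight of the symbols around the expanded one. The weights computed by the algorithm
remain products of symbol weights, as long as the weight divided by is not zero. -/
theorem weight_of_mem_childList [Fintype N] {wt : T → ℝ} {n : ℕ} (htab : IsTable tab G wt n)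
    (hr : G.Reaches G.start A) (hmn : m ≤ n) (hA0 : G.symWeight wt (ISym.non A m) ≠ 0) {κ : ℝ}
    (hμ : μ = κ * G.symWeight wt (ISym.non A m)) :
    (∀ B C, G.rule A = BRule.product B C → ∀ i ∈ boustrophedon m,
      μ * (tab B).getD i 0 * (tab C).getD (m - i) 0 / (tab A).getD m 0 =
        κ * G.iWeight wt [ISym.non B i, ISym.non C (m - i)]) ∧
    (∀ B, G.UnionDep A B → μ * (tab B).getD m 0 / (tab A).getD m 0 =
      κ * G.iWeight wt [ISym.non B m]) := by
  have hd : ∀ B, G.Dep A B → G.Reaches G.start B := fun B hB => Relation.ReflTransGen.tail hr hB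
  have hA' : (tab A).getD m 0 = G.symWeight wt (ISym.non A m) := htab A hr m hmn
  rw [hA', hμ]
  constructor
  · intro B C hA i hi
    rw [mem_boustrophedon] at hi
    rw [htab B (hd B (by simp [Dep, hA, BRule.operands])) i (by omega),
      htab C (hd C (by simp [Dep, hA, BRule.operands])) (m - i) (by omega)]
    rw [div_eq_iff hA0]
    simp only [iWeight, List.map_cons, List.map_nil, List.prod_cons, List.prod_nil]
    simp only [symWeight]
    ring
  · intro B hB
    rw [htab B (hd B ?_) m hmn, div_eq_iff hA0]
    · simp only [iWeight, List.map_cons, List.map_nil, List.prod_cons, List.prod_nil]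
      simp only [symWeight]
      ring
    · rcases hB with ⟨C, h | h⟩ <;> simp [Dep, h, BRule.operands]

/-- The 4 in the budget of `hgo` is for the operations that precede the choice: access to the tree,
comparison, subtraction and draw. -/
theorem branch_allRuns [Fintype N] {wt : T → ℝ} {n : ℕ} (hG : G.IsBCNF) (hU : G.TreeUnique G.start)
    (htab : IsTable tab G wt n) (hr : G.Reaches G.start A) (hmn : m ≤ n)
    (hA0 : G.symWeight wt (ISym.non A m) ≠ 0) {κ : ℝ}
    (hμ : μ = κ * G.symWeight wt (ISym.non A m)) {r : ℝ} (h0 : 0 ≤ r)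
    (hlt : r < ((G.childList A m).map fun x => κ * G.iWeight wt x - t.val (mk x)).sum)
    {Q : Option β → ℕ → Prop}
    (hgo : ∀ x ∈ G.childList A m, 0 < κ * G.iWeight wt x - t.val (mk x) →
      ∀ j : ℕ, (j : ℝ) + G.wordPot x + 4 ≤ G.symPot (ISym.non A m) →
      (go (mk x) (κ * G.iWeight wt x)).AllRuns fun a c => Q a (c + j)) :
    (branch tab t μ G A m mk go r).AllRuns Q := by
  obtain ⟨hprod, hunion⟩ := weight_of_mem_childList htab hr hmn hA0 hμ
  rcases hA : G.rule A with ⟨B, C⟩ | ⟨B, C⟩ | a | _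
  · simp only [childList, hA, List.map_map, Function.comp_def] at hlt hgo
    simp only [branch, hA]
    refine trySplits_allRuns tab t μ A B C m _ go
      (w := fun i => κ * G.iWeight wt [ISym.non B i, ISym.non C (m - i)])
      (hprod B C hA) h0 hlt fun j hj hpos => ?_
    refine hgo _ (List.mem_map.2 ⟨_, List.getElem_mem hj, rfl⟩) hpos _ ?_
    have hmem := mem_boustrophedon.1 (List.getElem_mem hj)
    have h1 := wordPot_product hG hU hr hA hmem.1 hmem.2
    have h2 : ((j + 1 : ℕ) : ℝ) ≤ (2 * min (boustrophedon m)[j] (m - (boustrophedon m)[j]) : ℕ) :=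
      by exact_mod_cast boustrophedon_index hj
    push_cast at h1 h2 ⊢
    linarith
  · simp only [childList, hA, List.map_cons, List.map_nil, List.sum_cons, List.sum_nil] at hlt hgo
    have hBu : G.UnionDep A B := ⟨C, Or.inl hA⟩
    have hCu : G.UnionDep A C := ⟨B, Or.inr hA⟩
    rw [branch_union hA (w := fun x => κ * G.iWeight wt x) (hunion B hBu) (hunion C hCu)]
    simp only [allRuns_tick]
    split_ifs with h
    · refine hgo _ (by simp) (by linarith) 6 ?_
      have := wordPot_union (m := m) hG hU hr hBu
      push_cast
      linarith
    -- The second share is positive because `r` is at least the first share and below the sum of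
    -- both.
    · refine hgo _ (by simp) (by linarith) 8 ?_
      have := wordPot_union (m := m) hG hU hr hCu
      push_cast
      linarith
  · simp only [childList, hA] at hlt hgo
    simp only [branch, hA]
    split_ifs at hlt hgo with hm
    · have e : κ * G.iWeight wt [ISym.ter a] = μ := by
        subst hm
        rw [hμ, symWeight_eq_sum wt hG (hU.reaches hG hr) one_pos]
        simp [childList, hA]
      simp only [List.map_cons, List.map_nil, List.sum_cons, List.sum_nil, add_zero] at hlt
      have := hgo _ (by simp) (h0.trans_lt hlt) 0 ?_
      · rwa [e] at this
      · have h1 := Real.log_pos one_lt_two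
        have h2 : 0 ≤ Real.log m := Real.log_natCast_nonneg m
        have h3 : 0 ≤ 14 / Real.log 2 * (m * Real.log m) := by positivity
        have h4 : (0 : ℝ) ≤ ((2 * m - 2) * Fintype.card N + G.height A : ℕ) := by positivity
        simp only [wordPot, List.map_cons, List.map_nil, List.sum_cons, List.sum_nil, symPot,
          symMeasure]
        push_cast at h4 ⊢
        linarith
    · simp at hlt; linarith
  · simp [childList, hA] at hlt; linarith

/-- Integrated over the range of `r`, each child is weighted by its share. A missing child, as for a
terminal with a length other than 1, corresponds to an interval of length 0. -/
theorem branch_prob [Fintype N] {wt : T → ℝ} {n : ℕ} (hG : G.IsBCNF) (hU : G.TreeUnique G.start)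
    (htab : IsTable tab G wt n) (hr : G.Reaches G.start A) (hmn : m ≤ n)
    (hA0 : G.symWeight wt (ISym.non A m) ≠ 0) {κ : ℝ}
    (hμ : μ = κ * G.symWeight wt (ISym.non A m))
    (hd : ∀ x ∈ G.childList A m, 0 ≤ κ * G.iWeight wt x - t.val (mk x))
    {γ : Type} (k : Option β → Prog γ) (E : Set γ) :
    ∫⁻ r in Set.Ico 0 ((G.childList A m).map fun x => κ * G.iWeight wt x - t.val (mk x)).sum,
        (branch tab t μ G A m mk go r >>= k).prob E =
      ((G.childList A m).map fun x => ENNReal.ofReal (κ * G.iWeight wt x - t.val (mk x)) *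
        (go (mk x) (κ * G.iWeight wt x) >>= k).prob E).sum := by
  obtain ⟨hprod, hunion⟩ := weight_of_mem_childList htab hr hmn hA0 hμ
  rcases hA : G.rule A with ⟨B, C⟩ | ⟨B, C⟩ | a | _
  · simp only [childList, hA, List.map_map, Function.comp_def] at hd ⊢
    simp only [branch, hA]
    exact trySplits_prob tab t μ A B C m (fun j => mk [ISym.non B j, ISym.non C (m - j)]) go
      (w := fun i => κ * G.iWeight wt [ISym.non B i, ISym.non C (m - i)]) k E
      (hprod B C hA) fun i hi => hd _ (List.mem_map.2 ⟨i, hi, rfl⟩)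
  · have hBu : G.UnionDep A B := ⟨C, Or.inl hA⟩
    have hCu : G.UnionDep A C := ⟨B, Or.inr hA⟩
    simp only [childList, hA] at hd ⊢
    simp only [List.map_cons, List.map_nil, List.sum_cons, List.sum_nil, add_zero]
    rw [lintegral_congr (g := fun r => if r - (κ * G.iWeight wt [ISym.non B m] -
        t.val (mk [ISym.non B m])) < 0
      then (go (mk [ISym.non B m]) (κ * G.iWeight wt [ISym.non B m]) >>= k).prob E
      else (go (mk [ISym.non C m]) (κ * G.iWeight wt [ISym.non C m]) >>= k).prob E),
      lintegral_Ico_add (hd _ (by simp)) (hd _ (by simp)) _ fun _ =>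
        (go (mk [ISym.non C m]) (κ * G.iWeight wt [ISym.non C m]) >>= k).prob E,
      setLIntegral_const, Real.volume_Ico, sub_zero]
    · congr 1
      exact mul_comm _ _
    · intro r
      rw [branch_union hA (w := fun x => κ * G.iWeight wt x) (hunion B hBu) (hunion C hCu)]
      simp only [tick_bind, prob_tick]
      split_ifs <;> rfl
  · simp only [childList, hA, branch]
    split_ifs with hm
    · have e : κ * G.iWeight wt [ISym.ter a] = μ := by
        subst hm
        rw [hμ, symWeight_eq_sum wt hG (hU.reaches hG hr) one_pos]
        simp [childList, hA]
      simp [e, mul_comm]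
    · simp
  · simp [childList, hA]

end

/-! ### Correctness, cost and distribution of a single draw -/

noncomputable section
open Prog BGrammar

section

variable {T N : Type} [Fintype N] {G : BGrammar T N} {φ : Policy T N} {n : ℕ} {wt : T → ℝ}
  {F : Finset (List T)} {t : WTree T N} {tab : N → List ℝ}

theorem wordWeight_pos (hwt : ∀ a, 0 < wt a) (w : List T) : 0 < wordWeight wt w := by
  refine List.prod_pos ?_
  simp only [List.mem_map]
  rintro _ ⟨a, -, rfl⟩
  exact hwt a

open Classical in
/-- The weight of an immature word without the forbidden words. -/
theorem WTree.Inv.gap_eq (h : t.Inv G φ n wt F) (hG : G.IsBCNF) (hU : G.TreeUnique G.start)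
    (hn : 0 < n) {ω : IWord T N} (hω : G.Reach φ n ω) :
    G.iWeight wt ω - t.val ω = ∑ w ∈ hG.derived φ n ω with w ∉ F, wordWeight wt w := by
  rw [h.val_eq hω, hG.iWeight_eq_sum wt hU hn hω, sub_eq_iff_eq_add,
    ← Finset.sum_filter_add_sum_filter_not _ (fun w => w ∉ F)]
  congr 1
  refine Finset.sum_congr ?_ fun _ _ => rfl
  ext w
  simp only [Finset.mem_filter, not_not, hG.mem_derived hω, and_comm]

theorem WTree.Inv.gap_nonneg (h : t.Inv G φ n wt F) (hG : G.IsBCNF) (hU : G.TreeUnique G.start)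
    (hn : 0 < n) (hwt : ∀ a, 0 < wt a) {ω : IWord T N} (hω : G.Reach φ n ω) :
    0 ≤ G.iWeight wt ω - t.val ω := by
  rw [h.gap_eq hG hU hn hω]
  exact Finset.sum_nonneg fun w _ => (wordWeight_pos hwt w).le

theorem WTree.Inv.val_nonneg (h : t.Inv G φ n wt F) (hwt : ∀ a, 0 < wt a) {ω : IWord T N}
    (hω : G.Reach φ n ω) : 0 ≤ t.val ω := by
  rw [h.val_eq hω]
  exact Finset.sum_nonneg fun w _ => (wordWeight_pos hwt w).le

/-- The shares of the children tile the interval from which `r` is drawn. Hence the search for a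
child never runs off the end of the list. -/
theorem WTree.Inv.sum_gap (h : t.Inv G φ n wt F) (hG : G.IsBCNF) (hU : G.TreeUnique G.start)
    (hn : 0 < n) {ω₁ ω₂ : IWord T N} {A : N} {m : ℕ}
    (hω : G.Reach φ n (ω₁ ++ ISym.non A m :: ω₂))
    (hp : φ.pos (ω₁ ++ ISym.non A m :: ω₂) = some ω₁.length) :
    ((G.childList A m).map fun x => G.iWeight wt ω₁ * G.iWeight wt ω₂ * G.iWeight wt x -
      t.val (ω₁ ++ x ++ ω₂)).sum =
      G.iWeight wt (ω₁ ++ ISym.non A m :: ω₂) - t.val (ω₁ ++ ISym.non A m :: ω₂) := by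
  obtain ⟨-, hm, -⟩ := hω.good hn A m (by simp)
  rw [h.gap_eq hG hU hn hω, Finset.sum_filter, hG.sum_derived hU hω hp hm]
  refine congrArg List.sum (List.map_congr_left fun x hx => ?_)
  rw [← Finset.sum_filter, ← h.gap_eq hG hU hn (hω.step ((step_split_iff hp hm).2 ⟨x, hx, rfl⟩)),
    iWeight_append, iWeight_append]
  ring

omit [Fintype N] in
theorem stepByStep_split {ω₁ ω₂ : IWord T N} {A : N} {m : ℕ}
    (hp : φ.pos (ω₁ ++ ISym.non A m :: ω₂) = some ω₁.length) {μ : ℝ}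
    (hlt : t.val (ω₁ ++ ISym.non A m :: ω₂) < μ) (depth : ℕ) :
    stepByStep G φ tab t (depth + 1) (ω₁ ++ ISym.non A m :: ω₂) μ =
      tick (tick (tick (draw (μ - t.val (ω₁ ++ ISym.non A m :: ω₂)) fun r =>
        branch tab t μ G A m (fun x => ω₁ ++ x ++ ω₂) (fun ω' μ' =>
          stepByStep G φ tab t depth ω' μ' >>= fun res => pure (res.map fun q =>
            ((ω₁ ++ ISym.non A m :: ω₂) :: q.1, q.2))) r))) := by
  have : (ω₁ ++ ISym.non A m :: ω₂)[ω₁.length]? = some (ISym.non A m) := by simp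
  simp only [stepByStep, WTree.forb_bind, less_bind, hlt, decide_true, if_true, hp, this, sub_bind,
    rand_bind, IWord.replace_split]
  rfl

omit [Fintype N] in
theorem stepByStep_mature {ω : IWord T N} (hp : φ.pos ω = none) {μ : ℝ} (hlt : t.val ω < μ)
    (depth : ℕ) :
    stepByStep G φ tab t (depth + 1) ω μ = tick (tick (pure (some ([ω], μ)))) := by
  simp only [stepByStep, WTree.forb_bind, less_bind, hlt, decide_true, if_true, hp]

omit [Fintype N] in
theorem isPath_of_pos_none {ω : IWord T N} (hp : φ.pos ω = none) :
    G.IsPath φ ω ω.letters [ω] := by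
  have := isPath_singleton (G := G) (φ := φ) ω.letters
  rwa [← φ.eq_map_ter hp] at this

theorem iWeight_split {ω₁ ω₂ : IWord T N} {A : N} {m : ℕ} :
    G.iWeight wt (ω₁ ++ ISym.non A m :: ω₂) =
      G.iWeight wt ω₁ * G.iWeight wt ω₂ * G.symWeight wt (ISym.non A m) := by
  rw [iWeight_append]
  simp only [iWeight, List.map_cons, List.prod_cons]
  ring

/-- Every run of the step-by-step algorithm that starts with an immature word of which some word is
not forbidden ends with the parse walk of such a word. -/
theorem stepByStep_allRuns (hG : G.IsBCNF) (hU : G.TreeUnique G.start) (hn : 0 < n)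
    (hwt : ∀ a, 0 < wt a) (htab : IsTable tab G wt n) (h : t.Inv G φ n wt F) {depth : ℕ}
    {ω : IWord T N} (hω : G.Reach φ n ω) (hdepth : G.wordMeasure ω < depth)
    (hpos : 0 < G.iWeight wt ω - t.val ω) :
    (stepByStep G φ tab t depth ω (G.iWeight wt ω)).AllRuns fun res c => ∃ p w,
      res = some (p, wordWeight wt w) ∧ G.IsPath φ ω w p ∧ w ∉ F ∧ (c : ℝ) ≤ G.wordPot ω + 2 := by
  induction depth generalizing ω with
  | zero => omega
  | succ depth ih =>
    rcases hp : φ.pos ω with _ | i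
    · rw [stepByStep_mature hp (by linarith)]
      simp only [allRuns_tick, allRuns_pure]
      refine ⟨[ω], ω.letters, ?_, isPath_of_pos_none hp, ?_, ?_⟩
      · rw [← iWeight_map_ter (G := G), ← φ.eq_map_ter hp]
      · intro hF
        rw [h.gap_eq hG hU hn hω, hG.derived_of_pos_none hω hp, Finset.filter_singleton,
          if_neg (not_not.2 hF)] at hpos
        simp at hpos
      · have := G.wordPot_nonneg ω
        push_cast
        linarith
    · obtain ⟨ω₁, A, m, ω₂, rfl, rfl⟩ := φ.exists_split hp
      obtain ⟨hA, hm, hmn⟩ := hω.good hn A m (by simp)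
      have hv := h.val_nonneg hwt hω
      -- If this factor were zero the whole weight would be, and a nonnegative stored number would
      -- leave no positive difference.
      have hA0 : G.symWeight wt (ISym.non A m) ≠ 0 := by
        intro h0
        rw [iWeight_split, h0] at hpos
        linarith
      rw [stepByStep_split hp (by linarith)]
      simp only [allRuns_tick, allRuns_draw]
      refine ⟨hpos, fun r h0 hr => ?_⟩
      rw [← h.sum_gap hG hU hn hω hp] at hr
      refine branch_allRuns hG hU htab hA hmn hA0 iWeight_split h0 hr fun x hx hxpos j hj => ?_
      have hs : G.Step φ (ω₁ ++ ISym.non A m :: ω₂) (ω₁ ++ x ++ ω₂) :=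
        (step_split_iff hp hm).2 ⟨x, hx, rfl⟩
      have hw : G.iWeight wt ω₁ * G.iWeight wt ω₂ * G.iWeight wt x =
          G.iWeight wt (ω₁ ++ x ++ ω₂) := by
        rw [iWeight_append, iWeight_append]
        ring
      rw [hw] at hxpos ⊢
      refine (ih (hω.step hs) ?_ hxpos).bind ?_
      · have := wordMeasure_step hG hU (hω.good hn) hs
        omega
      · rintro _ c ⟨p, w, rfl, hpath, hwF, hc⟩
        refine ⟨_, w, rfl, hpath.cons hs, hwF, ?_⟩
        simp only [wordPot, List.map_append, List.sum_append, List.map_cons, List.sum_cons] at hc hj ⊢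
        push_cast
        linarith

open Classical in
-- `Φ w` is the probability of the event once `w` has been drawn, whatever path led to it.
-- Multiplying by the allowed weight avoids division, so that the identity also holds at nodes whose
-- words are all forbidden and is additive over children.
theorem stepByStep_prob (hG : G.IsBCNF) (hU : G.TreeUnique G.start) (hn : 0 < n)
    (hwt : ∀ a, 0 < wt a) (htab : IsTable tab G wt n) (h : t.Inv G φ n wt F) {depth : ℕ}
    {ω : IWord T N} (hω : G.Reach φ n ω) (hdepth : G.wordMeasure ω < depth) {γ : Type}
    (k : Option (List (IWord T N) × ℝ) → Prog γ) (E : Set γ) (Φ : List T → ENNReal)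
    (hk : ∀ w ∉ F, ∀ p, G.IsPath φ ω w p → (k (some (p, wordWeight wt w))).prob E = Φ w) :
    ENNReal.ofReal (G.iWeight wt ω - t.val ω) *
        (stepByStep G φ tab t depth ω (G.iWeight wt ω) >>= k).prob E =
      ∑ w ∈ hG.derived φ n ω with w ∉ F, ENNReal.ofReal (wordWeight wt w) * Φ w := by
  induction depth generalizing ω k with
  | zero => omega
  | succ depth ih =>
    -- If the allowed weight is zero, no allowed word is below `ω`, as all weights are positive, and
    -- both sides vanish.
    rcases (h.gap_nonneg hG hU hn hwt hω).eq_or_lt with hpos | hpos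
    · rw [← hpos, ENNReal.ofReal_zero, zero_mul]
      rw [h.gap_eq hG hU hn hω, eq_comm,
        Finset.sum_eq_zero_iff_of_nonneg fun w _ => (wordWeight_pos hwt w).le] at hpos
      exact (Finset.sum_eq_zero fun w hw => absurd (hpos w hw) (wordWeight_pos hwt w).ne').symm
    rcases hp : φ.pos ω with _ | i
    · rw [stepByStep_mature hp (by linarith)]
      have hF : ω.letters ∉ F := by
        intro hF
        rw [h.gap_eq hG hU hn hω, hG.derived_of_pos_none hω hp, Finset.filter_singleton,
          if_neg (not_not.2 hF)] at hpos
        simp at hpos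
      have hw : G.iWeight wt ω = wordWeight wt ω.letters := by
        rw [← iWeight_map_ter (G := G), ← φ.eq_map_ter hp]
      rw [h.gap_eq hG hU hn hω, hG.derived_of_pos_none hω hp, Finset.filter_singleton, if_pos hF,
        Finset.sum_singleton, Finset.sum_singleton, hw]
      exact congrArg _ (hk _ hF _ (isPath_of_pos_none hp))
    · obtain ⟨ω₁, A, m, ω₂, rfl, rfl⟩ := φ.exists_split hp
      obtain ⟨hA, hm, hmn⟩ := hω.good hn A m (by simp)
      have hv := h.val_nonneg hwt hω
      have hA0 : G.symWeight wt (ISym.non A m) ≠ 0 := by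
        intro h0
        rw [iWeight_split, h0] at hpos
        linarith
      have hs : ∀ x ∈ G.childList A m, G.Step φ (ω₁ ++ ISym.non A m :: ω₂) (ω₁ ++ x ++ ω₂) :=
        fun x hx => (step_split_iff hp hm).2 ⟨x, hx, rfl⟩
      have hw : ∀ x, G.iWeight wt ω₁ * G.iWeight wt ω₂ * G.iWeight wt x =
          G.iWeight wt (ω₁ ++ x ++ ω₂) := by
        intro x
        rw [iWeight_append, iWeight_append]
        ring
      rw [stepByStep_split hp (by linarith)]
      simp only [tick_bind, prob_tick, draw_bind]
      -- The allowed weight is the length of the interval of the draw and cancels its normalization;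
      -- this is the telescoping along the walk.
      rw [prob, ← mul_assoc, ENNReal.mul_inv_cancel (by simpa using hpos) ENNReal.ofReal_ne_top,
        one_mul, ← h.sum_gap hG hU hn hω hp, branch_prob hG hU htab hA hmn hA0 iWeight_split,
        Finset.sum_filter, hG.sum_derived hU hω hp hm]
      · refine congrArg List.sum (List.map_congr_left fun x hx => ?_)
        rw [hw, bind_assoc', ← Finset.sum_filter]
        refine ih (hω.step (hs x hx)) ?_ _ ?_
        · have := wordMeasure_step hG hU (hω.good hn) (hs x hx)
          omega
        · intro w hwF p hpath
          exact hk w hwF _ (hpath.cons (hs x hx))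
      · intro x hx
        rw [hw]
        exact h.gap_nonneg hG hU hn hwt (hω.step (hs x hx))

end

noncomputable section
open Prog BGrammar

/-! ## The generation of several words -/

section

variable {T N : Type} [Fintype N] {G : BGrammar T N} {φ : Policy T N} {n : ℕ} {wt : T → ℝ}

theorem BGrammar.IsPath.length_le (hG : G.IsBCNF) (hU : G.TreeUnique G.start) {ω : IWord T N}
    (hω : G.Good n ω) {w : List T} {p : List (IWord T N)} (h : G.IsPath φ ω w p) :
    p.length ≤ G.wordMeasure ω + 1 := by
  induction p generalizing ω with
  | nil => simp
  | cons v p ih =>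
    obtain rfl : v = ω := Option.some.inj h.1
    cases p with
    | nil => simp
    | cons u p =>
      obtain ⟨hs, hc⟩ := List.isChain_cons_cons.1 h.2.1
      have h1 := wordMeasure_step hG hU hω hs
      have h2 := ih (hω.step hs) ⟨rfl, hc, by simpa using h.2.2⟩
      rw [List.length_cons]
      omega

theorem BGrammar.wordMeasure_start (hG : G.IsBCNF) (hU : G.TreeUnique G.start) (hn : 0 < n) :
    G.wordMeasure [ISym.non G.start n] ≤ 2 * n * Fintype.card N := by
  have h1 := hU.height_lt_card hG
  obtain ⟨n, rfl⟩ := Nat.exists_eq_add_of_le hn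
  simp only [wordMeasure, List.map_cons, List.map_nil, List.sum_cons, List.sum_nil, symMeasure]
  rw [show 2 * (0 + 1 + n) - 2 = 2 * n by omega, show 2 * (0 + 1 + n) = 2 * n + 2 by omega, add_mul]
  omega

omit [Fintype N] in
theorem letters_getLastD {ω : IWord T N} {w : List T} {p : List (IWord T N)}
    (h : G.IsPath φ ω w p) : IWord.letters (p.getLastD []) = w := by
  rw [List.getLastD_eq_getLast?, h.2.2, Option.getD_some, IWord.letters_map_ter]

open Classical in
/-- The state of the algorithm between the generations of two words. -/
structure Output.Inv (G : BGrammar T N) (φ : Policy T N) (n : ℕ) (wt : T → ℝ) (o : Output T N) :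
    Prop where
  nodup : o.words.Nodup
  mem_words : ∀ w ∈ o.words, w ∈ G.words n
  isTable : IsTable o.table G wt n
  tree : o.tree.Inv G φ n wt o.words.toFinset

variable {o : Output T N}

theorem Output.Inv.step (hG : G.IsBCNF) (hU : G.TreeUnique G.start) (hn : 0 < n)
    (h : o.Inv G φ n wt) {w : List T} (hw : w ∉ o.words) {p : List (IWord T N)}
    (hp : G.IsPath φ [ISym.non G.start n] w p) :
    ∃ t c, c ≤ 2 * n * Fintype.card N + 2 ∧ t.mem.length ≤ o.tree.mem.length + 2 ∧
      Returns (o.tree.update G φ p (wordWeight wt w)) t c ∧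
      Output.Inv G φ n wt
        { words := o.words ++ [IWord.letters (p.getLastD [])], tree := t, table := o.table } := by
  classical
  have hw' : w ∉ o.words.toFinset := by simpa using hw
  obtain ⟨t, c, hc, hmem, hret, hinv⟩ := h.tree.update hG hU hn hw' hp
  have h1 := hp.length_le hG hU (Reach.good (φ := φ) hn Relation.ReflTransGen.refl)
  have h2 := wordMeasure_start hG hU hn
  refine ⟨t, c, by omega, hmem, hret, ?_⟩
  rw [letters_getLastD hp]
  refine ⟨?_, ?_, h.isTable, ?_⟩
  · exact List.nodup_append.2 ⟨h.nodup, by simp, by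
      rintro a ha b hb rfl
      exact hw (List.mem_singleton.1 hb ▸ ha)⟩
  · intro v hv
    rcases List.mem_append.1 hv with hv | hv
    · exact h.mem_words v hv
    · rw [List.mem_singleton.1 hv]
      exact (hG.mem_words_iff_der φ).2 hp.der
  · convert hinv using 1
    ext v
    simp

theorem Output.Inv.start_weight (h : o.Inv G φ n wt) :
    (o.table G.start).getD n 0 = G.iWeight wt [ISym.non G.start n] := by
  rw [h.isTable _ .refl n le_rfl]
  simp [iWeight, symWeight]

/-- What follows the generation of a word: the update of the tree and the generation of `k` more
words. -/
def generateNext (G : BGrammar T N) (φ : Policy T N) (n k : ℕ) (o : Output T N) :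
    Option (List (IWord T N) × ℝ) → Prog (Option (Output T N))
  | none => pure none
  | some (walk, μ) => do
    let t ← o.tree.update G φ walk μ
    generateLoop G φ n k
      { words := o.words ++ [IWord.letters (walk.getLastD [])]
        tree := t
        table := o.table }

theorem generateLoop_succ (h : o.Inv G φ n wt) (k : ℕ) :
    generateLoop G φ n (k + 1) o =
      (stepByStep G φ o.table o.tree (2 * n * Fintype.card N + 1) [ISym.non G.start n]
        (G.iWeight wt [ISym.non G.start n])) >>= generateNext G φ n k o := by
  rw [generateLoop, h.start_weight]
  congr 1

/-- With fewer words drawn than there are, one word is left, and it has positive weight. -/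
theorem Output.Inv.gap_pos (hG : G.IsBCNF) (hU : G.TreeUnique G.start) (hn : 0 < n)
    (hwt : ∀ a, 0 < wt a) (h : o.Inv G φ n wt) (hlt : o.words.length < (G.words n).ncard) :
    0 < G.iWeight wt [ISym.non G.start n] - o.tree.val [ISym.non G.start n] := by
  classical
  rw [h.tree.gap_eq hG hU hn .refl]
  obtain ⟨w, hw, hwF⟩ : ∃ w ∈ G.words n, w ∉ o.words := by
    by_contra! hcon
    have hsub : G.words n ⊆ (o.words.toFinset : Set (List T)) := fun w hw => by simpa using hcon w hw
    have := Set.ncard_le_ncard hsub (Finset.finite_toSet _)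
    rw [Set.ncard_coe_finset, List.toFinset_card_of_nodup h.nodup] at this
    omega
  refine Finset.sum_pos (fun w _ => wordWeight_pos hwt w) ⟨w, ?_⟩
  simp only [Finset.mem_filter, List.mem_toFinset, hwF, not_false_eq_true, and_true]
  exact (hG.mem_derived .refl).2 ((hG.mem_words_iff_der φ).1 hw)

/-- The prefix relation among the conclusions is needed for the distribution: words once drawn stay
in place. Two cells per word and the cost of one draw plus one update are added up. -/
theorem generateLoop_allRuns (hG : G.IsBCNF) (hU : G.TreeUnique G.start) (hn : 0 < n)
    (hwt : ∀ a, 0 < wt a) (h : o.Inv G φ n wt) {k : ℕ}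
    (hk : o.words.length + k ≤ (G.words n).ncard) :
    (generateLoop G φ n k o).AllRuns fun out c => ∃ o', out = some o' ∧ o'.Inv G φ n wt ∧
      o'.table = o.table ∧ o'.words.length = o.words.length + k ∧ o.words <+: o'.words ∧
      o'.tree.mem.length ≤ o.tree.mem.length + 2 * k ∧
      (c : ℝ) ≤ k * (G.wordPot [ISym.non G.start n] + 2 * n * Fintype.card N + 4) := by
  induction k generalizing o with
  | zero => exact ⟨o, rfl, h, rfl, rfl, List.prefix_rfl, le_rfl, by simp⟩
  | succ k ih =>
    rw [generateLoop_succ h]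
    refine (stepByStep_allRuns hG hU hn hwt h.isTable h.tree .refl
      (Nat.lt_succ_of_le (wordMeasure_start hG hU hn))
      (h.gap_pos hG hU hn hwt (by omega))).bind ?_
    rintro _ c ⟨p, w, rfl, hp, hwF, hc⟩
    obtain ⟨t, d, hd, hmem, hret, hinv⟩ := h.step hG hU hn (by simpa using hwF) hp
    rw [generateNext, hret.allRuns_bind]
    refine (ih hinv (by simpa [add_assoc, add_comm 1 k] using hk)).mono ?_
    rintro _ e ⟨o', rfl, h1, h2, h3, h4, h5, h6⟩
    refine ⟨o', rfl, h1, h2, ?_, ?_, ?_, ?_⟩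
    · rw [h3, List.length_append, List.length_singleton]
      omega
    · exact (List.prefix_append _ _).trans h4
    · simp only at h5
      omega
    · have : (d : ℝ) ≤ 2 * n * Fintype.card N + 2 := by exact_mod_cast hd
      push_cast
      linarith

theorem Fin.sum_Iio_succ {k : ℕ} (f : Fin (k + 1) → ℝ) (i : Fin k) :
    ∑ j ∈ Finset.Iio i.succ, f j = f 0 + ∑ j ∈ Finset.Iio i, f j.succ := by
  have e : ∀ {k : ℕ} (f : Fin k → ℝ) (i : Fin k),
      ∑ j ∈ Finset.Iio i, f j = ∑ j, if j < i then f j else 0 := by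
    intro k f i
    rw [← Finset.sum_filter]
    congr 1
    ext j
    simp
  rw [e, e, Fin.sum_univ_succ]
  simp [Fin.succ_lt_succ_iff]

open Classical in
-- Induction on the number of draws still to be made: the sum in `stepByStep_prob` has a single
-- nonzero term, that of `σ 0`, with factor weight over allowed weight, and the remaining draws
-- start from a state with one more forbidden word.
theorem generateLoop_prob (hG : G.IsBCNF) (hU : G.TreeUnique G.start) (hn : 0 < n)
    (hwt : ∀ a, 0 < wt a) (h : o.Inv G φ n wt) {k : ℕ}
    (hk : o.words.length + k ≤ (G.words n).ncard) (σ : Fin k → List T)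
    (hσ : Function.Injective σ) (hσn : ∀ i, σ i ∈ G.words n) (hσo : ∀ i, σ i ∉ o.words) :
    (generateLoop G φ n k o).prob {out | ∃ o', out = some o' ∧ o'.words = o.words ++ List.ofFn σ} =
      ENNReal.ofReal (∏ i, wordWeight wt (σ i) /
        (G.iWeight wt [ISym.non G.start n] - (o.words.map (wordWeight wt)).sum -
          ∑ j ∈ Finset.Iio i, wordWeight wt (σ j))) := by
  induction k generalizing o with
  | zero =>
    rw [Fin.prod_univ_zero, ENNReal.ofReal_one]
    exact if_pos ⟨o, rfl, by simp⟩
  | succ k ih =>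
    rw [generateLoop_succ h]
    have hgap := h.gap_pos hG hU hn hwt (by omega)
    -- All drawn words lie below the root, so the root stores their total weight, the quantity
    -- subtracted in the denominators.
    have hval : o.tree.val [ISym.non G.start n] = (o.words.map (wordWeight wt)).sum := by
      rw [h.tree.val_eq .refl, Finset.filter_true_of_mem, List.sum_toFinset _ h.nodup]
      exact fun w hw => (hG.mem_words_iff_der φ).1 (h.mem_words w (by simpa using hw))
    have key := stepByStep_prob hG hU hn hwt h.isTable h.tree (φ := φ) .refl
      (Nat.lt_succ_of_le (wordMeasure_start hG hU hn)) (generateNext G φ n k o)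
      {out | ∃ o', out = some o' ∧ o'.words = o.words ++ List.ofFn σ}
      (fun w => if w = σ 0 then ENNReal.ofReal (∏ i : Fin k, wordWeight wt (σ i.succ) /
        (G.iWeight wt [ISym.non G.start n] - (o.words.map (wordWeight wt)).sum -
          ∑ j ∈ Finset.Iio i.succ, wordWeight wt (σ j))) else 0) ?_
    · simp only [mul_ite, mul_zero, Finset.sum_ite_eq'] at key
      rw [if_pos] at key
      · rw [Fin.prod_univ_succ, show Finset.Iio (0 : Fin (k + 1)) = ∅ from Finset.Iio_bot,
          Finset.sum_empty, sub_zero, ← hval, div_mul_eq_mul_div, ENNReal.ofReal_div_of_pos hgap,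
          ENNReal.ofReal_mul (wordWeight_pos hwt _).le, hval]
        rw [hval] at key hgap
        exact (ENNReal.eq_div_iff (by simpa using hgap) ENNReal.ofReal_ne_top).2 key
      · simp only [Finset.mem_filter, List.mem_toFinset, hσo 0, not_false_eq_true, and_true]
        exact (hG.mem_derived .refl).2 ((hG.mem_words_iff_der φ).1 (hσn 0))
    · intro w hwF p hp
      obtain ⟨t, d, hd, hmem, hret, hinv⟩ := h.step hG hU hn (by simpa using hwF) hp
      have hk' : (o.words ++ [IWord.letters (p.getLastD [])]).length + k ≤ (G.words n).ncard := by
        simpa [add_assoc, add_comm 1 k] using hk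
      rw [generateNext, hret.prob_bind]
      have hw := letters_getLastD hp
      split_ifs with hw0
      · have := ih hinv hk' (fun i => σ i.succ) (fun i j hij => Fin.succ_injective _ (hσ hij))
          (fun i => hσn _) ?_
        · simp only [hw, hw0, List.append_assoc, List.singleton_append] at this ⊢
          rw [List.ofFn_succ]
          refine this.trans (congrArg _ (Finset.prod_congr rfl fun i _ => ?_))
          rw [Fin.sum_Iio_succ]
          simp only [List.map_append, List.sum_append, List.map_cons, List.map_nil, List.sum_cons,
            List.sum_nil]
          ring
        · intro i hi
          rw [hw, hw0, List.mem_append, List.mem_singleton] at hi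
          rcases hi with hi | hi
          · exact hσo _ hi
          · exact Fin.succ_ne_zero i (hσ hi)
      -- With another first word, the prefix relation contradicts the required list of outputs.
      · refine prob_eq_zero ((generateLoop_allRuns hG hU hn hwt hinv hk').mono ?_)
        rintro _ c ⟨o', rfl, -, -, -, hpre, -⟩ ⟨o'', ho, hwords⟩
        obtain rfl := Option.some.inj ho
        rw [hwords, hw, List.ofFn_succ, List.prefix_append_right_inj] at hpre
        exact hw0 (by simpa using hpre)

end

noncomputable section
open Prog BGrammar

/-! ## The nodes of the tree, and the bounds -/

section

variable {T N : Type} {G : BGrammar T N} {φ : Policy T N} {n : ℕ}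

/-- A walk starts without letters and gains at most one per step, so it has at least n + 1 nodes for
a word of length n. -/
theorem BGrammar.length_letters_step {ω ω' : IWord T N} (h : G.Step φ ω ω') :
    ω'.letters.length ≤ ω.letters.length + 1 := by
  obtain ⟨ω₁, A, m, ω₂, x, rfl, -, hx, rfl⟩ := step_iff.1 h
  have hx1 : (IWord.letters x).length ≤ 1 := by
    simp only [Expands] at hx
    split at hx
    · obtain ⟨i, -, -, rfl⟩ := hx
      simp [IWord.letters]
    · rcases hx with rfl | rfl <;> simp [IWord.letters]
    · obtain ⟨-, rfl⟩ := hx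
      simp [IWord.letters]
    · obtain ⟨-, rfl⟩ := hx
      simp [IWord.letters]
  simp only [IWord.letters, List.filterMap_append, List.length_append, List.filterMap_cons] at hx1 ⊢
  omega

theorem BGrammar.IsPath.le_length {ω : IWord T N} {w : List T} {p : List (IWord T N)}
    (h : G.IsPath φ ω w p) : w.length + 1 ≤ ω.letters.length + p.length := by
  induction p generalizing ω with
  | nil => simp [IsPath] at h
  | cons v p ih =>
    obtain rfl : v = ω := Option.some.inj h.1
    cases p with
    | nil =>
      obtain rfl : v = w.map ISym.ter := Option.some.inj h.2.2
      simp [IWord.letters_map_ter]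
    | cons u p =>
      obtain ⟨hs, hc⟩ := List.isChain_cons_cons.1 h.2.1
      have h1 := length_letters_step hs
      have h2 := ih ⟨rfl, hc, by simpa using h.2.2⟩
      rw [List.length_cons]
      omega

variable [Fintype N]

/-- The immature words on the parse walk of a word. -/
theorem BGrammar.IsBCNF.exists_finset_walk (hG : G.IsBCNF) (hU : G.TreeUnique G.start) (hn : 0 < n)
    {w : List T} (hw : w ∈ G.words n) :
    ∃ S : Finset (IWord T N), (∀ v, v ∈ S ↔ G.Reach φ n v ∧ G.Der φ v w) ∧ n + 1 ≤ S.card ∧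
      S.card ≤ 2 * n * Fintype.card N + 1 := by
  classical
  obtain ⟨p, hp⟩ := ((hG.mem_words_iff_der φ).1 hw).exists_isPath
  have hgood := Reach.good (φ := φ) hn (G := G) Relation.ReflTransGen.refl
  have hnodup : p.Nodup := by
    refine List.Pairwise.imp_of_mem ?_ hp.pairwise
    rintro u v hu hv h rfl
    exact lt_irrefl _ (wordMeasure_transGen hG hU (Reach.good hn (hp.mem hu).1) h).2
  refine ⟨p.toFinset, fun v => by rw [List.mem_toFinset, hp.mem_iff hG hU], ?_, ?_⟩
  · rw [List.toFinset_card_of_nodup hnodup]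
    have := hp.le_length
    rw [hw.2] at this
    simpa [IWord.letters] using this
  · rw [List.toFinset_card_of_nodup hnodup]
    exact (hp.length_le hG hU hgood).trans (Nat.succ_le_succ (wordMeasure_start hG hU hn))

variable {wt : T → ℝ} {F : Finset (List T)} {t : WTree T N}

/-- The tree is covered by the walks of the words in `F`, each of bounded length. -/
theorem WTree.Inv.card_nodes_le (h : t.Inv G φ n wt F) (hG : G.IsBCNF) (hU : G.TreeUnique G.start)
    (hn : 0 < n) (hF : ∀ w ∈ F, w ∈ G.words n) :
    t.nodes.card ≤ F.card * (2 * n * Fintype.card N + 1) := by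
  classical
  choose S hS _ hcard using fun w : F => hG.exists_finset_walk (φ := φ) hU hn (hF w w.2)
  have hsub : t.nodes ⊆ F.attach.biUnion S := by
    intro v hv
    obtain ⟨hr, w, hw, hd⟩ := (h.mem_nodes v).1 hv
    exact Finset.mem_biUnion.2 ⟨⟨w, hw⟩, Finset.mem_attach _ _, (hS _ v).2 ⟨hr, hd⟩⟩
  refine (Finset.card_le_card hsub).trans (Finset.card_biUnion_le_card_mul _ _ _ fun w _ => hcard w)
    |>.trans ?_
  rw [Finset.card_attach]

/-- At least n nodes of a single walk are not its last one, and these are not mature; the mature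
words of `F` are |F| further nodes. -/
theorem WTree.Inv.le_card_nodes (h : t.Inv G φ n wt F) (hG : G.IsBCNF) (hU : G.TreeUnique G.start)
    (hn : 0 < n) (hF : ∀ w ∈ F, w ∈ G.words n) (hne : F.Nonempty) : n + F.card ≤ t.nodes.card := by
  classical
  obtain ⟨w, hw⟩ := hne
  obtain ⟨S, hS, hcard, -⟩ := hG.exists_finset_walk (φ := φ) hU hn (hF w hw)
  have hmat : ∀ v : List T, φ.pos (v.map ISym.ter) = none := φ.pos_map_ter
  have hinj : Function.Injective fun v : List T => (v.map ISym.ter : IWord T N) :=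
    fun _ _ h => ISym.map_ter_injective h
  have hdisj : Disjoint (S.erase (w.map ISym.ter)) (F.image fun v => (v.map ISym.ter : IWord T N)) := by
    rw [Finset.disjoint_left]
    rintro v hv hv'
    obtain ⟨u, -, rfl⟩ := Finset.mem_image.1 hv'
    obtain ⟨hne, hvS⟩ := Finset.mem_erase.1 hv
    exact hne ((der_of_pos_none (hmat u)).1 ((hS _).1 hvS).2)
  have hsub : S.erase (w.map ISym.ter) ∪ F.image (fun v => (v.map ISym.ter : IWord T N)) ⊆
      t.nodes := by
    refine Finset.union_subset (fun v hv => ?_) fun v hv => ?_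
    · obtain ⟨hr, hd⟩ := (hS v).1 (Finset.mem_of_mem_erase hv)
      exact (h.mem_nodes v).2 ⟨hr, w, hw, hd⟩
    · obtain ⟨u, hu, rfl⟩ := Finset.mem_image.1 hv
      exact (h.mem_nodes _).2 ⟨(hG.mem_words_iff_der φ).1 (hF u hu), u, hu, .refl⟩
  have h1 := Finset.card_le_card hsub
  have h2 := Finset.pred_card_le_card_erase (s := S) (a := w.map ISym.ter)
  rw [Finset.card_union_of_disjoint hdisj, Finset.card_image_of_injective _ hinj] at h1
  omega

theorem BGrammar.Computes.isTable {R : N → Recurrence} (hR : G.Computes wt R) {tab : N → List ℝ}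
    (htab : ∀ A, ∃ d, Returns ((R A).fill (n + 1)) (tab A) d) : IsTable tab G wt n := by
  intro A hA m hm
  obtain ⟨d, hd⟩ := htab A
  rw [(hd.allRuns _).1 (hR A hA (n + 1))]
  rw [List.getD_eq_getElem _ _ (by simpa using Nat.lt_succ_of_le hm)]
  simp

/-- The state of the algorithm after the precomputation. -/
theorem generate_eq {R : N → Recurrence} (hR : G.Computes wt R) (φ : Policy T N) :
    ∃ (o : Output T N) (c : ℕ), o.words = [] ∧ o.tree = WTree.empty ∧ o.Inv G φ n wt ∧
      (∀ A, (o.table A).length = n + 1) ∧ c ≤ (n + 1) * ∑ A, (R A).termCost ∧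
      (∀ k Q, (generate G R φ n k).AllRuns Q ↔
        (generateLoop G φ n k o).AllRuns fun a d => Q a (c + d)) ∧
      ∀ k E, (generate G R φ n k).prob E = (generateLoop G φ n k o).prob E := by
  classical
  obtain ⟨tab, c, hc, htab, hret⟩ := returns_precompute R n Finset.univ.toList
  refine ⟨{ words := [], tree := WTree.empty, table := tab }, c, rfl, rfl, ?_,
    fun A => (htab A (by simp)).1, by rwa [← Finset.sum_map_toList], fun k Q => hret.allRuns_bind _ _,
    fun k E => hret.prob_bind _ _⟩
  exact ⟨List.nodup_nil, by simp, hR.isTable fun A => (htab A (by simp)).2, by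
    simpa using WTree.inv_empty⟩

end

/-! ### Explicit constants, and the proof of the bounds -/

section

variable {T N : Type} [Fintype N] {G : BGrammar T N} {n : ℕ}

theorem wordPot_start_le (hG : G.IsBCNF) (hU : G.TreeUnique G.start) (hn : 0 < n) :
    G.wordPot [ISym.non G.start n] ≤
      24 * n * Fintype.card N + 14 / Real.log 2 * (n * Real.log n) := by
  have := wordMeasure_start hG hU hn
  simp only [wordMeasure, wordPot, List.map_cons, List.map_nil, List.sum_cons, List.sum_nil,
    add_zero, symPot] at this ⊢
  have : (G.symMeasure (ISym.non G.start n) : ℝ) ≤ 2 * n * Fintype.card N := by exact_mod_cast this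
  linarith

/-- The number of operations for one word, for words of length at least two. -/
theorem cost_le (hG : G.IsBCNF) (hU : G.TreeUnique G.start) (hn : 2 ≤ n) :
    G.wordPot [ISym.non G.start n] + 2 * n * Fintype.card N + 4 ≤
      (26 * Fintype.card N + 18) / Real.log 2 * (n * Real.log n) := by
  have h1 := wordPot_start_le hG hU (show 0 < n by omega)
  have hl := Real.log_pos one_lt_two
  have hn' : (2 : ℝ) ≤ n := by exact_mod_cast hn
  have h2 : Real.log 2 ≤ Real.log n := Real.log_le_log (by norm_num) hn'
  have h3 : (26 * Fintype.card N + 4 : ℝ) * (n * Real.log 2) ≤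
      (26 * Fintype.card N + 4) * (n * Real.log n) := by gcongr
  have h4 : (26 * Fintype.card N + 4 : ℝ) * n ≤
      (26 * Fintype.card N + 4) / Real.log 2 * (n * Real.log n) := by
    rw [div_mul_eq_mul_div, le_div_iff₀ hl]
    linarith
  have h5 : (26 * Fintype.card N + 18) / Real.log 2 * (n * Real.log n) =
      (26 * Fintype.card N + 4) / Real.log 2 * (n * Real.log n) +
        14 / Real.log 2 * (n * Real.log n) := by ring
  rw [h5]
  linarith

variable {φ : Policy T N} {wt : T → ℝ} {R : N → Recurrence} {k : ℕ}

theorem generate_allRuns (hG : G.IsBCNF) (hU : G.TreeUnique G.start) (hwt : ∀ a, 0 < wt a)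
    (hR : G.Computes wt R) (hn : 0 < n) (hk : k ≤ (G.words n).ncard) :
    (generate G R φ n k).AllRuns fun out ops => ∃ o : Output T N, out = some o ∧ o.Inv G φ n wt ∧
      o.words.length = k ∧ o.numbers R ≤ (∑ A, (R A).size) + Fintype.card N * (n + 1) + 2 * k ∧
      (ops : ℝ) ≤ (n + 1) * (∑ A, (R A).termCost : ℕ) +
        k * (G.wordPot [ISym.non G.start n] + 2 * n * Fintype.card N + 4) := by
  obtain ⟨o₀, c, hwords, htree, hinv, hlen, hc, hruns, -⟩ := generate_eq hR φ
  rw [hruns]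
  refine (generateLoop_allRuns hG hU hn hwt hinv (by simpa [hwords] using hk)).mono ?_
  rintro _ d ⟨o, rfl, h1, h2, h3, -, h5, h6⟩
  refine ⟨o, rfl, h1, by simpa [hwords] using h3, ?_, ?_⟩
  · have hmem : o.tree.mem.length ≤ 2 * k := by simpa [htree, WTree.empty] using h5
    simp only [Output.numbers, h2, hlen, Finset.sum_const, Finset.card_univ, smul_eq_mul]
    omega
  · have : (c : ℝ) ≤ (n + 1) * (∑ A, (R A).termCost : ℕ) := by exact_mod_cast hc
    push_cast at this ⊢
    linarith

/-- The complexity and the correctness of the algorithm. -/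
theorem generate_spec (hG : G.IsBCNF) (hU : G.TreeUnique G.start) :
    ∃ b : ℝ, ∀ wt : T → ℝ, (∀ a, 0 < wt a) →
      ∃ (c : ℝ) (R : N → Recurrence), G.Computes wt R ∧
        ∀ (φ : Policy T N) (n k : ℕ), 0 < n → 0 < k → k ≤ (G.words n).ncard →
          ((generate G R φ n k).AllRuns fun out ops => ∃ o : Output T N, out = some o ∧
            o.words.length = k ∧ o.words.Nodup ∧ (∀ w ∈ o.words, w ∈ G.words n) ∧
            (ops : ℝ) ≤ c * (n * Fintype.card N) + b * (k * (n * Real.log n)) ∧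
            (o.numbers R : ℝ) ≤ c * (n * Fintype.card N) + b * k ∧
            n + k ≤ o.tree.nodes.card ∧
            (o.tree.nodes.card : ℝ) ≤ b * (n * k)) ∧
          (∀ σ : Fin k → List T, Function.Injective σ → (∀ i, σ i ∈ G.words n) →
            (generate G R φ n k).prob {out | ∃ o : Output T N, out = some o ∧
                o.words = List.ofFn σ} =
              ENNReal.ofReal (∏ i, wordWeight wt (σ i) /
                (langWeight wt (G.words n) - ∑ j ∈ Finset.Iio i, wordWeight wt (σ j)))) := by
  classical
  have hl := Real.log_pos one_lt_two
  have hN : (1 : ℝ) ≤ Fintype.card N := by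
    exact_mod_cast Fintype.card_pos_iff.2 ⟨G.start⟩
  set K : ℝ := (Fintype.card N : ℝ) with hK
  -- The first summand is the constant of `cost_le` for one word of length at least 2. The second
  -- covers the 2k K n + k nodes of the tree and the 2k cells, with room to spare.
  refine ⟨(26 * K + 18) / Real.log 2 + (2 * K + 3), fun wt hwt => ?_⟩
  obtain ⟨R, hR⟩ := hG.exists_computes wt hU
  set s : ℝ := ((∑ A, (R A).size : ℕ) : ℝ) with hs
  set τ : ℝ := ((∑ A, (R A).termCost : ℕ) : ℝ) with hτ
  set ν : ℝ := ((G.words 1).ncard : ℝ) with hν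
  have hs0 : 0 ≤ s := Nat.cast_nonneg _
  have hτ0 : 0 ≤ τ := Nat.cast_nonneg _
  have hν0 : 0 ≤ ν := Nat.cast_nonneg _
  -- `s` pays for storing the recurrences, `2 * τ` for filling the tables, as n + 1 ≤ 2n, and 2 for
  -- their entries. The last term is for n = 1.
  refine ⟨s + 2 + 2 * τ + ν * (26 * K + 4), R, hR, fun φ n k hn hk hkn => ⟨?_, ?_⟩⟩
  · refine (generate_allRuns hG hU hwt hR hn hkn).mono ?_
    rintro _ ops ⟨o, rfl, hinv, hlen, hnum, hops⟩
    have hcardF : o.words.toFinset.card = k := by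
      rw [List.toFinset_card_of_nodup hinv.nodup, hlen]
    have hF : ∀ w ∈ o.words.toFinset, w ∈ G.words n := fun w hw =>
      hinv.mem_words w (by simpa using hw)
    have hn1 : (1 : ℝ) ≤ n := by exact_mod_cast hn
    have hk1 : (1 : ℝ) ≤ k := by exact_mod_cast hk
    have hlog : 0 ≤ Real.log n := Real.log_natCast_nonneg n
    have hnK : (n : ℝ) ≤ n * K := le_mul_of_one_le_right (by linarith) hN
    have hb0 : 0 ≤ (26 * K + 18) / Real.log 2 := by positivity
    have hc0 : 0 ≤ ν * (26 * K + 4) := by positivity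
    refine ⟨o, rfl, hlen, hinv.nodup, hinv.mem_words, ?_, ?_, ?_, ?_⟩
    · have e1 : (n + 1 : ℝ) * τ ≤ 2 * τ * (n * K) := by nlinarith
      have e2 : k * (G.wordPot [ISym.non G.start n] + 2 * n * K + 4) ≤
          ν * (26 * K + 4) * (n * K) + (26 * K + 18) / Real.log 2 * (k * (n * Real.log n)) := by
        -- For n = 1 the factor log n vanishes and the term with `b` pays for nothing. But then k is
        -- at most the number `ν` of words of length 1, a constant of the grammar, so the draws are
        -- charged to `c`.
        rcases (show n = 1 ∨ 2 ≤ n by omega) with rfl | h2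
        · have h3 := wordPot_start_le hG hU one_pos
          have h4 : (k : ℝ) ≤ ν := Nat.cast_le.2 hkn
          rw [← hK] at h3
          simp only [Nat.cast_one, Real.log_one, mul_zero, mul_one, one_mul, add_zero] at h3 ⊢
          calc (k : ℝ) * (G.wordPot [ISym.non G.start 1] + 2 * K + 4)
              ≤ k * (26 * K + 4) := by gcongr; linarith
            _ ≤ ν * (26 * K + 4) := by gcongr
            _ ≤ ν * (26 * K + 4) * K := le_mul_of_one_le_right (by positivity) hN
        · have h3 := mul_le_mul_of_nonneg_left (cost_le hG hU h2) (Nat.cast_nonneg (α := ℝ) k)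
          rw [← hK] at h3
          have h4 : 0 ≤ ν * (26 * K + 4) * (n * K) := by positivity
          linarith
      have e3 : 0 ≤ (2 * K + 3) * (k * (n * Real.log n)) := by positivity
      have e4 : 0 ≤ (s + 2) * (n * K) := by positivity
      linarith
    · have e1 : (o.numbers R : ℝ) ≤ s + K * (n + 1) + 2 * k := by
        rw [hs, hK]
        exact_mod_cast hnum
      have e2 : s ≤ s * (n * K) := le_mul_of_one_le_right hs0 (by linarith)
      have e3 : K ≤ n * K := le_mul_of_one_le_left (by linarith) hn1
      have e4 : 0 ≤ (2 * τ + ν * (26 * K + 4)) * (n * K) := by positivity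
      have e5 : 0 ≤ ((26 * K + 18) / Real.log 2 + (2 * K + 1)) * k := by positivity
      linarith
    · rw [← hcardF]
      exact hinv.tree.le_card_nodes hG hU hn hF (Finset.card_pos.1 (by omega))
    · have e1 : (o.tree.nodes.card : ℝ) ≤ k * (2 * n * K + 1) := by
        have := hinv.tree.card_nodes_le hG hU hn hF
        rw [hcardF] at this
        rw [hK]
        exact_mod_cast this
      have e2 : (k : ℝ) ≤ n * k := le_mul_of_one_le_left (by linarith) hn1
      have e3 : 0 ≤ ((26 * K + 18) / Real.log 2 + 2) * (n * k) := by positivity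
      linarith
  · intro σ hσ hσn
    obtain ⟨o, c, hwords, -, hinv, -, -, -, hprob⟩ := generate_eq hR φ
    rw [hprob]
    have := generateLoop_prob hG hU hn hwt hinv (by simpa [hwords] using hkn) σ hσ hσn
      (by simp [hwords])
    simpa [hwords, iWeight, symWeight, words_eq] using this

end

noncomputable section
open Prog BGrammar

/-! ## A grammar with large trees -/

/-- If no node besides the root lies above two words, the walks are disjoint apart from the root,
and each contributes at least n nodes of its own. -/
theorem WTree.Inv.mul_le_card_nodes {T N : Type} [Fintype N] {G : BGrammar T N} {φ : Policy T N}
    {n : ℕ} {wt : T → ℝ} {F : Finset (List T)} {t : WTree T N} (h : t.Inv G φ n wt F)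
    (hG : G.IsBCNF) (hU : G.TreeUnique G.start) (hn : 0 < n) (hF : ∀ w ∈ F, w ∈ G.words n)
    (hdis : ∀ v w w', G.Reach φ n v → v ≠ [ISym.non G.start n] → G.Der φ v w → G.Der φ v w' →
      w = w') : F.card * n ≤ t.nodes.card := by
  classical
  choose S hS hcard _ using fun w : F => hG.exists_finset_walk (φ := φ) hU hn (hF w w.2)
  have hsub : (F.attach.biUnion fun w => (S w).erase [ISym.non G.start n]) ⊆ t.nodes := by
    intro v hv
    obtain ⟨w, -, hv⟩ := Finset.mem_biUnion.1 hv
    obtain ⟨hr, hd⟩ := (hS w v).1 (Finset.mem_of_mem_erase hv)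
    exact (h.mem_nodes v).2 ⟨hr, w, w.2, hd⟩
  refine le_trans ?_ (Finset.card_le_card hsub)
  rw [Finset.card_biUnion, ← Finset.card_attach, ← smul_eq_mul]
  · refine Finset.card_nsmul_le_sum _ _ _ fun w _ => ?_
    have h1 := Finset.pred_card_le_card_erase (s := S w) (a := [ISym.non G.start n])
    have h2 := hcard w
    omega
  · intro w _ w' _ hne
    rw [Function.onFun, Finset.disjoint_left]
    intro v hv hv'
    obtain ⟨hvr, hv⟩ := Finset.mem_erase.1 hv
    obtain ⟨hr, hd⟩ := (hS w v).1 hv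
    exact hne (Subtype.ext (hdis v w w' hr hvr hd ((hS w' v).1 (Finset.mem_of_mem_erase hv')).2))

theorem Output.Inv.mul_le_card_nodes {T N : Type} [Fintype N] {G : BGrammar T N}
    {φ : Policy T N} {n : ℕ} {wt : T → ℝ} {o : Output T N} (h : o.Inv G φ n wt) (hG : G.IsBCNF)
    (hU : G.TreeUnique G.start) (hn : 0 < n)
    (hdis : ∀ v w w', G.Reach φ n v → v ≠ [ISym.non G.start n] → G.Der φ v w → G.Der φ v w' →
      w = w') : o.words.length * n ≤ o.tree.nodes.card := by
  classical
  have := h.tree.mul_le_card_nodes hG hU hn (fun w hw => h.mem_words w (by simpa using hw)) hdis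
  rwa [List.toFinset_card_of_nodup h.nodup] at this

open Classical in
/-- A derivation policy. -/
def somePolicy (T N : Type) : Policy T N where
  pos ω := if h : ∃ i A m, ω[i]? = some (ISym.non A m) then some h.choose else none
  pos_none ω := by
    rw [dite_eq_right_iff]
    simp only [reduceCtorEq, imp_false, not_exists]
    constructor
    · intro h A m hm
      obtain ⟨i, hi⟩ := List.mem_iff_getElem?.1 hm
      exact h i A m hi
    · exact fun h i A m hi => h A m (List.mem_of_getElem? hi)
  pos_some ω i hi := by
    split_ifs at hi with h
    obtain rfl := Option.some.inj hi
    exact h.choose_spec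

/-- The grammar of the words `xx⋯xyy⋯y`, where `x = false` and `y = true`. The nonterminal
`some (x, 1)` stands for the nonempty powers of `x`, its operands `some (x, 0)` and `some (x, 2)` in
a union for `x` and for the powers of exponent at least two. -/
def blocks : BGrammar Bool (Option (Bool × Fin 3)) where
  start := none
  rule
    | none => BRule.product (some (false, 1)) (some (true, 1))
    | some (x, 0) => BRule.terminal x
    | some (x, 1) => BRule.union (some (x, 0)) (some (x, 2))
    | some (x, 2) => BRule.product (some (x, 0)) (some (x, 1))

namespace blocks

/-- The parse tree of a letter. -/
def letter (x : Bool) : PTree Bool (Option (Bool × Fin 3)) := PTree.un (some (x, 0)) (PTree.leaf x)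

/-- The parse tree of a nonempty power of a letter. -/
def power (x : Bool) : ℕ → PTree Bool (Option (Bool × Fin 3))
  | 0 => PTree.un (some (x, 1)) (letter x)
  | l + 1 => PTree.un (some (x, 1)) (PTree.bin (some (x, 2)) (letter x) (power x l))

theorem yield_power (x : Bool) (l : ℕ) : (power x l).yield = List.replicate (l + 1) x := by
  induction l with
  | zero => rfl
  | succ l ih => simp [power, PTree.yield, letter, ih, List.replicate_succ]

theorem root_power (x : Bool) (l : ℕ) : (power x l).root = ISym.non (some (x, 1)) (l + 1) := by
  have h := congrArg List.length (yield_power x l)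
  cases l <;> simp_all [power, PTree.root, PTree.yield]

theorem valid_letter (x : Bool) : (letter x).Valid blocks := by
  simp [letter, PTree.Valid, Expands, blocks, PTree.yield, PTree.root]

theorem valid_long {x : Bool} {l : ℕ} (h : (power x l).Valid blocks) :
    (PTree.bin (some (x, 2)) (letter x) (power x l)).Valid blocks := by
  refine ⟨⟨1, le_rfl, ?_, ?_⟩, valid_letter x, h⟩
  · simp [yield_power, letter, PTree.yield]
  · rw [root_power]
    simp [yield_power, letter, PTree.yield, PTree.root]

theorem valid_power (x : Bool) (l : ℕ) : (power x l).Valid blocks := by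
  induction l with
  | zero => exact ⟨Or.inl rfl, valid_letter x⟩
  | succ l ih =>
    refine ⟨Or.inr ?_, valid_long ih⟩
    simp [PTree.root, PTree.yield]

theorem valid_start (i j : ℕ) :
    (PTree.bin none (power false i) (power true j)).Valid blocks := by
  refine ⟨⟨i + 1, by simp, ?_, ?_⟩, valid_power _ _, valid_power _ _⟩
  · simp [yield_power]
  · simp [root_power, yield_power]

theorem eq_letter {τ : PTree Bool (Option (Bool × Fin 3))} (h : τ.Valid blocks) {x : Bool} {m : ℕ}
    (hr : τ.root = ISym.non (some (x, 0)) m) : τ = letter x := by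
  cases τ with
  | leaf t => simp [PTree.root] at hr
  | nil A =>
    simp only [PTree.root, ISym.non.injEq] at hr
    obtain ⟨rfl, rfl⟩ := hr
    simp [PTree.Valid, Expands, blocks] at h
  | un A c =>
    simp only [PTree.root, ISym.non.injEq] at hr
    obtain ⟨rfl, rfl⟩ := hr
    simp only [PTree.Valid, Expands, blocks] at h
    rw [PTree.root_eq_ter (List.singleton_injective h.1.2)]
    rfl
  | bin A l r =>
    simp only [PTree.root, ISym.non.injEq] at hr
    obtain ⟨rfl, rfl⟩ := hr
    simp [PTree.Valid, Expands, blocks] at h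

theorem eq_long {τ : PTree Bool (Option (Bool × Fin 3))} (h : τ.Valid blocks) {x : Bool} {m : ℕ}
    (hr : τ.root = ISym.non (some (x, 2)) m) : ∃ r, τ = PTree.bin (some (x, 2)) (letter x) r ∧
      r.Valid blocks ∧ ∃ j, r.root = ISym.non (some (x, 1)) j := by
  cases τ with
  | leaf t => simp [PTree.root] at hr
  | nil A =>
    simp only [PTree.root, ISym.non.injEq] at hr
    obtain ⟨rfl, rfl⟩ := hr
    simp [PTree.Valid, Expands, blocks] at h
  | un A c =>
    simp only [PTree.root, ISym.non.injEq] at hr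
    obtain ⟨rfl, rfl⟩ := hr
    simp [PTree.Valid, Expands, blocks] at h
  | bin A l r =>
    simp only [PTree.root, ISym.non.injEq] at hr
    obtain ⟨rfl, rfl⟩ := hr
    simp only [PTree.Valid, Expands, blocks] at h
    obtain ⟨⟨i, -, -, h1⟩, hl, hr⟩ := h
    simp only [List.cons.injEq, and_true] at h1
    exact ⟨r, by rw [eq_letter hl h1.1], hr, _, h1.2⟩

/-- Induction on the size: the first alternative of the union ends the power, the second one puts a
letter in front of a smaller tree of the same kind. -/
theorem eq_power {τ : PTree Bool (Option (Bool × Fin 3))} (h : τ.Valid blocks) {x : Bool} {m : ℕ}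
    (hr : τ.root = ISym.non (some (x, 1)) m) : ∃ l, τ = power x l := by
  induction hk : τ.count using Nat.strong_induction_on generalizing τ m with
  | _ k ih =>
    cases τ with
    | leaf t => simp [PTree.root] at hr
    | nil A =>
      simp only [PTree.root, ISym.non.injEq] at hr
      obtain ⟨rfl, rfl⟩ := hr
      simp [PTree.Valid, Expands, blocks] at h
    | un A c =>
      simp only [PTree.root, ISym.non.injEq] at hr
      obtain ⟨rfl, rfl⟩ := hr
      simp only [PTree.Valid, Expands, blocks] at h
      rcases h.1 with h1 | h1
      · rw [eq_letter h.2 (List.singleton_injective h1)]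
        exact ⟨0, rfl⟩
      · obtain ⟨r, rfl, hr, j, hj⟩ := eq_long h.2 (List.singleton_injective h1)
        obtain ⟨l, rfl⟩ := ih r.count (by simp only [PTree.count] at hk; omega) hr hj rfl
        exact ⟨l + 1, rfl⟩
    | bin A l r =>
      simp only [PTree.root, ISym.non.injEq] at hr
      obtain ⟨rfl, rfl⟩ := hr
      simp [PTree.Valid, Expands, blocks] at h

theorem yield_of_root {τ : PTree Bool (Option (Bool × Fin 3))} (h : τ.Valid blocks) {x : Bool}
    {m : ℕ} (hr : τ.root = ISym.non (some (x, 1)) m) : τ.yield = List.replicate m x := by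
  obtain ⟨l, rfl⟩ := eq_power h hr
  rw [root_power, ISym.non.injEq] at hr
  rw [yield_power, hr.2]

theorem eq_start {τ : PTree Bool (Option (Bool × Fin 3))} (h : τ.Valid blocks) {m : ℕ}
    (hr : τ.root = ISym.non none m) : ∃ i j, τ = PTree.bin none (power false i) (power true j) := by
  cases τ with
  | leaf t => simp [PTree.root] at hr
  | nil A =>
    simp only [PTree.root, ISym.non.injEq] at hr
    obtain ⟨rfl, rfl⟩ := hr
    simp [PTree.Valid, Expands, blocks] at h
  | un A c =>
    simp only [PTree.root, ISym.non.injEq] at hr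
    obtain ⟨rfl, rfl⟩ := hr
    simp [PTree.Valid, Expands, blocks] at h
  | bin A l r =>
    simp only [PTree.root, ISym.non.injEq] at hr
    obtain ⟨rfl, rfl⟩ := hr
    simp only [PTree.Valid, Expands, blocks] at h
    obtain ⟨⟨i, -, -, h1⟩, hl, hr⟩ := h
    simp only [List.cons.injEq, and_true] at h1
    obtain ⟨i, rfl⟩ := eq_power hl h1.1
    obtain ⟨j, rfl⟩ := eq_power hr h1.2
    exact ⟨i, j, rfl⟩

/-- A tree is given by the two exponents, which the yield reveals as numbers of occurrences. -/
theorem treeUnique : blocks.TreeUnique blocks.start := by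
  intro τ τ' m h h' hr hr' hy
  obtain ⟨i, j, rfl⟩ := eq_start h hr
  obtain ⟨i', j', rfl⟩ := eq_start h' hr'
  simp only [PTree.yield, yield_power] at hy
  have h1 := congrArg (List.count false) hy
  have h2 := congrArg (List.count true) hy
  simp [List.count_replicate] at h1 h2
  rw [h1, h2]

/-- There are no epsilon rules, so a production never empties a sentential form. -/
theorem nil_notMem_lang (A : Option (Bool × Fin 3)) : [] ∉ blocks.lang A := by
  intro h
  have key : ∀ u v, blocks.toCFG.Derives u v → u ≠ [] → v ≠ [] := by
    intro u v h hu
    induction h with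
    | refl => exact hu
    | tail _ hp _ =>
      obtain ⟨A, o, ho, p, q, -, rfl⟩ := produces_iff.1 hp
      have : o ≠ [] := by
        rintro rfl
        rcases A with _ | ⟨x, i⟩
        · simp [blocks, BRule.outputs] at ho
        · fin_cases i <;> simp [blocks, BRule.outputs] at ho
      exact List.append_ne_nil_of_left_ne_nil (List.append_ne_nil_of_right_ne_nil _ this) _
  exact key _ _ h (List.cons_ne_nil _ _) rfl

theorem isBCNF : blocks.IsBCNF where
  union_ne A B C h := by
    rcases A with _ | ⟨x, i⟩
    · simp [blocks] at h
    · fin_cases i <;> simp [blocks] at h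
      obtain ⟨rfl, rfl⟩ := h
      simp
  productive A := by
    rcases A with _ | ⟨x, i⟩
    · exact ⟨_, (valid_start 0 0).mem_lang rfl⟩
    · fin_cases i
      · exact ⟨_, (valid_letter x).mem_lang rfl⟩
      · exact ⟨_, (valid_power x 0).mem_lang rfl⟩
      · exact ⟨_, (valid_long (valid_power x 0)).mem_lang rfl⟩
  epsilon_not_selfRef E h := by
    rcases E with _ | ⟨x, i⟩
    · simp [blocks] at h
    · fin_cases i <;> simp [blocks] at h
  product_pos _ B C _ := ⟨nil_notMem_lang B, nil_notMem_lang C⟩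

theorem mem_words (i j : ℕ) :
    List.replicate (i + 1) false ++ List.replicate (j + 1) true ∈ blocks.words (i + 1 + (j + 1)) := by
  rw [words_eq, isBCNF.mem_langLen]
  refine ⟨_, valid_start i j, ?_, ?_⟩
  · simp [PTree.root, yield_power, blocks]
  · simp [PTree.yield, yield_power]

/-- The exponent of the first letter ranges over 1, …, n - 1. The truncated subtraction in the
second exponent is harmless: it is exact in this range, and injectivity is read off the first letter
alone. -/
theorem le_ncard_words (n : ℕ) : n - 1 ≤ (blocks.words n).ncard := by
  have hinj : Function.Injective fun i : ℕ =>
      List.replicate (i + 1) false ++ List.replicate (n - 2 - i + 1) true := by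
    intro i j h
    have := congrArg (List.count false) h
    simpa [List.count_replicate] using this
  have hsub : (fun i : ℕ => List.replicate (i + 1) false ++ List.replicate (n - 2 - i + 1) true) ''
      (Finset.range (n - 1) : Set ℕ) ⊆ blocks.words n := by
    rintro _ ⟨i, hi, rfl⟩
    have hi : i < n - 1 := by simpa using hi
    have := mem_words i (n - 2 - i)
    rwa [show i + 1 + (n - 2 - i + 1) = n by omega] at this
  have := Set.ncard_le_ncard hsub (isBCNF.finite_langLen _ _)
  rwa [Set.ncard_image_of_injective _ hinj, Set.ncard_coe_finset, Finset.card_range] at this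

/-- The first atomic derivation splits n into the two exponents, and each operand has only one word
of a given length. Below the root everything is thus determined, for any policy. -/
theorem eq_of_der {φ : Policy Bool (Option (Bool × Fin 3))} {n : ℕ}
    {v : IWord Bool (Option (Bool × Fin 3))} {w w' : List Bool} (hr : blocks.Reach φ n v)
    (hv : v ≠ [ISym.non blocks.start n]) (hd : blocks.Der φ v w) (hd' : blocks.Der φ v w') :
    w = w' := by
  rcases Relation.ReflTransGen.cases_head hr with rfl | ⟨c, hc, hcv⟩
  · exact absurd rfl hv
  obtain ⟨ω₁, A, m, ω₂, x, h, -, hx, rfl⟩ := step_iff.1 hc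
  obtain ⟨rfl, h', rfl⟩ : ω₁ = [] ∧ ISym.non blocks.start n = ISym.non A m ∧ ω₂ = [] := by
    rcases ω₁ with _ | ⟨s, ω₁⟩
    · exact ⟨rfl, (List.cons.inj h).1, (List.cons.inj h).2.symm⟩
    · simpa using congrArg List.length h
  obtain ⟨rfl, rfl⟩ := ISym.non.inj h'
  obtain ⟨i, -, -, rfl⟩ : ∃ i, 1 ≤ i ∧ i < n ∧ x = [ISym.non (some (false, 1)) i,
      ISym.non (some (true, 1)) (n - i)] := hx
  have key : ∀ w, blocks.Der φ v w → w = List.replicate i false ++ List.replicate (n - i) true := by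
    intro w hd
    obtain ⟨p, h1, h2, h3⟩ := Der.exists_isPath (Relation.ReflTransGen.trans hcv hd)
    obtain ⟨p, rfl⟩ := List.head?_eq_some_iff.1 h1
    obtain ⟨F, hF, hroot, rfl, -⟩ := PTree.exists_run_of_isChain h2 h3
    match F with
    | [τ₁, τ₂] =>
      simp only [List.map_cons, List.map_nil, List.nil_append, List.append_nil, List.cons.injEq,
        and_true] at hroot
      simp [yield_of_root (hF τ₁ (by simp)) hroot.1, yield_of_root (hF τ₂ (by simp)) hroot.2]
    | [] | [_] | _ :: _ :: _ :: _ => simp at hroot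
  rw [key w hd, key w' hd']

end blocks

theorem blocks_spec (φ : Policy Bool (Option (Bool × Fin 3))) {wt : Bool → ℝ} (hwt : ∀ a, 0 < wt a)
    {R : Option (Bool × Fin 3) → Recurrence} (hR : blocks.Computes wt R) {n k : ℕ} (hn : 0 < n)
    (hk : k ≤ (blocks.words n).ncard) :
    (generate blocks R φ n k).AllRuns fun out _ =>
      ∃ o : Output Bool (Option (Bool × Fin 3)), out = some o ∧
        (1 : ℝ) * (n * k) ≤ (o.tree.nodes.card : ℝ) := by
  refine (generate_allRuns blocks.isBCNF blocks.treeUnique hwt hR hn hk).mono ?_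
  rintro _ c ⟨o, rfl, hinv, hlen, -, -⟩
  have := hinv.mul_le_card_nodes blocks.isBCNF blocks.treeUnique hn fun v w w' => blocks.eq_of_der
  rw [hlen] at this
  refine ⟨o, rfl, ?_⟩
  rw [one_mul, mul_comm]
  exact_mod_cast this

end

theorem mainTheorem1 :
    (∀ (T N : Type) [Fintype N] (G : BGrammar T N), G.IsBCNF → G.IsUnambiguous →
      ∃ b : ℝ, ∀ wt : T → ℝ, (∀ a, 0 < wt a) →
        ∃ (c : ℝ) (R : N → Recurrence), G.Computes wt R ∧
          ∀ (φ : Policy T N) (n k : ℕ), 0 < n → 0 < k → k ≤ (G.words n).ncard →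
            ((generate G R φ n k).AllRuns fun out ops => ∃ o : Output T N, out = some o ∧
              o.words.length = k ∧ o.words.Nodup ∧ (∀ w ∈ o.words, w ∈ G.words n) ∧
              (ops : ℝ) ≤ c * (n * Fintype.card N) + b * (k * (n * Real.log n)) ∧
              (o.numbers R : ℝ) ≤ c * (n * Fintype.card N) + b * k ∧
              n + k ≤ o.tree.nodes.card ∧
              (o.tree.nodes.card : ℝ) ≤ b * (n * k)) ∧
            (∀ σ : Fin k → List T, Function.Injective σ → (∀ i, σ i ∈ G.words n) →
              (generate G R φ n k).prob {out | ∃ o : Output T N, out = some o ∧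
                  o.words = List.ofFn σ} =
                ENNReal.ofReal (∏ i, wordWeight wt (σ i) /
                  (langWeight wt (G.words n) - ∑ j ∈ Finset.Iio i, wordWeight wt (σ j))))) ∧
    (∃ (T N : Type) (_ : Fintype N) (G : BGrammar T N) (φ : Policy T N) (ε : ℝ),
      G.IsBCNF ∧ G.IsUnambiguous ∧ 0 < ε ∧ (∀ k, ∃ n₀, ∀ n ≥ n₀, k ≤ (G.words n).ncard) ∧
      ∀ wt : T → ℝ, (∀ a, 0 < wt a) → ∀ R : N → Recurrence, G.Computes wt R →
        ∀ n k : ℕ, 0 < n → 0 < k → k ≤ (G.words n).ncard →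
          (generate G R φ n k).AllRuns fun out _ => ∃ o : Output T N, out = some o ∧
            ε * (n * k) ≤ (o.tree.nodes.card : ℝ)) := by
  refine ⟨fun T N _ G hG hA => generate_spec hG hA.treeUnique_start,
    Bool, Option (Bool × Fin 3), inferInstance, blocks, somePolicy _ _, 1, blocks.isBCNF,
    blocks.treeUnique.isUnambiguous (somePolicy _ _), one_pos,
    fun k => ⟨k + 1, fun n hn => le_trans (by omega) (blocks.le_ncard_words n)⟩,
    fun wt hwt R hR n k hn _ hk => blocks_spec _ hwt hR hn hk⟩
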